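/- All graphs are nonempty, finite and loopless, with vertices labelled $1,\dots,n$ and a total order on the edges. For graphs $G_1,G_2$ with $k_1,k_2$ vertices, $G_1+G_2$ is the graph on $[k_1+k_2-1]$ with edge set $E(G_1)\cup\{\{i+k_1-1,j+k_1-1\}:\{i,j\}\in E(G_2)\}$, where the orders on the edges of $G_1$ and of $G_2$ are kept and every edge of $G_1$ is smaller than every edge of $G_2$. For $a\ge 2$ the cycle $C_a$ has vertex set $[a]$ and edges $\{1,2\}<\cdots<\{a-1,a\}<\{a,1\}$ ($C_2$ is a single edge). A clique $K_a$, $a\ge1$, is the complete graph on $[a]$, with any ordering of its edges. An adjacent cycle+clique chain is a graph $G_1+\cdots+G_m$ with $m\ge 1$ in which each $G_i$ is a cycle or a clique. A broken circuit of $G$ is a cycle of $G$ with its largest edge removed. A non-broken circuit is a spanning subgraph of $G$ that contains no broken circuit; it is a forest. A forest triple of $G$ is a set $\mathcal F=\{(T_1,\alpha^{(1)},r_1),\dots,(T_m,\alpha^{(m)},r_m)\}$ where $T_1,\dots,T_m$ are the connected components (trees) of some non-broken circuit of $G$, $\alpha^{(i)}$ is a composition of $|V(T_i)|$, and $1\le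 r_i\le\alpha^{(i)}_1$. Its type is the partition of $n$ formed by all parts of all $\alpha^{(i)}$, its sign is $(-1)^{\sum_i(\ell(\alpha^{(i)})-1)}$, and it is unit if $\ell(\alpha^{(i)})=1$ for all $i$. Let $\mathrm{FT}(G)$ be the set of forest triples of $G$. A first-preserving involution is an involution $\varphi:\mathrm{FT}(G)\to\mathrm{FT}(G)$ that preserves type, changes the sign of each forest triple that it does not fix, has only unit fixed points (which therefore have sign $1$), and such that for all $\mathcal F$ the tree triples $(T,\alpha,r)\in\mathcal F$ and $(T',\alpha',r')\in\varphi(\mathcal F)$ whose trees contain the vertex $1$ satisfy $\alpha_1=\alpha_1'$ and $r=r'$. The chromatic symmetric function of a graph $G$ on $n$ vertices is $X_G=\sum_\kappa\prod_{v} x_{\kappa(v)}$, the sum over all proper colorings $\kappa:V(G)\to\mathbb N$, and $G$ is $e$-positive if $X_G=\sum_{\lambda\vdash n}c_\lambda e_\lambda$ with all $c_\lambda\ge 0$, where $e_\lambda$ are the elementary symmetric functions. **Corollary.** Let $G$ be an adjacent cycle+clique chain. Then $\mathrm{FT}(G)$ has a first-preserving involution, and $G$ is $e$-positive. -/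

import Mathlib

/-! ### The chromatic symmetric function and e-positivity -/

/-- The chromatic symmetric function `X_G = ∑_κ ∏_v x_{κ(v)}` (sum over all proper colorings
`κ : V → ℕ`), as a formal power series in the variables `x_0, x_1, …`: the coefficient of the
monomial `d` is the (finite) number of proper colorings `κ` with `∏_v x_{κ(v)} = x ^ d`. -/
noncomputable def SimpleGraph.chromaticSymmetricFunction {V : Type*} [Fintype V]
    (G : SimpleGraph V) : MvPowerSeries ℕ ℤ :=
  fun d => (Nat.card {κ : G.Coloring ℕ // ∑ v, Finsupp.single (κ v) 1 = d} : ℤ)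

open Classical in
/-- The elementary symmetric function `e_k = ∑_{i_1 < ⋯ < i_k} x_{i_1} ⋯ x_{i_k}`: its monomials
are the squarefree monomials of degree `k`, each with coefficient `1`. -/
noncomputable def elementarySymm (k : ℕ) : MvPowerSeries ℕ ℤ :=
  fun d => if (∀ i, d i ≤ 1) ∧ d.degree = k then 1 else 0

/-- `e_λ = ∏_i e_{λ_i}` for a partition `λ`. -/
noncomputable def elementarySymmPartition {n : ℕ} (p : n.Partition) : MvPowerSeries ℕ ℤ :=
  (p.parts.map elementarySymm).prod

/-- `G` is `e`-positive: `X_G` is a combination of the `e_λ`, with `λ` ranging over the partitions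
of the number of vertices, with non-negative coefficients. -/
def SimpleGraph.EPositive {V : Type*} [Fintype V] (G : SimpleGraph V) : Prop :=
  ∃ c : (Fintype.card V).Partition → ℤ,
    G.chromaticSymmetricFunction = ∑ p, c p • elementarySymmPartition p ∧ ∀ p, 0 ≤ c p

/-! ### Labelled graphs with ordered edges -/

/-- A nonempty finite loopless graph with vertices labelled `0, …, last` (so it has `last + 1`
vertices) and a total order on its edges: `edges` lists the edges in increasing order. -/
structure OrderedGraph where
  last : ℕ
  edges : List (Sym2 (Fin (last + 1)))
  nodup : edges.Nodup
  loopless : ∀ e ∈ edges, ¬ e.IsDiag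

namespace OrderedGraph

/-- The vertex set. -/
abbrev Vertex (G : OrderedGraph) : Type := Fin (G.last + 1)

/-- The underlying simple graph. -/
def graph (G : OrderedGraph) : SimpleGraph G.Vertex :=
  SimpleGraph.fromEdgeSet {e | e ∈ G.edges}

/-- The inclusion of the vertices of `G₁` into those of `G₁ + G₂`. -/
def inl (a b : ℕ) (i : Fin (a + 1)) : Fin (a + b + 1) := ⟨i, by omega⟩

/-- The inclusion of the vertices of `G₂` into those of `G₁ + G₂`. -/
def inr (a b : ℕ) (j : Fin (b + 1)) : Fin (a + b + 1) := ⟨j + a, by omega⟩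

theorem inl_injective (a b : ℕ) : Function.Injective (inl a b) := by
  intro i j h
  simpa [inl, Fin.ext_iff] using h

theorem inr_injective (a b : ℕ) : Function.Injective (inr a b) := by
  intro i j h
  simpa [inr, Fin.ext_iff] using h

/-- `G₁ + G₂`: the last vertex of `G₁` is identified with the first vertex of `G₂`, the labels of
`G₂` are shifted accordingly, and the edges of `G₁` precede those of `G₂`. -/
def glue (G₁ G₂ : OrderedGraph) : OrderedGraph where
  last := G₁.last + G₂.last
  edges := G₁.edges.map (Sym2.map (inl G₁.last G₂.last)) ++
    G₂.edges.map (Sym2.map (inr G₁.last G₂.last))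
  nodup := by
    refine List.Nodup.append
      (G₁.nodup.map (Sym2.map.injective (inl_injective _ _)))
      (G₂.nodup.map (Sym2.map.injective (inr_injective _ _))) ?_
    intro e h₁ h₂
    obtain ⟨e₁, he₁, rfl⟩ := List.mem_map.1 h₁
    obtain ⟨e₂, he₂, h⟩ := List.mem_map.1 h₂
    have hd := G₁.loopless e₁ he₁
    induction e₁ with | _ x y
    induction e₂ with | _ z w
    simp only [Sym2.map_mk, Sym2.eq_iff, inl, inr, Fin.ext_iff, Sym2.mk_isDiag_iff] at h hd
    omega
  loopless := by
    intro e he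
    rcases List.mem_append.1 he with he | he
    · obtain ⟨e', he', rfl⟩ := List.mem_map.1 he
      rw [Sym2.isDiag_map (inl_injective _ _)]
      exact G₁.loopless e' he'
    · obtain ⟨e', he', rfl⟩ := List.mem_map.1 he
      rw [Sym2.isDiag_map (inr_injective _ _)]
      exact G₂.loopless e' he'

instance : Add OrderedGraph := ⟨glue⟩

/-- The cycle `C_{k+1}` with `k + 1 ≥ 2` vertices, whose edges are ordered as
`{0,1} < {1,2} < ⋯ < {k-1,k} < {k,0}`; `C_2` is a single edge. -/
def cycle (k : ℕ) (hk : 1 ≤ k) : OrderedGraph where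
  last := k
  edges := (List.ofFn (fun i : Fin k => s(i.castSucc, i.succ)) ++ [s(Fin.last k, 0)]).dedup
  nodup := List.nodup_dedup _
  loopless := by
    intro e he
    rcases List.mem_append.1 (List.mem_dedup.1 he) with he | he
    · obtain ⟨i, rfl⟩ := (List.mem_ofFn' _ _).1 he
      simp [Fin.ext_iff]
    · obtain rfl := List.mem_singleton.1 he
      simp [Fin.ext_iff]
      omega

/-- `G` is a cycle, with its standard labelling and edge ordering. -/
def IsCycle (G : OrderedGraph) : Prop := ∃ (k : ℕ) (hk : 1 ≤ k), G = cycle k hk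

/-- `G` is a clique `K_a`, `a ≥ 1`, with any ordering of its edges. -/
def IsClique (G : OrderedGraph) : Prop := G.graph = ⊤

/-- `G = G_1 + ⋯ + G_m` with `m ≥ 1` and each `G_i` a cycle or a clique. -/
inductive IsCycleCliqueChain : OrderedGraph → Prop
  | single (H : OrderedGraph) (hH : H.IsCycle ∨ H.IsClique) : IsCycleCliqueChain H
  | add (H G : OrderedGraph) (hH : H.IsCycle ∨ H.IsClique) (hG : IsCycleCliqueChain G) :
      IsCycleCliqueChain (H + G)

/-! ### Forest triples -/

/-- `B` is the edge set of a broken circuit: a cycle of `G` without its largest edge. -/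
def IsBrokenCircuit (G : OrderedGraph) (B : Finset (Sym2 G.Vertex)) : Prop :=
  ∃ (v : G.Vertex) (p : G.graph.Walk v v), p.IsCycle ∧ ∃ e ∈ p.edges,
    (∀ f ∈ p.edges, G.edges.idxOf f ≤ G.edges.idxOf e) ∧ B = p.edges.toFinset.erase e

/-- `F` is the edge set of a (spanning) non-broken circuit. -/
def IsNonBroken (G : OrderedGraph) (F : Finset (Sym2 G.Vertex)) : Prop :=
  (∀ e ∈ F, e ∈ G.edges) ∧ ∀ B, G.IsBrokenCircuit B → ¬ B ⊆ F

/-- The data `(T, α, r)` of a tree triple: the vertex set and edge set of `T`, the tuple `α` and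
the integer `r`. The conditions on them are in `IsTreeTriple`. -/
structure TreeTriple (V : Type) where
  verts : Finset V
  edges : Finset (Sym2 V)
  comp : List ℕ
  r : ℕ

/-- The first part `α_1` of the composition. -/
def TreeTriple.first {V : Type} (τ : TreeTriple V) : ℕ := τ.comp.headD 0

/-- `τ = (T, α, r)` is a tree triple where `T` is one of the trees (connected components) of `F`,
`α` is a composition of `|T|`, and `1 ≤ r ≤ α_1`. -/
def IsTreeTriple {V : Type} (F : Finset (Sym2 V)) (τ : TreeTriple V) : Prop :=
  (∃ c : (SimpleGraph.fromEdgeSet (F : Set (Sym2 V))).ConnectedComponent,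
    (τ.verts : Set V) = c.supp) ∧
  (∀ e, e ∈ τ.edges ↔ e ∈ F ∧ ∀ v ∈ e, v ∈ τ.verts) ∧
  (∀ a ∈ τ.comp, 0 < a) ∧ τ.comp.sum = τ.verts.card ∧
  1 ≤ τ.r ∧ τ.r ≤ τ.first

/-- `FT(G)`: the sets of tree triples with exactly one tree triple for each of the trees of some
non-broken circuit `F`. -/
def ForestTriple (G : OrderedGraph) : Type :=
  {S : Finset (TreeTriple G.Vertex) // ∃ F : Finset (Sym2 G.Vertex), G.IsNonBroken F ∧
    (∀ τ ∈ S, IsTreeTriple F τ) ∧ ∀ v : G.Vertex, ∃! τ, τ ∈ S ∧ v ∈ τ.verts}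

namespace ForestTriple

variable {G : OrderedGraph}

/-- The type: the partition formed by all parts of all the compositions, as a multiset. -/
def type (𝓕 : G.ForestTriple) : Multiset ℕ := ∑ τ ∈ 𝓕.1, (τ.comp : Multiset ℕ)

/-- `sign(𝓕) = (-1) ^ ∑ (ℓ(α) - 1)`. -/
def sign (𝓕 : G.ForestTriple) : ℤ := (-1) ^ ∑ τ ∈ 𝓕.1, (τ.comp.length - 1)

/-- All the compositions have exactly one part. -/
def IsUnit (𝓕 : G.ForestTriple) : Prop := ∀ τ ∈ 𝓕.1, τ.comp.length = 1

/-- A sign-reversing involution on `FT(G)`. -/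
structure IsSignReversingInvolution (φ : G.ForestTriple → G.ForestTriple) : Prop where
  involutive : ∀ 𝓕, φ (φ 𝓕) = 𝓕
  type_eq : ∀ 𝓕, (φ 𝓕).type = 𝓕.type
  sign_ne : ∀ 𝓕, φ 𝓕 ≠ 𝓕 → (φ 𝓕).sign ≠ 𝓕.sign
  sign_fixed : ∀ 𝓕, φ 𝓕 = 𝓕 → 𝓕.sign = 1

/-- A first-preserving involution on `FT(G)`: a sign-reversing involution whose fixed points are
unit and which preserves `α_1` and `r` for the tree triple containing the smallest vertex. -/
structure IsFirstPreservingInvolution (φ : G.ForestTriple → G.ForestTriple) : Prop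
    extends IsSignReversingInvolution φ where
  unit_fixed : ∀ 𝓕, φ 𝓕 = 𝓕 → 𝓕.IsUnit
  first_eq : ∀ 𝓕, ∀ τ ∈ 𝓕.1, 0 ∈ τ.verts → ∀ τ' ∈ (φ 𝓕).1, 0 ∈ τ'.verts →
    τ'.first = τ.first ∧ τ'.r = τ.r

end ForestTriple

end OrderedGraph

/-! The involution is obtained by counting. Group the forest triples by their type and by the values
`α_1` and `r` at the tree of the first vertex. If in each class the number of positive triples minus
the number of negative ones lies between `0` and the number of unit triples, then that many unit
triples can be fixed and the remaining ones matched in pairs of opposite sign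
(`exists_involution_of_sum_bounds`). The lower bound also gives e-positivity, since `X_G` is the sum
of `sign(𝓕) e_{type(𝓕)}` over all forest triples.

The counts are encoded as polynomials in variables `e_1, e_2, …`, ordered coefficientwise. Let `e_0
= 1` and `E = ∑ e_n x^n`. A tree with `n` vertices away from the root contributes `p_n` to the
signed count, where `∑ p_n x^n = xE'/E`, and `n e_n` to the unit count. If `α_1 = c` and `r` are
prescribed, the root tree contributes `e_c` times the coefficient of `x^n` in `h_c = x^c/E`,
respectively in `δ_c = x^c`. Let `L` and `L'` send a weight for the root tree to the signed and unit
sums over forests. The claim becomes `0 ≤ L(h_c) ≤ L'(δ_c)` for `c ≥ 1` (`IsBounded`), and it is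
proved by induction along the chain.

By Whitney's theorem (`sum_noActiveEdge`) a sum over non-broken circuits is an alternating sum over
all edge sets. Hence the edge order is irrelevant, and vertices can be removed one at a time. Gluing
`H` in front of `G` turns the functional of `G` into weights for forests of `H` with two marked
vertices (`rootSum_add`). Write `ĝ = ∑ g(k+1) x^k`. For a clique or cycle `H` with `m + 1 ≥ 2`
vertices the sum is a constant times the coefficient of `x^m` in `x(ĝ₁ĝ₂ + ĝ')Y`, where `Y = exp ∫ŵ`
for cliques and `Y = 1/(1 - xŵ)` for cycles.

In the signed count `Y = DE`, with `D = 1` for cliques and `D = 1/(E - xE')` for cycles; `D` has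
non-negative coefficients, and in the unit count `Y` dominates `DE`. The factor `E` cancels the
denominator of `h_c`. In degrees `j ≥ c`, what multiplies `D` has coefficient `∑_i (i+1) e_{j+1+i}
L(h_{c+1+i})` (`coeff_separatedSeries_add_joinedSeries`); in lower degrees it is likewise a
non-negative combination of values `L(h_t)` with `t ≥ 1`. The inductive inequalities therefore
suffice. -/

set_option linter.unusedSectionVars false

/-! ### Alternating sums over sublists of a join-semilattice -/

section AltSum

variable {Λ Λ' M N : Type*} [SemilatticeSup Λ] [SemilatticeSup Λ'] [AddCommGroup M] [AddCommGroup N]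

/-- The alternating sum `∑_S (-1)^|S| f (π ⊔ sup S)` over the sublists `S` of `l`. -/
def altSum : List Λ → (Λ → M) → Λ → M
  | [], f, π => f π
  | s :: l, f, π => altSum l f π - altSum l f (π ⊔ s)

theorem altSum_append (l₁ l₂ : List Λ) (f : Λ → M) (π : Λ) :
    altSum (l₁ ++ l₂) f π = altSum l₁ (altSum l₂ f) π := by
  induction l₁ generalizing π with
  | nil => rfl
  | cons s l ih => simp only [List.cons_append, altSum, ih]

theorem altSum_sup (l : List Λ) (f : Λ → M) (π σ : Λ) :
    altSum l f (π ⊔ σ) = altSum l (fun ρ => f (ρ ⊔ σ)) π := by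
  induction l generalizing π with
  | nil => rfl
  | cons s l ih => simp only [altSum, ← ih, sup_right_comm]

theorem altSum_perm {l₁ l₂ : List Λ} (h : l₁.Perm l₂) (f : Λ → M) (π : Λ) :
    altSum l₁ f π = altSum l₂ f π := by
  induction h generalizing π with
  | nil => rfl
  | cons s _ ih => simp only [altSum, ih]
  | swap s t l => simp only [altSum, sup_right_comm π s t]; abel
  | trans _ _ ih₁ ih₂ => rw [ih₁, ih₂]

/-- Toggling the membership of `s` pairs sublists with opposite signs and equal values. -/
theorem altSum_eq_zero {l : List Λ} {s : Λ} (hs : s ∈ l) {f : Λ → M}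
    (hf : ∀ π, f (π ⊔ s) = f π) (π : Λ) : altSum l f π = 0 := by
  classical
  rw [altSum_perm (List.perm_cons_erase hs)]
  simp only [altSum, altSum_sup, hf, sub_self]

/-- After one copy of `s` is joined, the other copy changes nothing, so the corresponding term
cancels. This is needed for `C_2`, whose single edge is listed twice before deduplication. -/
theorem altSum_map_dedup {α : Type*} [DecidableEq α] (φ : α → Λ) (l : List α) (f : Λ → M) (π : Λ) :
    altSum (l.dedup.map φ) f π = altSum (l.map φ) f π := by
  induction l generalizing π with
  | nil => rfl
  | cons s l ih =>
    by_cases hs : s ∈ l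
    · rw [List.dedup_cons_of_mem hs, ih, List.map_cons, altSum, altSum_sup,
        altSum_eq_zero (List.mem_map_of_mem hs) (f := fun ρ => f (ρ ⊔ φ s)) (fun ρ => by simp),
        sub_zero]
    · simp only [List.dedup_cons_of_notMem hs, List.map_cons, altSum, ih]

theorem altSum_congr {S : Set Λ} {l : List Λ} {f g : Λ → M} (hS : ∀ π ∈ S, ∀ s ∈ l, π ⊔ s ∈ S)
    (hfg : ∀ π ∈ S, f π = g π) {π : Λ} (hπ : π ∈ S) : altSum l f π = altSum l g π := by
  induction l generalizing π with
  | nil => exact hfg π hπ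
  | cons s l ih =>
    have h : ∀ π ∈ S, ∀ s ∈ l, π ⊔ s ∈ S := fun π hπ t ht => hS π hπ t (List.mem_cons_of_mem _ ht)
    simp only [altSum, ih h hπ, ih h (hS π hπ s List.mem_cons_self)]

theorem altSum_map_addHom (φ : M →+ N) (l : List Λ) (f : Λ → M) (π : Λ) :
    φ (altSum l f π) = altSum l (fun ρ => φ (f ρ)) π := by
  induction l generalizing π with
  | nil => rfl
  | cons s l ih => simp only [altSum, map_sub, ih]

theorem altSum_mul_left {R : Type*} [Ring R] (a : R) (l : List Λ) (f : Λ → R) (π : Λ) :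
    altSum l (fun ρ => a * f ρ) π = a * altSum l f π :=
  (altSum_map_addHom (AddMonoidHom.mulLeft a) l f π).symm

theorem altSum_sub (l : List Λ) (f g : Λ → M) (π : Λ) :
    altSum l (fun ρ => f ρ - g ρ) π = altSum l f π - altSum l g π := by
  induction l generalizing π with
  | nil => rfl
  | cons s l ih => simp only [altSum, ih]; abel

theorem altSum_sum {ι : Type*} (I : Finset ι) (l : List Λ) (f : ι → Λ → M) (π : Λ) :
    altSum l (fun ρ => ∑ i ∈ I, f i ρ) π = ∑ i ∈ I, altSum l (f i) π := by
  induction l generalizing π with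
  | nil => rfl
  | cons s l ih => simp only [altSum, ih, Finset.sum_sub_distrib]

theorem altSum_map {φ : Λ → Λ'} (hφ : ∀ a b, φ (a ⊔ b) = φ a ⊔ φ b) (l : List Λ) (f : Λ' → M)
    (π : Λ) : altSum (l.map φ) f (φ π) = altSum l (fun ρ => f (φ ρ)) π := by
  induction l generalizing π with
  | nil => rfl
  | cons s l ih => simp only [List.map_cons, altSum, ← hφ, ih]

end AltSum

/-! ### Blocks of equivalence relations -/

namespace Setoid

variable {V W : Type*}

/-- The equivalence relation whose only class with more than one element is `A`. -/
def ofSet (A : Set V) : Setoid V where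
  r x y := x = y ∨ (x ∈ A ∧ y ∈ A)
  iseqv := by
    refine ⟨fun x => Or.inl rfl, ?_, ?_⟩
    · rintro x y (rfl | h)
      exacts [Or.inl rfl, Or.inr h.symm]
    · rintro x y z (rfl | h) (rfl | h')
      exacts [Or.inl rfl, Or.inr h', Or.inr h, Or.inr ⟨h.1, h'.2⟩]

theorem ofSet_mono {A B : Set V} (h : A ⊆ B) : ofSet A ≤ ofSet B := by
  rintro x y (rfl | ⟨hx, hy⟩)
  exacts [Or.inl rfl, Or.inr ⟨h hx, h hy⟩]

theorem ofSet_le_iff {A : Set V} {π : Setoid V} :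
    ofSet A ≤ π ↔ ∀ x ∈ A, ∀ y ∈ A, π x y := by
  refine ⟨fun h x hx y hy => h (Or.inr ⟨hx, hy⟩), ?_⟩
  rintro h x y (rfl | ⟨hx, hy⟩)
  exacts [π.refl x, h x hx y hy]

/-- The equivalence relation that identifies the two ends of an edge. -/
def ofEdge (e : Sym2 V) : Setoid V := ofSet {v | v ∈ e}

theorem ofEdge_le_iff {u v : V} {π : Setoid V} : ofEdge s(u, v) ≤ π ↔ π u v := by
  rw [ofEdge, ofSet_le_iff]
  constructor
  · exact fun h => h u (by simp) v (by simp)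
  · intro h x hx y hy
    simp only [Set.mem_ofPred_eq, Sym2.mem_iff] at hx hy
    rcases hx with rfl | rfl <;> rcases hy with rfl | rfl
    exacts [π.refl _, h, π.symm h, π.refl _]

/-- The pushforward of an equivalence relation along an injection. -/
def pushforward (f : V ↪ W) (π : Setoid V) : Setoid W where
  r x y := x = y ∨ ∃ a b, f a = x ∧ f b = y ∧ π a b
  iseqv := by
    refine ⟨fun x => Or.inl rfl, ?_, ?_⟩
    · rintro x y (rfl | ⟨a, b, ha, hb, h⟩)
      exacts [Or.inl rfl, Or.inr ⟨b, a, hb, ha, π.symm h⟩]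
    · rintro x y z (rfl | ⟨a, b, ha, hb, h⟩) (rfl | ⟨a', b', ha', hb', h'⟩)
      · exact Or.inl rfl
      · exact Or.inr ⟨a', b', ha', hb', h'⟩
      · exact Or.inr ⟨a, b, ha, hb, h⟩
      · obtain rfl : b = a' := f.injective (hb.trans ha'.symm)
        exact Or.inr ⟨a, b', ha, hb', π.trans h h'⟩

theorem pushforward_gc (f : V ↪ W) : GaloisConnection (pushforward f) (comap f) := by
  intro π ρ
  constructor
  · exact fun h x y hxy => h (Or.inr ⟨x, y, rfl, rfl, hxy⟩)
  · rintro h x y (rfl | ⟨a, b, rfl, rfl, hab⟩)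
    exacts [ρ.refl _, h hab]

theorem pushforward_apply (f : V ↪ W) (π : Setoid V) (a b : V) :
    pushforward f π (f a) (f b) ↔ π a b := by
  constructor
  · rintro (h | ⟨a', b', ha, hb, h⟩)
    · rw [f.injective h]
    · rwa [← f.injective ha, ← f.injective hb]
  · exact fun h => Or.inr ⟨a, b, rfl, rfl, h⟩

theorem pushforward_ofEdge (f : V ↪ W) (e : Sym2 V) :
    pushforward f (ofEdge e) = ofEdge (e.map f) := by
  induction e with | _ u v
  refine eq_of_forall_ge_iff fun ρ => ?_
  rw [pushforward_gc f _ _, ofEdge_le_iff, Sym2.map_mk, ofEdge_le_iff]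
  rfl

/-- For equivalence relations supported on sets that meet in at most one point `c`, the join only
adds the relations through `c`. -/
theorem sup_rel_iff {π σ : Setoid V} {A B : Set V} {c : V} (hπ : π ≤ ofSet A) (hσ : σ ≤ ofSet B)
    (hAB : ∀ x ∈ A, x ∈ B → x = c) (x y : V) :
    (π ⊔ σ) x y ↔ (π x y ∨ σ x y) ∨ ((π x c ∨ σ x c) ∧ (π c y ∨ σ c y)) := by
  -- A step of `π` followed by a step of `σ`, both nontrivial, has its middle point in `A` and in
  -- `B`, so that point is `c`.
  have key : ∀ x y z, (π x y ∨ σ x y) → (π y z ∨ σ y z) →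
      (π x z ∨ σ x z) ∨ (y = c) := by
    rintro x y z (h | h) (h' | h')
    · exact Or.inl (Or.inl (π.trans h h'))
    · rcases hπ h with rfl | ⟨_, hA⟩
      · exact Or.inl (Or.inr h')
      rcases hσ h' with rfl | ⟨hB, _⟩
      · exact Or.inl (Or.inl h)
      exact Or.inr (hAB _ hA hB)
    · rcases hσ h with rfl | ⟨_, hB⟩
      · exact Or.inl (Or.inl h')
      rcases hπ h' with rfl | ⟨hA, _⟩
      · exact Or.inl (Or.inr h)
      exact Or.inr (hAB _ hA hB)
    · exact Or.inl (Or.inr (σ.trans h h'))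
  have refl' : ∀ x, π x x ∨ σ x x := fun x => Or.inl (π.refl x)
  have symm' : ∀ x y, (π x y ∨ σ x y) → (π y x ∨ σ y x) := fun x y h =>
    h.imp (fun h => π.symm h) (fun h => σ.symm h)
  let ρ : Setoid V :=
    { r := fun x y => (π x y ∨ σ x y) ∨ ((π x c ∨ σ x c) ∧ (π c y ∨ σ c y))
      iseqv := by
        refine ⟨fun x => Or.inl (refl' x), ?_, ?_⟩
        · rintro x y (h | ⟨h, h'⟩)
          exacts [Or.inl (symm' _ _ h), Or.inr ⟨symm' _ _ h', symm' _ _ h⟩]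
        · rintro x y z (h | ⟨h₁, h₂⟩) (h' | ⟨h₃, h₄⟩)
          · rcases key x y z h h' with h'' | rfl
            exacts [Or.inl h'', Or.inr ⟨h, h'⟩]
          · rcases key x y c h h₃ with h'' | rfl
            exacts [Or.inr ⟨h'', h₄⟩, Or.inr ⟨h, h₄⟩]
          · rcases key c y z h₂ h' with h'' | rfl
            exacts [Or.inr ⟨h₁, h''⟩, Or.inr ⟨h₁, h'⟩]
          · exact Or.inr ⟨h₁, h₄⟩ }
  have hρ : π ⊔ σ = ρ := by
    refine le_antisymm (sup_le (fun {x y} h => Or.inl (Or.inl h)) fun {x y} h => Or.inl (Or.inr h)) ?_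
    have hle : ∀ x y, (π x y ∨ σ x y) → (π ⊔ σ) x y := fun x y h =>
      h.elim (fun h => (le_sup_left : π ≤ π ⊔ σ) h) fun h => (le_sup_right : σ ≤ π ⊔ σ) h
    rintro x y (h | ⟨h, h'⟩)
    · exact hle _ _ h
    · exact (π ⊔ σ).trans (hle _ _ h) (hle _ _ h')
  rw [hρ]
  rfl

variable [DecidableEq V] [DecidableEq W]

open Classical in
/-- The elements of `U` that are equivalent to `x`. -/
noncomputable def block (U : Finset V) (π : Setoid V) (x : V) : Finset V := {y ∈ U | π x y}

/-- The blocks of an equivalence relation on `U`. -/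
noncomputable def blocks (U : Finset V) (π : Setoid V) : Finset (Finset V) := U.image (π.block U)

theorem mem_block {U : Finset V} {π : Setoid V} {x y : V} : y ∈ π.block U x ↔ y ∈ U ∧ π x y := by
  simp [block]

theorem block_subset (U : Finset V) (π : Setoid V) (x : V) : π.block U x ⊆ U :=
  fun _ h => (mem_block.1 h).1

theorem self_mem_block {U : Finset V} (π : Setoid V) {x : V} (hx : x ∈ U) : x ∈ π.block U x :=
  mem_block.2 ⟨hx, π.refl x⟩

theorem block_congr {U : Finset V} {π : Setoid V} {x y : V} (h : π x y) :
    π.block U x = π.block U y := by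
  ext z
  simp only [mem_block]
  exact and_congr_right fun _ => ⟨fun h' => π.trans (π.symm h) h', fun h' => π.trans h h'⟩

theorem mem_blocks {U : Finset V} {π : Setoid V} {B : Finset V} :
    B ∈ π.blocks U ↔ ∃ x ∈ U, π.block U x = B := by
  simp [blocks]

theorem block_mem_blocks {U : Finset V} (π : Setoid V) {x : V} (hx : x ∈ U) :
    π.block U x ∈ π.blocks U := mem_blocks.2 ⟨x, hx, rfl⟩

theorem eq_block_of_mem {U : Finset V} {π : Setoid V} {B : Finset V} (hB : B ∈ π.blocks U) {x : V}
    (hx : x ∈ B) : B = π.block U x := by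
  obtain ⟨y, hy, rfl⟩ := mem_blocks.1 hB
  exact block_congr (mem_block.1 hx).2

theorem nonempty_of_mem_blocks {U : Finset V} {π : Setoid V} {B : Finset V}
    (hB : B ∈ π.blocks U) : B.Nonempty := by
  obtain ⟨y, hy, rfl⟩ := mem_blocks.1 hB
  exact ⟨y, self_mem_block π hy⟩

theorem subset_of_mem_blocks {U : Finset V} {π : Setoid V} {B : Finset V}
    (hB : B ∈ π.blocks U) : B ⊆ U := by
  obtain ⟨y, hy, rfl⟩ := mem_blocks.1 hB
  exact block_subset _ _ _

/-- The product of `f B` over the blocks `B`. -/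
noncomputable def blockProd {R : Type*} [CommMonoid R] (U : Finset V) (f : Finset V → R)
    (π : Setoid V) : R := ∏ B ∈ π.blocks U, f B

theorem blockProd_split {R : Type*} [CommMonoid R] {U : Finset V} (f : Finset V → R)
    (π : Setoid V) {c : V} (hc : c ∈ U) :
    blockProd U f π = f (π.block U c) * ∏ B ∈ π.blocks U with c ∉ B, f B := by
  have h : {B ∈ π.blocks U | c ∈ B} = {π.block U c} := by
    ext B
    simp only [Finset.mem_filter, Finset.mem_singleton]
    constructor
    · exact fun h => eq_block_of_mem h.1 h.2
    · rintro rfl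
      exact ⟨block_mem_blocks π hc, self_mem_block π hc⟩
  rw [blockProd, ← Finset.prod_filter_mul_prod_filter_not _ (fun B => c ∈ B), h,
    Finset.prod_singleton]

theorem blockProd_congr {R : Type*} [CommMonoid R] {U : Finset V} {f g : Finset V → R}
    (h : ∀ B ⊆ U, B.Nonempty → f B = g B) (π : Setoid V) : blockProd U f π = blockProd U g π :=
  Finset.prod_congr rfl fun _ hB => h _ (subset_of_mem_blocks hB) (nonempty_of_mem_blocks hB)

/-! ### Blocks of the join of two relations that meet in one vertex -/

section Glue

variable {π σ : Setoid V} {A B : Finset V} {c : V}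

theorem block_sup_self (hπ : π ≤ ofSet (A : Set V)) (hσ : σ ≤ ofSet (B : Set V))
    (hAB : ∀ x ∈ A, x ∈ B → x = c) (hA : c ∈ A) (hB : c ∈ B) :
    (π ⊔ σ).block (A ∪ B) c = π.block A c ∪ σ.block B c := by
  ext x
  have h := sup_rel_iff hπ hσ hAB c x
  have h' : (π c c ∨ σ c c) := Or.inl (π.refl c)
  have hA' : π c x → x ∈ A := fun h => by
    rcases hπ h with rfl | h
    exacts [hA, h.2]
  have hB' : σ c x → x ∈ B := fun h => by
    rcases hσ h with rfl | h
    exacts [hB, h.2]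
  simp only [mem_block, Finset.mem_union, h]
  tauto

theorem block_sup_left (hπ : π ≤ ofSet (A : Set V)) (hσ : σ ≤ ofSet (B : Set V))
    (hAB : ∀ x ∈ A, x ∈ B → x = c) {x : V} (hx : x ∈ A)
    (hxc : ¬ π x c) : (π ⊔ σ).block (A ∪ B) x = π.block A x := by
  ext y
  have hne : x ≠ c := fun h => hxc (h ▸ π.refl c)
  have hσx : ∀ z, σ x z → x = z := fun z h => (hσ h).resolve_right fun h' => hne (hAB x hx h'.1)
  have h1 : σ x y → π x y := fun h => hσx y h ▸ π.refl x
  have h2 : ¬ σ x c := fun h => hne (hσx c h)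
  have h3 : π x y → y ∈ A := fun h => by
    rcases hπ h with rfl | h
    exacts [hx, h.2]
  simp only [mem_block, Finset.mem_union, sup_rel_iff hπ hσ hAB x y]
  tauto

theorem filter_blocks_sup (hπ : π ≤ ofSet (A : Set V)) (hσ : σ ≤ ofSet (B : Set V))
    (hAB : ∀ x ∈ A, x ∈ B → x = c) (hA : c ∈ A) (hB : c ∈ B) :
    {D ∈ (π ⊔ σ).blocks (A ∪ B) | c ∉ D} =
      {D ∈ π.blocks A | c ∉ D} ∪ {D ∈ σ.blocks B | c ∉ D} := by
  have hBA : ∀ x ∈ B, x ∈ A → x = c := fun x h h' => hAB x h' h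
  have l : ∀ x ∈ A, ¬ π x c → (π ⊔ σ).block (A ∪ B) x = π.block A x := fun x hx h =>
    block_sup_left hπ hσ hAB hx h
  have r : ∀ x ∈ B, ¬ σ x c → (π ⊔ σ).block (A ∪ B) x = σ.block B x := fun x hx h => by
    rw [sup_comm, Finset.union_comm]
    exact block_sup_left hσ hπ hBA hx h
  ext D
  simp only [Finset.mem_filter, Finset.mem_union, mem_blocks]
  constructor
  · rintro ⟨⟨x, hx, rfl⟩, hc⟩
    have hxc : ¬ (π ⊔ σ) x c := fun h => hc (mem_block.2 ⟨Finset.mem_union_left _ hA, h⟩)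
    have hπx : ¬ π x c := fun h => hxc ((le_sup_left : π ≤ π ⊔ σ) h)
    have hσx : ¬ σ x c := fun h => hxc ((le_sup_right : σ ≤ π ⊔ σ) h)
    rcases hx with hx | hx
    · exact Or.inl ⟨⟨x, hx, (l x hx hπx).symm⟩, hc⟩
    · exact Or.inr ⟨⟨x, hx, (r x hx hσx).symm⟩, hc⟩
  · rintro (⟨⟨x, hx, rfl⟩, hc⟩ | ⟨⟨x, hx, rfl⟩, hc⟩)
    · exact ⟨⟨x, Or.inl hx, l x hx fun h => hc (mem_block.2 ⟨hA, h⟩)⟩, hc⟩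
    · exact ⟨⟨x, Or.inr hx, r x hx fun h => hc (mem_block.2 ⟨hB, h⟩)⟩, hc⟩

theorem prod_filter_blocks_sup {R : Type*} [CommMonoid R] (f : Finset V → R)
    (hπ : π ≤ ofSet (A : Set V)) (hσ : σ ≤ ofSet (B : Set V))
    (hAB : ∀ x ∈ A, x ∈ B → x = c) (hA : c ∈ A) (hB : c ∈ B) :
    ∏ D ∈ (π ⊔ σ).blocks (A ∪ B) with c ∉ D, f D =
      (∏ D ∈ π.blocks A with c ∉ D, f D) * ∏ D ∈ σ.blocks B with c ∉ D, f D := by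
  rw [filter_blocks_sup hπ hσ hAB hA hB, Finset.prod_union]
  rw [Finset.disjoint_left]
  intro D h h'
  rw [Finset.mem_filter] at h h'
  obtain ⟨x, hx⟩ := nonempty_of_mem_blocks h.1
  have := hAB x (subset_of_mem_blocks h.1 hx) (subset_of_mem_blocks h'.1 hx)
  exact h.2 (this ▸ hx)

/-- Only the two blocks of `c` merge; every other block of the join is a block of one side. As `c`
lies in exactly one block per side, each conditional applies once, and the nested form lets `π` be
frozen while summing over `σ`. -/
theorem blockProd_sup {R : Type*} [CommMonoid R] (f : Finset V → R)
    (hπ : π ≤ ofSet (A : Set V)) (hσ : σ ≤ ofSet (B : Set V))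
    (hAB : ∀ x ∈ A, x ∈ B → x = c) (hA : c ∈ A) (hB : c ∈ B) :
    blockProd (A ∪ B) f (π ⊔ σ) = blockProd A (fun C => if c ∈ C then
      blockProd B (fun D => if c ∈ D then f (C ∪ D) else f D) σ else f C) π := by
  rw [blockProd_split _ _ (Finset.mem_union_left B hA), block_sup_self hπ hσ hAB hA hB,
    prod_filter_blocks_sup f hπ hσ hAB hA hB, blockProd_split (U := A) _ _ hA,
    if_pos (self_mem_block π hA), blockProd_split (U := B) _ _ hB, if_pos (self_mem_block σ hB),
    Finset.prod_congr rfl (g := f) (s₁ := {B ∈ π.blocks A | c ∉ B})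
      (fun D hD => if_neg (Finset.mem_filter.1 hD).2),
    Finset.prod_congr rfl (g := f) (s₁ := {D ∈ σ.blocks B | c ∉ D})
      (fun D hD => if_neg (Finset.mem_filter.1 hD).2)]
  rw [mul_assoc, mul_comm (∏ D ∈ π.blocks A with c ∉ D, f D)]

end Glue

theorem blockProd_insert {R : Type*} [CommMonoid R] (f : Finset V → R) {π : Setoid V}
    {U : Finset V} {v : V} (hv : v ∉ U) (hπ : π ≤ ofSet (U : Set V)) :
    blockProd (insert v U) f π = f {v} * blockProd U f π := by
  have hv' : ∀ x, π v x → x = v := fun x h =>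
    ((hπ h).resolve_right fun h' => hv (by simpa using h'.1)).symm
  have h1 : π.block (insert v U) v = {v} := by
    ext x
    simp only [mem_block, Finset.mem_insert, Finset.mem_singleton]
    exact ⟨fun h => hv' x h.2, fun h => ⟨Or.inl h, h ▸ π.refl v⟩⟩
  have h2 : ∀ x ∈ U, π.block (insert v U) x = π.block U x := by
    intro x hx
    ext y
    simp only [mem_block, Finset.mem_insert]
    refine ⟨fun h => ⟨h.1.resolve_left ?_, h.2⟩, fun h => ⟨Or.inr h.1, h.2⟩⟩
    rintro rfl
    exact hv (hv' x (π.symm h.2) ▸ hx)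
  have h3 : π.blocks (insert v U) = insert {v} (π.blocks U) := by
    rw [blocks, Finset.image_insert, h1, blocks, Finset.image_congr (g := π.block U)]
    exact fun x hx => h2 x hx
  rw [blockProd, h3, Finset.prod_insert]
  · rfl
  · exact fun h => hv (subset_of_mem_blocks h (by simp))

theorem blockProd_pushforward {R : Type*} [CommMonoid R] (f : Finset W → R) (ι : V ↪ W)
    (U : Finset V) (π : Setoid V) :
    blockProd (U.map ι) f (pushforward ι π) = blockProd U (fun B => f (B.map ι)) π := by
  have h : ∀ x, (pushforward ι π).block (U.map ι) (ι x) = (π.block U x).map ι := by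
    intro x
    ext y
    simp only [mem_block, Finset.mem_map]
    constructor
    · rintro ⟨⟨a, ha, rfl⟩, h⟩
      exact ⟨a, ⟨ha, (pushforward_apply ι π x a).1 h⟩, rfl⟩
    · rintro ⟨a, ⟨ha, h⟩, rfl⟩
      exact ⟨⟨a, ha, rfl⟩, (pushforward_apply ι π x a).2 h⟩
  have h2 : (pushforward ι π).blocks (U.map ι) = (π.blocks U).map (Finset.mapEmbedding ι).toEmbedding := by
    ext B
    simp only [mem_blocks, Finset.mem_map]
    constructor
    · rintro ⟨_, ⟨x, hx, rfl⟩, rfl⟩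
      exact ⟨_, ⟨x, hx, rfl⟩, (h x).symm⟩
    · rintro ⟨_, ⟨x, hx, rfl⟩, rfl⟩
      exact ⟨_, ⟨x, hx, rfl⟩, h x⟩
  rw [blockProd, h2, Finset.prod_map]
  rfl

end Setoid

/-! ### Sums over forests -/

section ForestSum

open Setoid

variable {V W R : Type*} [DecidableEq V] [DecidableEq W] [CommRing R]

/-- The sum of `∏ f B` (product over the blocks `B` of `F`) over the non-broken circuits `F` of the
graph on `U` with edges `l`, written as an alternating sum over all sets of edges. -/
noncomputable def forestSum (U : Finset V) (l : List (Sym2 V)) (f : Finset V → R) : R :=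
  (-1) ^ U.card * altSum (l.map ofEdge) (blockProd U fun B => -f B) ⊥

/-- All edges of `l` have their ends in `U`. -/
def EdgesIn (U : Finset V) (l : List (Sym2 V)) : Prop := ∀ e ∈ l, ∀ v ∈ e, v ∈ U

theorem EdgesIn.sup_le {U : Finset V} {l : List (Sym2 V)} (hl : EdgesIn U l) :
    ∀ π ∈ {π : Setoid V | π ≤ ofSet (U : Set V)}, ∀ s ∈ l.map ofEdge,
      π ⊔ s ∈ {π : Setoid V | π ≤ ofSet (U : Set V)} := by
  intro π hπ s hs
  obtain ⟨e, he, rfl⟩ := List.mem_map.1 hs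
  exact _root_.sup_le hπ (ofSet_mono fun v hv => hl e he v hv)

theorem EdgesIn.altSum_congr {M : Type*} [AddCommGroup M] {U : Finset V} {l : List (Sym2 V)}
    (hl : EdgesIn U l) {f g : Setoid V → M}
    (h : ∀ π : Setoid V, π ≤ ofSet (U : Set V) → f π = g π) :
    altSum (l.map ofEdge) f ⊥ = altSum (l.map ofEdge) g ⊥ :=
  _root_.altSum_congr hl.sup_le h (by simp)

theorem forestSum_congr {U : Finset V} {f g : Finset V → R} (l : List (Sym2 V))
    (h : ∀ B ⊆ U, B.Nonempty → f B = g B) : forestSum U l f = forestSum U l g := by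
  have : (blockProd U fun B => -f B) = blockProd U fun B => -g B :=
    funext fun π => blockProd_congr (fun B hB hB' => by rw [h B hB hB']) π
  rw [forestSum, forestSum, this]

theorem forestSum_perm {U : Finset V} (f : Finset V → R) {l l' : List (Sym2 V)} (h : l.Perm l') :
    forestSum U l f = forestSum U l' f := by
  rw [forestSum, forestSum, altSum_perm (h.map _)]

theorem forestSum_dedup (U : Finset V) (l : List (Sym2 V)) (f : Finset V → R) :
    forestSum U l.dedup f = forestSum U l f := by
  rw [forestSum, forestSum, altSum_map_dedup]

theorem forestSum_map (ι : V ↪ W) (U : Finset V) (l : List (Sym2 V)) (f : Finset W → R) :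
    forestSum (U.map ι) (l.map (Sym2.map ι)) f = forestSum U l fun B => f (B.map ι) := by
  have h1 : (l.map (Sym2.map ι)).map ofEdge = (l.map ofEdge).map (pushforward ι) := by
    simp only [List.map_map]
    exact List.map_congr_left fun e _ => (pushforward_ofEdge ι e).symm
  have h2 : pushforward ι ⊥ = ⊥ := (pushforward_gc ι).l_bot
  rw [forestSum, forestSum, h1, ← h2, altSum_map fun a b => (pushforward_gc ι).l_sup,
    Finset.card_map]
  congr 2
  exact funext fun π => blockProd_pushforward _ _ _ _

theorem forestSum_nil_singleton (v : V) (f : Finset V → R) : forestSum {v} [] f = f {v} := by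
  have h : (⊥ : Setoid V).blocks {v} = {{v}} := by
    rw [blocks, Finset.image_singleton]
    congr 1
    ext x
    simp only [mem_block, Finset.mem_singleton]
    exact ⟨fun h => h.1, fun h => ⟨h, h.symm⟩⟩
  simp [forestSum, altSum, blockProd, h]

/-- Two graphs that share one vertex. -/
theorem forestSum_union {A B : Finset V} {c : V} {l l' : List (Sym2 V)} (hl : EdgesIn A l)
    (hl' : EdgesIn B l') (hAB : ∀ x ∈ A, x ∈ B → x = c) (hA : c ∈ A) (hB : c ∈ B)
    (f : Finset V → R) :
    forestSum (A ∪ B) (l ++ l') f = forestSum A l fun C =>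
      if c ∈ C then forestSum B l' fun D => if c ∈ D then f (C ∪ D) else f D else f C := by
  -- The shared vertex is counted only once. The resulting sign matches the minus sign that the
  -- inner `forestSum` receives as a block weight of the outer one.
  have hcard : (-1 : R) ^ (A ∪ B).card = -((-1) ^ A.card * (-1) ^ B.card) := by
    have h : A ∩ B = {c} := by
      ext x
      simp only [Finset.mem_inter, Finset.mem_singleton]
      exact ⟨fun h => hAB x h.1 h.2, by rintro rfl; exact ⟨hA, hB⟩⟩
    have h' := Finset.card_union_add_card_inter A B
    rw [h, Finset.card_singleton] at h'
    rw [← pow_add, ← h', pow_succ]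
    ring
  rw [forestSum, forestSum, hcard, List.map_append, altSum_append, neg_mul, mul_assoc, ← mul_neg]
  congr 1
  rw [← altSum_mul_left, ← neg_one_mul, ← altSum_mul_left]
  refine hl.altSum_congr fun π hπ => ?_
  have h1 : altSum (l'.map ofEdge) (blockProd (A ∪ B) fun D => -f D) π =
      altSum (l'.map ofEdge) (fun σ => blockProd A (fun C => if c ∈ C then
        blockProd B (fun D => if c ∈ D then -f (C ∪ D) else -f D) σ else -f C) π) ⊥ := by
    rw [← bot_sup_eq π, altSum_sup, bot_sup_eq]
    refine hl'.altSum_congr fun σ hσ => ?_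
    rw [sup_comm, blockProd_sup _ hπ hσ hAB hA hB]
  simp only [blockProd_split (U := A) _ π hA, if_pos (self_mem_block π hA)] at h1 ⊢
  rw [h1]
  have h2 : ∀ g : Finset V → R, ∏ C ∈ π.blocks A with c ∉ C, (if c ∈ C then g C else -f C) =
      ∏ C ∈ π.blocks A with c ∉ C, -f C := fun g =>
    Finset.prod_congr rfl fun C hC => if_neg (Finset.mem_filter.1 hC).2
  have h3 : ∏ C ∈ π.blocks A with c ∉ C, (-if c ∈ C then
      forestSum B l' fun D => if c ∈ D then f (C ∪ D) else f D else f C) =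
      ∏ C ∈ π.blocks A with c ∉ C, -f C :=
    Finset.prod_congr rfl fun C hC => by rw [if_neg (Finset.mem_filter.1 hC).2]
  simp only [h2, h3]
  simp only [mul_comm _ (∏ C ∈ π.blocks A with c ∉ C, -f C), altSum_mul_left, forestSum]
  have h4 : (blockProd B fun D => if c ∈ D then -f (π.block A c ∪ D) else -f D) =
      blockProd B fun D => -if c ∈ D then f (π.block A c ∪ D) else f D := by
    funext σ
    exact blockProd_congr (fun D _ _ => by split_ifs <;> rfl) σ
  rw [h4]
  ring

theorem altSum_insert_isolated {U : Finset V} {v : V} {l : List (Sym2 V)} (hl : EdgesIn U l)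
    (hv : v ∉ U) (f : Finset V → R) :
    (-1) ^ (insert v U).card * altSum (l.map ofEdge) (blockProd (insert v U) fun B => -f B) ⊥ =
      f {v} * forestSum U l f := by
  rw [hl.altSum_congr fun π hπ => blockProd_insert (fun B => -f B) hv hπ, altSum_mul_left,
    Finset.card_insert_of_notMem hv, forestSum]
  ring

/-- The edge attaches `v` to the block of `i`: there is one more vertex but no new block, hence the
minus sign. -/
theorem altSum_insert_edge {U : Finset V} {v i : V} {l : List (Sym2 V)} (hl : EdgesIn U l)
    (hv : v ∉ U) (hi : i ∈ U) (f : Finset V → R) :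
    (-1) ^ (insert v U).card * altSum (l.map ofEdge)
      (fun π => blockProd (insert v U) (fun B => -f B) (π ⊔ ofEdge s(i, v))) ⊥ =
      -forestSum U l fun B => if i ∈ B then f (insert v B) else f B := by
  have hU : insert v U = U ∪ {i, v} := by
    ext x
    simp only [Finset.mem_insert, Finset.mem_union, Finset.mem_singleton]
    constructor
    · rintro (h | h) <;> simp [h]
    · rintro (h | rfl | rfl) <;> simp [*]
  have hσ : ofEdge s(i, v) ≤ ofSet (({i, v} : Finset V) : Set V) :=
    ofSet_mono fun x hx => by simpa using hx
  have hb : (ofEdge s(i, v)).blocks {i, v} = {{i, v}} := by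
    have h : ∀ x ∈ ({i, v} : Finset V), (ofEdge s(i, v)).block {i, v} x = {i, v} := by
      intro x hx
      ext y
      rw [mem_block]
      refine ⟨fun h => h.1, fun h => ⟨h, Or.inr ⟨?_, ?_⟩⟩⟩
      · simpa using hx
      · simpa using h
    ext B
    rw [mem_blocks, Finset.mem_singleton]
    constructor
    · rintro ⟨x, hx, rfl⟩
      exact h x hx
    · rintro rfl
      exact ⟨i, by simp, h i (by simp)⟩
  have key : ∀ π : Setoid V, π ≤ ofSet (U : Set V) →
      blockProd (insert v U) (fun B => -f B) (π ⊔ ofEdge s(i, v)) =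
        blockProd U (fun B => -if i ∈ B then f (insert v B) else f B) π := by
    intro π hπ
    rw [hU, blockProd_sup (fun B => -f B) hπ hσ (c := i) ?_ hi (by simp)]
    · refine blockProd_congr (fun C _ _ => ?_) π
      split_ifs with hC
      · rw [blockProd, hb, Finset.prod_singleton, if_pos (by simp)]
        congr 2
        ext x
        simp only [Finset.mem_insert, Finset.mem_union, Finset.mem_singleton]
        constructor
        · rintro (h | rfl | rfl) <;> simp [*]
        · rintro (h | h) <;> simp [h]
      · rfl
    · intro x hx hx'
      simp only [Finset.mem_insert, Finset.mem_singleton] at hx'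
      exact hx'.resolve_right (by rintro rfl; exact hv hx)
  rw [hl.altSum_congr key, Finset.card_insert_of_notMem hv, forestSum]
  ring

theorem EdgesIn.append {U : Finset V} {l l' : List (Sym2 V)} (h : EdgesIn U l)
    (h' : EdgesIn U l') : EdgesIn U (l ++ l') := fun e he =>
  (List.mem_append.1 he).elim (h e) (h' e)

/-- Adding a leaf. -/
theorem forestSum_leaf {U : Finset V} {v i : V} {l : List (Sym2 V)} (hl : EdgesIn U l)
    (hv : v ∉ U) (hi : i ∈ U) (f : Finset V → R) :
    forestSum (insert v U) (l ++ [s(i, v)]) f = f {v} * forestSum U l f +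
      forestSum U l fun B => if i ∈ B then f (insert v B) else f B := by
  have h := altSum_insert_edge hl hv hi f
  rw [← altSum_insert_isolated hl hv, ← neg_eq_iff_eq_neg.2 h, ← sub_eq_add_neg, ← mul_sub,
    ← altSum_sub, forestSum, List.map_append, altSum_append]
  rfl

/-- `l` lists the edges of the complete graph on `U`. -/
def IsCompleteList (U : Finset V) (l : List (Sym2 V)) : Prop :=
  l.Nodup ∧ ∀ e, e ∈ l ↔ ¬ e.IsDiag ∧ ∀ v ∈ e, v ∈ U

theorem IsCompleteList.edgesIn {U : Finset V} {l : List (Sym2 V)} (h : IsCompleteList U l) :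
    EdgesIn U l := fun e he => ((h.2 e).1 he).2

theorem exists_isCompleteList (U : Finset V) : ∃ l, IsCompleteList U l := by
  refine ⟨(U.sym2.filter fun e => ¬ e.IsDiag).toList, Finset.nodup_toList _, fun e => ?_⟩
  rw [Finset.mem_toList, Finset.mem_filter, Finset.mem_sym2_iff, and_comm]

theorem IsCompleteList.perm_insert {U : Finset V} {v : V} (hv : v ∉ U) {l l' : List (Sym2 V)}
    (h : IsCompleteList (insert v U) l) (h' : IsCompleteList U l') :
    l.Perm (l' ++ U.toList.map fun i => s(i, v)) := by
  rw [List.perm_ext_iff_of_nodup h.1]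
  · intro e
    rw [h.2, List.mem_append, h'.2, List.mem_map]
    induction e with | _ x y
    simp only [Sym2.mk_isDiag_iff, Sym2.mem_iff, forall_eq_or_imp, forall_eq, Finset.mem_insert,
      Finset.mem_toList, Sym2.eq_iff]
    constructor
    · rintro ⟨hne, rfl | hx, rfl | hy⟩
      · exact absurd rfl hne
      · exact Or.inr ⟨y, hy, Or.inr ⟨rfl, rfl⟩⟩
      · exact Or.inr ⟨x, hx, Or.inl ⟨rfl, rfl⟩⟩
      · exact Or.inl ⟨hne, hx, hy⟩
    · rintro (⟨hne, hx, hy⟩ | ⟨a, ha, ⟨rfl, rfl⟩ | ⟨rfl, rfl⟩⟩)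
      · exact ⟨hne, Or.inr hx, Or.inr hy⟩
      · exact ⟨by rintro rfl; exact hv ha, Or.inr ha, Or.inl rfl⟩
      · exact ⟨by rintro rfl; exact hv ha, Or.inl rfl, Or.inr ha⟩
  · refine h'.1.append (U.nodup_toList.map ?_) ?_
    · intro i j hij
      simp only [Sym2.eq_iff] at hij
      rcases hij with h | h
      exacts [h.1, h.1.trans h.2]
    · intro e he he'
      obtain ⟨i, _, rfl⟩ := List.mem_map.1 he'
      exact hv (((h'.2 _).1 he).2 v (by simp))

/-- Edge sets with two edges `iv` and `jv` cancel: `ij` is an edge of the clique, and toggling it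
does not change the join. Only the sets with at most one edge at `v` survive. -/
theorem altSum_complete_append {M : Type*} [AddCommGroup M] {U : Finset V} {v : V}
    {l : List (Sym2 V)} (hl : IsCompleteList U l) (I : List V) (hI : I.Nodup)
    (hIU : ∀ i ∈ I, i ∈ U) (f : Setoid V → M) :
    altSum ((l ++ I.map fun i => s(i, v)).map ofEdge) f ⊥ = altSum (l.map ofEdge) f ⊥ -
      (I.map fun i => altSum (l.map ofEdge) (fun π => f (π ⊔ ofEdge s(i, v))) ⊥).sum := by
  induction I generalizing f with
  | nil => simp
  | cons i I ih =>
    have hI' := (List.nodup_cons.1 hI)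
    have hIU' : ∀ j ∈ I, j ∈ U := fun j hj => hIU j (List.mem_cons_of_mem _ hj)
    have h0 : ∀ j ∈ I, altSum (l.map ofEdge)
        (fun π => f (π ⊔ ofEdge s(j, v) ⊔ ofEdge s(i, v))) ⊥ = 0 := by
      intro j hj
      have hij : i ≠ j := by rintro rfl; exact hI'.1 hj
      refine altSum_eq_zero (s := ofEdge s(i, j)) (List.mem_map_of_mem ((hl.2 _).2 ⟨?_, ?_⟩)) ?_ _
      · simpa using hij
      · simpa using ⟨hIU i List.mem_cons_self, hIU' j hj⟩
      · intro π
        congr 1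
        rw [sup_assoc, sup_assoc, sup_assoc]
        congr 1
        refine sup_eq_right.2 ?_
        rw [ofEdge_le_iff]
        refine Setoid.trans' _ (y := v) ?_ (Setoid.symm' _ ?_)
        · exact (le_sup_right : _ ≤ ofEdge s(j, v) ⊔ ofEdge s(i, v)) (ofEdge_le_iff.1 le_rfl)
        · exact (le_sup_left : _ ≤ ofEdge s(j, v) ⊔ ofEdge s(i, v)) (ofEdge_le_iff.1 le_rfl)
    have h1 : altSum ((l ++ (i :: I).map fun i => s(i, v)).map ofEdge) f ⊥ =
        altSum ((l ++ I.map fun i => s(i, v)).map ofEdge) f ⊥ -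
        altSum ((l ++ I.map fun i => s(i, v)).map ofEdge) (fun π => f (π ⊔ ofEdge s(i, v))) ⊥ := by
      rw [← altSum_sub]
      simp only [List.map_append, altSum_append, List.map_cons, altSum, altSum_sub]
      simp only [altSum_sup]
    rw [h1, ih hI'.2 hIU', ih hI'.2 hIU', List.map_congr_left h0]
    simp only [List.map_const', List.sum_replicate, smul_zero, List.map_cons, List.sum_cons]
    abel

/-- Adding a vertex to a clique. -/
theorem forestSum_complete_insert {U : Finset V} {v : V} (hv : v ∉ U) {l l' : List (Sym2 V)}
    (h : IsCompleteList (insert v U) l) (h' : IsCompleteList U l') (f : Finset V → R) :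
    forestSum (insert v U) l f = f {v} * forestSum U l' f +
      ∑ i ∈ U, forestSum U l' fun B => if i ∈ B then f (insert v B) else f B := by
  rw [forestSum_perm f (h.perm_insert hv h'), ← altSum_insert_isolated h'.edgesIn hv, forestSum,
    altSum_complete_append h' U.toList U.nodup_toList (fun i hi => Finset.mem_toList.1 hi), mul_sub,
    sub_eq_add_neg, Finset.sum_map_toList, Finset.mul_sum, ← Finset.sum_neg_distrib]
  congr 1
  refine Finset.sum_congr rfl fun i hi => ?_
  rw [altSum_insert_edge h'.edgesIn hv hi, neg_neg]

/-- Completing a cycle through a new vertex. -/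
theorem forestSum_cycle {U : Finset V} {v i j : V} {l : List (Sym2 V)} (hl : EdgesIn U l)
    (hv : v ∉ U) (hi : i ∈ U) (hj : j ∈ U) (f : Finset V → R) :
    forestSum (insert v U) (l ++ [s(i, v), s(v, j)]) f = f {v} * forestSum U l f +
      (forestSum U l fun B => if i ∈ B then f (insert v B) else f B) +
      forestSum U (l ++ [s(i, j)]) fun B => if j ∈ B then f (insert v B) else f B := by
  have hl' : EdgesIn U (l ++ [s(i, j)]) := hl.append (by simpa [EdgesIn] using ⟨hi, hj⟩)
  have h1 := altSum_insert_edge hl hv hi f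
  have h2 := altSum_insert_edge hl' hv hj f
  rw [← altSum_insert_isolated hl hv, ← neg_eq_iff_eq_neg.2 h1, ← neg_eq_iff_eq_neg.2 h2,
    ← sub_eq_add_neg, ← sub_eq_add_neg, ← mul_sub, ← mul_sub, forestSum]
  congr 1
  simp only [List.map_append, altSum_append, ← altSum_sub]
  congr 1
  funext π
  simp only [List.map_cons, List.map_nil, altSum]
  rw [show ofEdge s(v, j) = ofEdge s(j, v) by rw [Sym2.eq_swap]]
  -- With both new edges present, `iv` may be replaced by the chord `ij`: this contracts the cycle
  -- to one with a vertex less, in which `v` hangs on `j`.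
  have h3 : π ⊔ ofEdge s(i, v) ⊔ ofEdge s(j, v) = π ⊔ ofEdge s(i, j) ⊔ ofEdge s(j, v) := by
    rw [sup_assoc, sup_assoc]
    congr 1
    refine le_antisymm (sup_le ?_ le_sup_right) (sup_le ?_ le_sup_right)
    · rw [ofEdge_le_iff]
      exact Setoid.trans' _ (y := j) ((le_sup_left : ofEdge s(i, j) ≤ _) (ofEdge_le_iff.1 le_rfl))
        ((le_sup_right : ofEdge s(j, v) ≤ _) (ofEdge_le_iff.1 le_rfl))
    · rw [ofEdge_le_iff]
      exact Setoid.trans' _ (y := v) ((le_sup_left : ofEdge s(i, v) ≤ _) (ofEdge_le_iff.1 le_rfl))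
        (Setoid.symm' _ ((le_sup_right : ofEdge s(j, v) ≤ _) (ofEdge_le_iff.1 le_rfl)))
  rw [h3]
  abel

end ForestSum

/-! ### Weights for forests with one or two marked vertices -/

section RootWeights

open PowerSeries

variable {V R : Type*} [DecidableEq V] [CommRing R]

/-- The weight `g |B|` for the block of `r` and `w |B|` for the other blocks. -/
def rootWeight (r : V) (g w : ℕ → R) (B : Finset V) : R := if r ∈ B then g B.card else w B.card

/-- The weight `g |B|` for a block that contains `r` and `s`, `g₁ |B|` and `g₂ |B|` for the blocks
that contain only `r` and only `s`, and `w |B|` for the other blocks. -/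
def rootWeight₂ (r s : V) (g g₁ g₂ w : ℕ → R) (B : Finset V) : R :=
  if r ∈ B then (if s ∈ B then g B.card else g₁ B.card)
  else if s ∈ B then g₂ B.card else w B.card

theorem rootWeight₂_self (r s : V) (g w : ℕ → R) :
    rootWeight₂ r s g g w w = rootWeight r g w := by
  funext B
  simp [rootWeight₂, rootWeight]

theorem rootWeight_self (r : V) (w : ℕ → R) :
    rootWeight r w w = fun B => w B.card := by
  funext B
  simp [rootWeight]

/-- The power series `∑ g (k + 1) X ^ k`. -/
noncomputable def shiftSeries (g : ℕ → R) : PowerSeries R := PowerSeries.mk fun k => g (k + 1)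

theorem coeff_shiftSeries (g : ℕ → R) (k : ℕ) : coeff k (shiftSeries g) = g (k + 1) :=
  coeff_mk _ _

theorem constantCoeff_shiftSeries (g : ℕ → R) : constantCoeff (shiftSeries g) = g 1 := by
  rw [← coeff_zero_eq_constantCoeff_apply, coeff_shiftSeries]

theorem shiftSeries_eq (g : ℕ → R) :
    shiftSeries g = C (g 1) + X * shiftSeries fun k => g (k + 1) := by
  ext k
  cases k with
  | zero => simp [coeff_shiftSeries]
  | succ k => simp [coeff_shiftSeries, coeff_succ_X_mul]

/-- The series that describes a graph with two marked vertices. -/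
noncomputable def pairSeries (g g₁ g₂ : ℕ → R) : PowerSeries R :=
  shiftSeries g₁ * shiftSeries g₂ + derivative R (shiftSeries g)

/-- The three terms reflect the removal of the second marked vertex: it is a tree by itself, it
hangs on the first marked vertex, or it hangs on another vertex, which inherits the mark. -/
theorem pairSeries_eq (g g₁ g₂ : ℕ → R) :
    pairSeries g g₁ g₂ = C (g₂ 1) * shiftSeries g₁ + shiftSeries (fun k => g (k + 1)) +
      X * pairSeries (fun k => g (k + 1)) g₁ (fun k => g₂ (k + 1)) := by
  rw [pairSeries, pairSeries, shiftSeries_eq g₂, shiftSeries_eq g, map_add, Derivation.leibniz,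
    derivative_C, derivative_X]
  simp only [smul_eq_mul]
  ring

theorem rootWeight_insert_root {U : Finset V} {r : V} (hr : r ∉ U) (i : V) (g w : ℕ → R) :
    ∀ B ⊆ U, B.Nonempty → (if i ∈ B then rootWeight r g w (insert r B) else rootWeight r g w B) =
      rootWeight i (fun k => g (k + 1)) w B := by
  intro B hB _
  have hrB : r ∉ B := fun h => hr (hB h)
  by_cases h : i ∈ B <;> simp [rootWeight, h, hrB, Finset.card_insert_of_notMem hrB]

theorem rootWeight₂_insert {U : Finset V} {r s : V} (hs : s ∉ U) (hrs : r ≠ s) (i : V)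
    (g g₁ g₂ w : ℕ → R) :
    ∀ B ⊆ U, B.Nonempty → (if i ∈ B then rootWeight₂ r s g g₁ g₂ w (insert s B)
        else rootWeight₂ r s g g₁ g₂ w B) =
      rootWeight₂ r i (fun k => g (k + 1)) g₁ (fun k => g₂ (k + 1)) w B := by
  intro B hB _
  have hsB : s ∉ B := fun h => hs (hB h)
  by_cases h : i ∈ B <;> by_cases h' : r ∈ B <;>
    simp [rootWeight₂, h, h', hsB, hrs, Finset.card_insert_of_notMem hsB]

theorem rootWeight₂_insert_same {U : Finset V} {s : V} (hs : s ∉ U) (r : V)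
    (g g₁ g₂ w : ℕ → R) :
    ∀ B ⊆ U, B.Nonempty → (if r ∈ B then rootWeight₂ r s g g₁ g₂ w (insert s B)
        else rootWeight₂ r s g g₁ g₂ w B) = rootWeight r (fun k => g (k + 1)) w B := by
  intro B hB _
  have hsB : s ∉ B := fun h => hs (hB h)
  by_cases h' : r ∈ B <;>
    simp [rootWeight₂, rootWeight, h', hsB, Finset.card_insert_of_notMem hsB]

theorem rootWeight₂_notMem {U : Finset V} {s : V} (hs : s ∉ U) (r : V) (g g₁ g₂ w : ℕ → R) :
    ∀ B ⊆ U, B.Nonempty → rootWeight₂ r s g g₁ g₂ w B = rootWeight r g₁ w B := by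
  intro B hB _
  have hsB : s ∉ B := fun h => hs (hB h)
  simp [rootWeight₂, rootWeight, hsB]

/-! ### Cliques and exponential generating functions -/

section Complete

variable {w : ℕ → R} {Y : PowerSeries R} (h0 : coeff 0 Y = 1)
  (hY : derivative R Y = shiftSeries w * Y)

include h0 hY

/-- Here `Y = exp ∫ŵ`. Removing `r` leaves it alone, with weight `g 1`, or hanging on one of the
other `m` vertices, which becomes the root with a shifted weight; this is the decomposition `ĝ =
g(1) + x·(…)`. -/
theorem forestSum_complete_rootWeight {m : ℕ} {U : Finset V} (hU : U.card = m + 1) {r : V}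
    (hr : r ∈ U) {l : List (Sym2 V)} (hl : IsCompleteList U l) (g : ℕ → R) :
    forestSum U l (rootWeight r g w) = m.factorial * coeff m (shiftSeries g * Y) := by
  induction m generalizing U r l g with
  | zero =>
    obtain ⟨x, rfl⟩ := Finset.card_eq_one.1 hU
    obtain rfl := Finset.mem_singleton.1 hr
    have hl' : l = [] := by
      refine List.eq_nil_iff_forall_not_mem.2 fun e he => ?_
      have := (hl.2 e).1 he
      induction e with | _ a b
      simp at this
      exact this.1 (this.2.1.trans this.2.2.symm)
    rw [hl', forestSum_nil_singleton]
    simp only [coeff_zero_eq_constantCoeff] at h0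
    simp [rootWeight, h0, constantCoeff_shiftSeries]
  | succ n ih =>
    obtain ⟨l', hl'⟩ := exists_isCompleteList (U.erase r)
    have hr' := Finset.notMem_erase r U
    have hU' : (U.erase r).card = n + 1 := by rw [Finset.card_erase_of_mem hr, hU]; rfl
    rw [← Finset.insert_erase hr] at hl ⊢
    obtain ⟨i, hi⟩ : (U.erase r).Nonempty := Finset.card_pos.1 (by omega)
    -- Without `r` no block is special, so `i` may serve as a root of weight `w`. The equation `Y' =
    -- ŵY` then turns the coefficient into `n + 1` times the next coefficient of `Y`.
    have h1 : forestSum (U.erase r) l' (rootWeight r g w) =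
        (n + 1).factorial * coeff (n + 1) Y := by
      rw [forestSum_congr (g := rootWeight i w w), ih hU' hi hl', ← hY, coeff_derivative,
        Nat.factorial_succ]
      · push_cast; ring
      · intro B hB _
        rw [rootWeight_self, rootWeight, if_neg fun h => hr' (hB h)]
    rw [forestSum_complete_insert hr' hl hl', h1,
      Finset.sum_congr rfl fun i hi => (forestSum_congr l' (rootWeight_insert_root hr' i g w)).trans
        (ih hU' hi hl' _), Finset.sum_const, hU', shiftSeries_eq g, add_mul, map_add, coeff_C_mul,
      mul_assoc, coeff_succ_X_mul, Nat.factorial_succ]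
    simp [rootWeight]
    ring

/-- Removing `s` gives the three cases of `pairSeries_eq`; in the last one there are `m` choices for
the neighbour, which is how the factorial arises. -/
theorem forestSum_complete_rootWeight₂ {m : ℕ} {U : Finset V} (hU : U.card = m + 2) {r s : V}
    (hr : r ∈ U) (hs : s ∈ U) (hrs : r ≠ s) {l : List (Sym2 V)} (hl : IsCompleteList U l)
    (g g₁ g₂ : ℕ → R) :
    forestSum U l (rootWeight₂ r s g g₁ g₂ w) =
      m.factorial * coeff m (pairSeries g g₁ g₂ * Y) := by
  induction m generalizing U s l g g₁ g₂ with
  | zero =>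
    obtain ⟨l', hl'⟩ := exists_isCompleteList (U.erase s)
    have hs' := Finset.notMem_erase s U
    have hU' : (U.erase s).card = 0 + 1 := by rw [Finset.card_erase_of_mem hs, hU]
    have hrU : r ∈ U.erase s := Finset.mem_erase.2 ⟨hrs, hr⟩
    have hUr : U.erase s = {r} := by
      obtain ⟨x, hx⟩ := Finset.card_eq_one.1 hU'
      rw [hx] at hrU ⊢
      rw [Finset.mem_singleton.1 hrU]
    rw [← Finset.insert_erase hs] at hl ⊢
    rw [forestSum_complete_insert hs' hl hl', forestSum_congr l' (rootWeight₂_notMem hs' _ _ _ _ _),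
      forestSum_complete_rootWeight h0 hY hU' hrU hl', hUr, Finset.sum_singleton, ← hUr,
      forestSum_congr l' (rootWeight₂_insert_same hs' _ _ _ _ _),
      forestSum_complete_rootWeight h0 hY hU' hrU hl', pairSeries_eq]
    simp [rootWeight₂, hrs, add_mul, mul_assoc]
  | succ n ih =>
    obtain ⟨l', hl'⟩ := exists_isCompleteList (U.erase s)
    have hs' := Finset.notMem_erase s U
    have hU' : (U.erase s).card = (n + 1) + 1 := by rw [Finset.card_erase_of_mem hs, hU]; rfl
    have hrU : r ∈ U.erase s := Finset.mem_erase.2 ⟨hrs, hr⟩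
    rw [← Finset.insert_erase hs] at hl ⊢
    have h1 : ∀ i ∈ (U.erase s).erase r, (forestSum (U.erase s) l' fun B =>
        if i ∈ B then rootWeight₂ r s g g₁ g₂ w (insert s B) else rootWeight₂ r s g g₁ g₂ w B) =
        n.factorial * coeff n (pairSeries (fun k => g (k + 1)) g₁ (fun k => g₂ (k + 1)) * Y) :=
      fun i hi => (forestSum_congr l' (rootWeight₂_insert hs' hrs _ _ _ _ _)).trans
        (ih hU' hrU (Finset.mem_of_mem_erase hi) (Finset.ne_of_mem_erase hi).symm hl' _ _ _)
    rw [forestSum_complete_insert hs' hl hl', forestSum_congr l' (rootWeight₂_notMem hs' _ _ _ _ _),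
      forestSum_complete_rootWeight h0 hY hU' hrU hl', ← Finset.add_sum_erase _ _ hrU,
      forestSum_congr l' (rootWeight₂_insert_same hs' _ _ _ _ _),
      forestSum_complete_rootWeight h0 hY hU' hrU hl', Finset.sum_congr rfl h1, Finset.sum_const,
      Finset.card_erase_of_mem hrU, hU', pairSeries_eq g, add_mul, add_mul, map_add, map_add,
      mul_assoc, coeff_C_mul, mul_assoc X, coeff_succ_X_mul, Nat.factorial_succ]
    simp [rootWeight₂, hrs]
    ring

end Complete

/-! ### Paths and cycles -/

/-- The edges of the path `0, 1, …, m`. -/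
def pathList (m : ℕ) : List (Sym2 ℕ) := (List.range m).map fun i => s(i, i + 1)

theorem pathList_succ (m : ℕ) : pathList (m + 1) = pathList m ++ [s(m, m + 1)] := by
  simp [pathList, List.range_succ]

theorem pathList_edgesIn (m : ℕ) : EdgesIn (Finset.range (m + 1)) (pathList m) := by
  intro e he v hv
  obtain ⟨i, hi, rfl⟩ := List.mem_map.1 he
  rw [List.mem_range] at hi
  rw [Finset.mem_range]
  rcases Sym2.mem_iff.1 hv with rfl | rfl <;> omega

section Path

variable {w : ℕ → R} {Y : PowerSeries R} (hY : Y = 1 + X * shiftSeries w * Y)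

include hY

/-- Here `Y = 1/(1 - xŵ)` counts sequences of trees. A forest of the path is either one tree through
both ends, or a first tree and a last tree with such a sequence between them. -/
theorem forestSum_path_rootWeight₂ (m : ℕ) (g g₁ g₂ : ℕ → R) :
    forestSum (Finset.range (m + 1)) (pathList m) (rootWeight₂ 0 m g g₁ g₂ w) =
      coeff m (X * shiftSeries g₁ * shiftSeries g₂ * Y + shiftSeries g) := by
  induction m generalizing g g₁ g₂ with
  | zero =>
    have : pathList 0 = [] := rfl
    rw [this, show Finset.range (0 + 1) = {0} from rfl, forestSum_nil_singleton]
    simp [rootWeight₂, constantCoeff_shiftSeries, mul_assoc]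
  | succ m ih =>
    have hs : m + 1 ∉ Finset.range (m + 1) := by simp
    have h1 : forestSum (Finset.range (m + 1)) (pathList m) (rootWeight₂ 0 (m + 1) g g₁ g₂ w) =
        coeff m (shiftSeries g₁ * Y) := by
      rw [forestSum_congr _ (rootWeight₂_notMem hs _ _ _ _ _), ← rootWeight₂_self 0 m, ih]
      congr 1
      conv_rhs => rw [hY]
      ring
    rw [Finset.range_add_one (n := m + 1), pathList_succ,
      forestSum_leaf (pathList_edgesIn m) hs (by simp), h1,
      forestSum_congr _ (rootWeight₂_insert hs (by simp) _ _ _ _ _), ih]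
    have h2 : rootWeight₂ 0 (m + 1) g g₁ g₂ w {m + 1} = g₂ 1 := by simp [rootWeight₂]
    have h3 : X * shiftSeries g₁ * shiftSeries g₂ * Y + shiftSeries g = C (g 1) +
        X * (C (g₂ 1) * (shiftSeries g₁ * Y) + (X * shiftSeries g₁ *
          (shiftSeries fun k => g₂ (k + 1)) * Y + shiftSeries fun k => g (k + 1))) := by
      conv_lhs => rw [shiftSeries_eq g, shiftSeries_eq g₂]
      ring
    rw [h2, h3, map_add (coeff (m + 1)), coeff_succ_X_mul, map_add (coeff m) (C (g₂ 1) * _),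
      coeff_C_mul]
    simp

theorem forestSum_path_rootWeight (m : ℕ) (g : ℕ → R) :
    forestSum (Finset.range (m + 1)) (pathList m) (rootWeight 0 g w) =
      coeff m (shiftSeries g * Y) := by
  rw [← rootWeight₂_self 0 m, forestSum_path_rootWeight₂ hY]
  congr 1
  conv_rhs => rw [hY]
  ring

/-- The last vertex is alone, hangs on its predecessor in the path, or hangs on `0` after its
predecessor has been joined to `0` by a chord. The first two cases are path sums, the third is a
shorter cycle. -/
theorem forestSum_cycle_rootWeight₂ (m : ℕ) (g g₁ g₂ : ℕ → R) :
    forestSum (Finset.range (m + 1)) (pathList m ++ [s(m, 0)]) (rootWeight₂ 0 m g g₁ g₂ w) =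
      coeff m (X * pairSeries g g₁ g₂ * Y) := by
  induction m generalizing g g₁ g₂ with
  | zero =>
    -- For `m = 0` the closing edge is a loop. It joins nothing, so its presence and absence cancel,
    -- in accordance with the factor `X`.
    have : Setoid.ofEdge s(0, 0) = ⊥ := le_bot_iff.1 (Setoid.ofEdge_le_iff.2 rfl)
    simp [forestSum, pathList, altSum, this, mul_assoc]
  | succ m ih =>
    have hs : m + 1 ∉ Finset.range (m + 1) := by simp
    rw [Finset.range_add_one (n := m + 1), pathList_succ, List.append_assoc, List.singleton_append,
      forestSum_cycle (pathList_edgesIn m) hs (by simp) (by simp),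
      forestSum_congr _ (rootWeight₂_notMem hs _ _ _ _ _), forestSum_path_rootWeight hY,
      forestSum_congr _ (rootWeight₂_insert hs (by simp) _ _ _ _ _), forestSum_path_rootWeight₂ hY,
      forestSum_congr _ (rootWeight₂_insert_same hs _ _ _ _ _), ← rootWeight₂_self 0 m, ih,
      mul_assoc X (pairSeries g g₁ g₂), coeff_succ_X_mul, pairSeries_eq g]
    have h2 : rootWeight₂ 0 (m + 1) g g₁ g₂ w {m + 1} = g₂ 1 := by simp [rootWeight₂]
    rw [h2, ← coeff_C_mul, ← map_add, ← map_add]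
    congr 1
    simp only [pairSeries]
    linear_combination (-shiftSeries fun k => g (k + 1)) * hY

end Path

end RootWeights

/-! ### Non-broken circuits -/

section NonBroken

open Setoid

variable {V R : Type*} [DecidableEq V] [CommRing R]

theorem Finset.card_image_le_of_imp {α β γ : Type*} [DecidableEq β] [DecidableEq γ] {U : Finset α}
    {a : α → β} {h : α → γ} (hah : ∀ x ∈ U, ∀ y ∈ U, a x = a y → h x = h y) :
    (U.image h).card ≤ (U.image a).card := by
  classical
  have : ∀ c ∈ U.image h, ∃ x ∈ U, h x = c := fun c hc => Finset.mem_image.1 hc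
  rcases isEmpty_or_nonempty α with _ | _
  · simp [Finset.eq_empty_of_isEmpty U]
  choose! k hk hk' using this
  refine Finset.card_le_card_of_injOn (fun c => a (k c))
    (fun c hc => Finset.mem_image_of_mem _ (hk c hc)) ?_
  intro c hc d hd hcd
  rw [← hk' c hc, ← hk' d hd]
  exact hah _ (hk c hc) _ (hk d hd) hcd

theorem card_blocks_eq_card_image {γ : Type*} [DecidableEq γ] (U : Finset V) (π : Setoid V)
    (h : V → γ) (hπ : ∀ x y, π x y ↔ h x = h y) : (π.blocks U).card = (U.image h).card := by
  have key : ∀ x ∈ U, ∀ y ∈ U, π.block U x = π.block U y ↔ h x = h y := by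
    intro x hx y hy
    rw [← hπ]
    refine ⟨fun e => ?_, block_congr⟩
    have := self_mem_block π hy
    rw [← e] at this
    exact (mem_block.1 this).2
  exact le_antisymm (Finset.card_image_le_of_imp fun x hx y hy => (key x hx y hy).2)
    (Finset.card_image_le_of_imp fun x hx y hy => (key x hx y hy).1)

/-- Blocks are counted as values of a function: `θ` redirects the class of `v` to that of `u`, so
exactly one value is lost. -/
theorem card_blocks_sup_ofEdge {U : Finset V} {π : Setoid V} {u v : V} (hu : u ∈ U) (hv : v ∈ U)
    (huv : ¬ π u v) : (π.blocks U).card = ((π ⊔ ofEdge s(u, v)).blocks U).card + 1 := by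
  classical
  let q : V → Quotient π := Quotient.mk π
  have hq : ∀ x y, q x = q y ↔ π x y := fun x y => Quotient.eq
  let θ : V → Quotient π := fun x => if q x = q v then q u else q x
  have huv' : q u ≠ q v := fun h => huv ((hq _ _).1 h)
  have hθ : π ⊔ ofEdge s(u, v) = ker θ := by
    refine le_antisymm (sup_le ?_ ?_) ?_
    · intro x y h
      have : q x = q y := (hq _ _).2 h
      simp only [ker_def, θ, this]
    · rw [ofEdge_le_iff, ker_def]
      simp [θ]
    · intro x y h
      rw [ker_def] at h
      have hle : ∀ x y, q x = q y → (π ⊔ ofEdge s(u, v)) x y := fun x y h =>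
        (le_sup_left : π ≤ _) ((hq _ _).1 h)
      have he : (π ⊔ ofEdge s(u, v)) u v :=
        (le_sup_right : ofEdge s(u, v) ≤ π ⊔ _) (ofEdge_le_iff.1 le_rfl)
      simp only [θ] at h
      split_ifs at h with h1 h2 h2
      · exact hle _ _ (h1.trans h2.symm)
      · exact Setoid.trans' _ (hle _ _ h1) (Setoid.trans' _ (Setoid.symm' _ he) (hle _ _ h))
      · exact Setoid.trans' _ (hle _ _ h) (Setoid.trans' _ he (hle _ _ h2.symm))
      · exact hle _ _ h
  have himg : U.image θ = (U.image q).erase (q v) := by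
    ext c
    simp only [Finset.mem_image, Finset.mem_erase, θ]
    constructor
    · rintro ⟨x, hx, rfl⟩
      split_ifs with h
      exacts [⟨huv', u, hu, rfl⟩, ⟨h, x, hx, rfl⟩]
    · rintro ⟨hc, x, hx, rfl⟩
      exact ⟨x, hx, if_neg hc⟩
  rw [card_blocks_eq_card_image U π q fun x y => (hq x y).symm,
    card_blocks_eq_card_image U _ θ fun x y => by rw [hθ, ker_def], himg,
    Finset.card_erase_add_one (Finset.mem_image_of_mem _ hv)]

/-- No edge of the list `l` joins two vertices that are equivalent under the join of `π` and the
edges in `F` that precede it in `l`. -/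
def NoActiveEdge (F : Finset (Sym2 V)) : List (Sym2 V) → Setoid V → Prop
  | [], _ => True
  | e :: l, π => ¬ ofEdge e ≤ π ∧ NoActiveEdge F l (if e ∈ F then π ⊔ ofEdge e else π)

theorem noActiveEdge_insert {e : Sym2 V} {l : List (Sym2 V)} (he : e ∉ l) (F : Finset (Sym2 V))
    (π : Setoid V) : NoActiveEdge (insert e F) l π ↔ NoActiveEdge F l π := by
  induction l generalizing π with
  | nil => rfl
  | cons f l ih =>
    have hf : f ≠ e := fun h => he (h ▸ List.mem_cons_self)
    have hl : e ∉ l := fun h => he (List.mem_cons_of_mem _ h)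
    simp only [NoActiveEdge, ih hl, Finset.mem_insert, hf, false_or]

theorem noActiveEdge_iff {F : Finset (Sym2 V)} {l : List (Sym2 V)} (hl : l.Nodup) (π : Setoid V) :
    NoActiveEdge F l π ↔ ∀ e ∈ l,
      ¬ ofEdge e ≤ π ⊔ {f ∈ F | f ∈ l ∧ l.idxOf f < l.idxOf e}.sup ofEdge := by
  induction l generalizing π with
  | nil => simp [NoActiveEdge]
  | cons e l ih =>
    obtain ⟨he, hl⟩ := List.nodup_cons.1 hl
    simp only [NoActiveEdge, ih hl, List.forall_mem_cons]
    refine and_congr (by simp) (forall₂_congr fun f hf => ?_)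
    have hfe : e ≠ f := fun h => he (h ▸ hf)
    have h : (if e ∈ F then π ⊔ ofEdge e else π) ⊔ {x ∈ F | x ∈ l ∧ l.idxOf x < l.idxOf f}.sup ofEdge
        = π ⊔ {x ∈ F | x ∈ e :: l ∧ (e :: l).idxOf x < (e :: l).idxOf f}.sup ofEdge := by
      have hx : ∀ x ∈ l, (x ∈ e :: l ∧ (e :: l).idxOf x < (e :: l).idxOf f) ↔
          (x ∈ l ∧ l.idxOf x < l.idxOf f) := by
        intro x hx
        have : e ≠ x := fun h => he (h ▸ hx)
        simp [List.idxOf_cons_ne _ this, List.idxOf_cons_ne _ hfe, hx]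
      split_ifs with heF
      · have : {x ∈ F | x ∈ e :: l ∧ (e :: l).idxOf x < (e :: l).idxOf f} =
            insert e {x ∈ F | x ∈ l ∧ l.idxOf x < l.idxOf f} := by
          ext x
          by_cases hxe : x = e
          · subst hxe
            simp [heF, List.idxOf_cons_ne _ hfe]
          · by_cases hxl : x ∈ l
            · simp only [Finset.mem_filter, Finset.mem_insert, hx x hxl, hxe, false_or]
            · simp [hxl, hxe]
        rw [this, Finset.sup_insert, sup_assoc]
      · have : {x ∈ F | x ∈ e :: l ∧ (e :: l).idxOf x < (e :: l).idxOf f} =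
            {x ∈ F | x ∈ l ∧ l.idxOf x < l.idxOf f} := by
          ext x
          by_cases hxe : x = e
          · subst hxe
            simp [heF]
          · by_cases hxl : x ∈ l
            · simp only [Finset.mem_filter, hx x hxl]
            · simp [hxl, hxe]
        rw [this]
    rw [h]

open Classical in
-- Whitney's broken circuit theorem with block weights. The edges are treated in increasing order:
-- an edge inside a block of `π` kills both sides, and any other edge may be taken or not. Taking it
-- lowers the number of blocks by one, which absorbs the sign of the alternating sum.
theorem sum_noActiveEdge {U : Finset V} (f : Finset V → R) {l : List (Sym2 V)} (hl : l.Nodup)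
    (hU : EdgesIn U l) (π : Setoid V) :
    ∑ F ∈ l.toFinset.powerset with NoActiveEdge F l π, blockProd U f (π ⊔ F.sup ofEdge) =
      (-1) ^ (π.blocks U).card * altSum (l.map ofEdge) (blockProd U fun B => -f B) π := by
  induction l generalizing π with
  | nil =>
    rw [List.toFinset_nil, Finset.powerset_empty, Finset.filter_singleton,
      if_pos (show NoActiveEdge ∅ [] π from trivial),
      Finset.sum_singleton, Finset.sup_empty, sup_bot_eq, List.map_nil, altSum]
    rw [blockProd, blockProd, Finset.prod_neg, ← mul_assoc, ← pow_add, ← two_mul, pow_mul]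
    simp
  | cons e l ih =>
    obtain ⟨he, hl⟩ := List.nodup_cons.1 hl
    have hU' : EdgesIn U l := fun f hf => hU f (List.mem_cons_of_mem _ hf)
    rw [List.map_cons, altSum]
    by_cases heπ : ofEdge e ≤ π
    · rw [sup_eq_left.2 heπ, sub_self, mul_zero]
      refine Finset.sum_eq_zero fun F hF => ?_
      exact absurd heπ (Finset.mem_filter.1 hF).2.1
    · have hcard : (-1 : R) ^ (π.blocks U).card = -(-1) ^ ((π ⊔ ofEdge e).blocks U).card := by
        induction e with | _ u v
        rw [card_blocks_sup_ofEdge (hU _ List.mem_cons_self u (by simp))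
          (hU _ List.mem_cons_self v (by simp)) fun h => heπ (ofEdge_le_iff.2 h), pow_succ]
        ring
      rw [mul_sub, ← ih hl hU', hcard, neg_mul, sub_neg_eq_add, ← ih hl hU', Finset.sum_filter,
        List.toFinset_cons, Finset.sum_powerset_insert (by simpa using he), Finset.sum_filter,
        Finset.sum_filter]
      congr 1
      · refine Finset.sum_congr rfl fun F hF => ?_
        have heF : e ∉ F := fun h => he (by simpa using Finset.mem_powerset.1 hF h)
        simp only [NoActiveEdge, heπ, heF, not_false_eq_true, true_and, if_false]
      · refine Finset.sum_congr rfl fun F hF => ?_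
        simp only [NoActiveEdge, heπ, noActiveEdge_insert he, not_false_eq_true, true_and,
          Finset.mem_insert, true_or, if_true, Finset.sup_insert, sup_assoc]

theorem card_blocks_bot (U : Finset V) : ((⊥ : Setoid V).blocks U).card = U.card := by
  rw [card_blocks_eq_card_image U ⊥ id fun x y => Iff.rfl, Finset.image_id]

end NonBroken

namespace OrderedGraph

open Setoid

theorem sup_ofEdge_rel_iff {V : Type*} [DecidableEq V] (F : Finset (Sym2 V)) (u v : V) :
    (F.sup ofEdge) u v ↔ (SimpleGraph.fromEdgeSet (F : Set (Sym2 V))).Reachable u v := by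
  constructor
  · have : F.sup ofEdge ≤ (SimpleGraph.fromEdgeSet (F : Set (Sym2 V))).reachableSetoid := by
      refine Finset.sup_le fun e he => ?_
      induction e with | _ x y
      rw [ofEdge_le_iff]
      change (SimpleGraph.fromEdgeSet (F : Set (Sym2 V))).Reachable x y
      by_cases hxy : x = y
      · rw [hxy]
      · exact SimpleGraph.Adj.reachable (by simp [he, hxy])
    exact fun h => this h
  · rintro ⟨p⟩
    induction p with
    | nil => exact Setoid.refl' _ _
    | cons h _ ih =>
      refine Setoid.trans' _ ?_ ih
      rw [SimpleGraph.fromEdgeSet_adj] at h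
      exact ofEdge_le_iff.1 (Finset.le_sup (f := ofEdge) h.1)

/-- An edge `e` has its ends connected by smaller edges of `F` exactly when `F` contains a broken
circuit obtained by removing `e` as the largest edge. Whether `e` itself belongs to `F` does not
matter. -/
theorem isNonBroken_iff (G : OrderedGraph) (F : Finset (Sym2 G.Vertex)) :
    G.IsNonBroken F ↔ (∀ e ∈ F, e ∈ G.edges) ∧ NoActiveEdge F G.edges ⊥ := by
  rw [IsNonBroken, noActiveEdge_iff G.nodup]
  refine and_congr_right fun hF => ?_
  have hidx : ∀ e ∈ G.edges, ∀ f, G.edges.idxOf f = G.edges.idxOf e → f = e := fun e he f h =>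
    ((List.idxOf_inj he).1 h.symm).symm
  have hX : ∀ e, {f ∈ F | f ∈ G.edges ∧ G.edges.idxOf f < G.edges.idxOf e} =
      {f ∈ F | G.edges.idxOf f < G.edges.idxOf e} := fun e =>
    Finset.filter_congr fun f hf => by simp [hF f hf]
  constructor
  · intro h e he hle
    rw [bot_sup_eq, hX] at hle
    have hdiag := G.loopless e he
    induction e with | _ u v
    rw [ofEdge_le_iff, sup_ofEdge_rel_iff] at hle
    set X := {f ∈ F | G.edges.idxOf f < G.edges.idxOf s(u, v)} with hXdef
    have hle' : SimpleGraph.fromEdgeSet (X : Set (Sym2 G.Vertex)) ≤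
        (SimpleGraph.fromEdgeSet (insert s(u, v) X : Set (Sym2 G.Vertex))).deleteEdges
          {s(u, v)} := by
      intro x y hxy
      rw [SimpleGraph.fromEdgeSet_adj] at hxy
      rw [SimpleGraph.deleteEdges_adj, SimpleGraph.fromEdgeSet_adj]
      refine ⟨⟨Or.inr hxy.1, hxy.2⟩, fun h' => ?_⟩
      have h'' := hxy.1
      rw [Set.mem_singleton_iff.1 h'] at h''
      simp [hXdef] at h''
    obtain ⟨w, p, hp, hep⟩ := SimpleGraph.adj_and_reachable_delete_edges_iff_exists_cycle.1
      ⟨(SimpleGraph.fromEdgeSet_adj _).2 ⟨Or.inl rfl, by simpa using hdiag⟩, hle.mono hle'⟩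
    have hG : SimpleGraph.fromEdgeSet (insert s(u, v) X : Set (Sym2 G.Vertex)) ≤ G.graph := by
      refine SimpleGraph.fromEdgeSet_mono ?_
      rintro f (rfl | hf)
      · exact he
      · exact hF f (Finset.mem_filter.1 hf).1
    have hpe : ∀ f ∈ p.edges, f = s(u, v) ∨ f ∈ X := by
      intro f hf
      have := p.edges_subset_edgeSet hf
      rw [SimpleGraph.edgeSet_fromEdgeSet] at this
      exact this.1
    refine h _ ⟨w, p.mapLe hG, hp.mapLe hG, s(u, v), by simpa using hep, ?_, rfl⟩ ?_
    · intro f hf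
      rcases hpe f (by simpa using hf) with rfl | hf
      · exact le_rfl
      · exact (Finset.mem_filter.1 hf).2.le
    · intro f hf
      rw [Finset.mem_erase] at hf
      rcases hpe f (by simpa using hf.2) with rfl | hf'
      · exact absurd rfl hf.1
      · exact (Finset.mem_filter.1 hf').1
  · rintro h B ⟨w, p, hp, e, he, hmax, rfl⟩ hB
    have hGe : ∀ f ∈ p.edges, f ∈ G.edges := fun f hf => by
      have := p.edges_subset_edgeSet hf
      rw [graph, SimpleGraph.edgeSet_fromEdgeSet] at this
      exact this.1
    refine h e (hGe e he) ?_
    rw [bot_sup_eq, hX]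
    induction e with | _ u v
    rw [ofEdge_le_iff, sup_ofEdge_rel_iff]
    have hp' : ∀ f ∈ p.edges, f ∈ (SimpleGraph.fromEdgeSet {f | f ∈ p.edges}).edgeSet := by
      intro f hf
      rw [SimpleGraph.edgeSet_fromEdgeSet]
      exact ⟨hf, G.loopless f (hGe f hf)⟩
    have := (SimpleGraph.adj_and_reachable_delete_edges_iff_exists_cycle.2
      ⟨w, p.transfer _ hp', hp.transfer hp', by simpa using he⟩).2
    refine this.mono ?_
    intro x y hxy
    rw [SimpleGraph.deleteEdges_adj, SimpleGraph.fromEdgeSet_adj] at hxy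
    rw [SimpleGraph.fromEdgeSet_adj]
    obtain ⟨⟨hxy1, hxy2⟩, hxy3⟩ := hxy
    have hne : s(x, y) ≠ s(u, v) := by simpa using hxy3
    refine ⟨Finset.mem_coe.2 (Finset.mem_filter.2 ⟨hB ?_, ?_⟩), hxy2⟩
    · exact Finset.mem_erase.2 ⟨hne, List.mem_toFinset.2 hxy1⟩
    · exact lt_of_le_of_ne (hmax _ hxy1) fun h => hne (hidx _ (hGe _ he) _ h)

open Classical in
/-- The non-broken circuits. -/
noncomputable def nonBroken (G : OrderedGraph) : Finset (Finset (Sym2 G.Vertex)) :=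
  Finset.univ.filter G.IsNonBroken

theorem mem_nonBroken {G : OrderedGraph} {F : Finset (Sym2 G.Vertex)} :
    F ∈ G.nonBroken ↔ G.IsNonBroken F := by simp [nonBroken]

theorem sum_nonBroken {R : Type*} [CommRing R] (G : OrderedGraph) (f : Finset G.Vertex → R) :
    ∑ F ∈ G.nonBroken, blockProd Finset.univ f (F.sup ofEdge) =
      forestSum Finset.univ G.edges f := by
  classical
  have h := sum_noActiveEdge f G.nodup (U := Finset.univ) (fun _ _ _ _ => Finset.mem_univ _) ⊥
  rw [forestSum, ← card_blocks_bot, ← h]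
  refine Finset.sum_congr ?_ fun F _ => by rw [bot_sup_eq]
  ext F
  rw [mem_nonBroken, isNonBroken_iff, Finset.mem_filter, Finset.mem_powerset]
  refine and_congr_left fun _ => ?_
  simp [Finset.subset_iff]

end OrderedGraph

/-! ### Compositions -/

section Compositions

/-- The compositions of `n`, as lists. -/
def compositionLists : ℕ → Finset (List ℕ)
  | 0 => {[]}
  | n + 1 => Finset.univ.biUnion fun i : Fin (n + 1) =>
      (compositionLists (n - i)).image (List.cons (i + 1))

theorem mem_compositionLists {n : ℕ} {α : List ℕ} :
    α ∈ compositionLists n ↔ (∀ a ∈ α, 0 < a) ∧ α.sum = n := by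
  induction n using Nat.strong_induction_on generalizing α with
  | _ n ih =>
    cases n with
    | zero =>
      rw [compositionLists, Finset.mem_singleton]
      constructor
      · rintro rfl
        simp
      · rintro ⟨h, h'⟩
        cases α with
        | nil => rfl
        | cons a α =>
          have := h a List.mem_cons_self
          simp at h'
          omega
    | succ n =>
      rw [compositionLists, Finset.mem_biUnion]
      simp only [Finset.mem_univ, true_and, Finset.mem_image]
      constructor
      · rintro ⟨i, β, hβ, rfl⟩
        rw [ih _ (by omega)] at hβ
        have := i.2
        simp only [List.forall_mem_cons, List.sum_cons, hβ.2]
        exact ⟨⟨by omega, hβ.1⟩, by omega⟩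
      · rintro ⟨h, h'⟩
        cases α with
        | nil => simp at h'
        | cons a α =>
          simp only [List.forall_mem_cons, List.sum_cons] at h h'
          refine ⟨⟨a - 1, by omega⟩, α, ?_, ?_⟩
          · rw [ih _ (by simp only; omega)]
            exact ⟨h.2, by simp; omega⟩
          · simp only [List.cons.injEq, and_true]
            omega

theorem sum_compositionLists_succ {M : Type*} [AddCommMonoid M] (n : ℕ) (φ : List ℕ → M) :
    ∑ α ∈ compositionLists (n + 1), φ α =
      ∑ i ∈ Finset.range (n + 1), ∑ β ∈ compositionLists (n - i), φ ((i + 1) :: β) := by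
  rw [compositionLists, Finset.sum_biUnion, Finset.sum_range]
  · refine Finset.sum_congr rfl fun i _ => ?_
    rw [Finset.sum_image]
    intro β _ β' _ h
    exact (List.cons.inj h).2
  · intro i _ j _ hij
    rw [Function.onFun, Finset.disjoint_left]
    intro α hα hα'
    obtain ⟨β, _, rfl⟩ := Finset.mem_image.1 hα
    obtain ⟨β', _, h⟩ := Finset.mem_image.1 hα'
    have := (List.cons.inj h).1
    exact hij (Fin.ext (by omega))

/-- The pairs `(α, r)` with `α` a composition of `n` and `1 ≤ r ≤ α_1`. -/
def treeData (n : ℕ) : Finset (Σ _ : List ℕ, ℕ) :=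
  (compositionLists n).sigma fun α => Finset.Icc 1 (α.headD 0)

theorem sum_treeData_zero {M : Type*} [AddCommMonoid M] (φ : (Σ _ : List ℕ, ℕ) → M) :
    ∑ x ∈ treeData 0, φ x = 0 := by
  simp [treeData, Finset.sum_sigma, compositionLists]

theorem sum_treeData_succ {M : Type*} [AddCommMonoid M] (n : ℕ) (φ : (Σ _ : List ℕ, ℕ) → M) :
    ∑ x ∈ treeData (n + 1), φ x = ∑ i ∈ Finset.range (n + 1), ∑ β ∈ compositionLists (n - i),
      ∑ r ∈ Finset.Icc 1 (i + 1), φ ⟨(i + 1) :: β, r⟩ := by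
  rw [treeData, Finset.sum_sigma, sum_compositionLists_succ]
  rfl

variable {R : Type*} [CommRing R] (e : ℕ → R)

/-- `∏ e_{α_i}`. -/
def compWeight (α : List ℕ) : R := (α.map e).prod

/-- `∑_α (-1)^{ℓ(α)} e_α` over the compositions `α` of `n`. -/
def signedComplete (n : ℕ) : R := ∑ α ∈ compositionLists n, (-1) ^ α.length * compWeight e α

theorem signedComplete_zero : signedComplete e 0 = 1 := by
  simp [signedComplete, compositionLists, compWeight]

theorem signedComplete_succ (n : ℕ) : signedComplete e (n + 1) =
    -∑ i ∈ Finset.range (n + 1), e (i + 1) * signedComplete e (n - i) := by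
  rw [signedComplete, sum_compositionLists_succ, ← Finset.sum_neg_distrib]
  refine Finset.sum_congr rfl fun i _ => ?_
  rw [signedComplete, Finset.mul_sum, ← Finset.sum_neg_distrib]
  refine Finset.sum_congr rfl fun β _ => ?_
  simp only [compWeight, List.length_cons, List.map_cons, List.prod_cons, pow_succ]
  ring

/-- `∑ (-1)^{ℓ(α) - 1} e_α` over the pairs `(α, r)` with `α` a composition of `n`. -/
def signedPower (n : ℕ) : R := ∑ x ∈ treeData n, (-1) ^ (x.1.length - 1) * compWeight e x.1

theorem signedPower_zero : signedPower e 0 = 0 := sum_treeData_zero _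

theorem signedPower_succ (n : ℕ) : signedPower e (n + 1) =
    ∑ i ∈ Finset.range (n + 1), (i + 1 : ℕ) * e (i + 1) * signedComplete e (n - i) := by
  rw [signedPower, sum_treeData_succ]
  refine Finset.sum_congr rfl fun i _ => ?_
  rw [signedComplete, Finset.mul_sum]
  refine Finset.sum_congr rfl fun β _ => ?_
  simp only [Finset.sum_const, Nat.card_Icc, compWeight, List.length_cons, List.map_cons,
    List.prod_cons, nsmul_eq_mul, Nat.add_sub_cancel]
  ring

/-- Once the first part `a` is removed, an arbitrary composition of `n - a` remains, and the
exponent `ℓ(α) - 1` is its length. -/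
theorem sum_treeData_first {a r : ℕ} (hr : 1 ≤ r) (hra : r ≤ a) (n : ℕ) :
    (∑ x ∈ treeData n, if x.1.headD 0 = a then (if x.2 = r then
      (-1) ^ (x.1.length - 1) * compWeight e x.1 else 0) else 0) =
      if a ≤ n then e a * signedComplete e (n - a) else 0 := by
  cases n with
  | zero => rw [sum_treeData_zero, if_neg (by omega)]
  | succ n =>
    have h : ∀ i ∈ Finset.range (n + 1), (∑ β ∈ compositionLists (n - i),
        ∑ s ∈ Finset.Icc 1 (i + 1), if i + 1 = a then (if s = r then
          (-1) ^ (((i + 1) :: β : List ℕ).length - 1) * compWeight e ((i + 1) :: β) else 0)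
          else 0) =
        if i = a - 1 then e a * signedComplete e (n + 1 - a) else 0 := by
      intro i _
      by_cases h1 : i + 1 = a
      · rw [if_pos (by omega), signedComplete, Finset.mul_sum, show n + 1 - a = n - i by omega]
        refine Finset.sum_congr rfl fun β _ => ?_
        simp only [if_pos h1]
        rw [Finset.sum_ite_eq' _ r, if_pos (Finset.mem_Icc.2 ⟨hr, by omega⟩)]
        simp only [compWeight, List.length_cons, List.map_cons, List.prod_cons, h1,
          Nat.add_sub_cancel]
        ring
      · simp [h1, show i ≠ a - 1 by omega]
    rw [sum_treeData_succ]
    refine (Finset.sum_congr rfl h).trans ?_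
    rw [Finset.sum_ite_eq']
    simp only [Finset.mem_range]
    exact if_congr (by omega) rfl rfl

theorem sum_treeData_unit (n : ℕ) :
    (∑ x ∈ treeData n, if x.1.length = 1 then compWeight e x.1 else 0) = n * e n := by
  cases n with
  | zero => rw [sum_treeData_zero]; simp
  | succ n =>
    rw [sum_treeData_succ, Finset.sum_range_succ, Finset.sum_eq_zero]
    · simp [compositionLists, compWeight]
    · intro i hi
      refine Finset.sum_eq_zero fun β hβ => Finset.sum_eq_zero fun r _ => if_neg ?_
      have hi' := Finset.mem_range.1 hi
      have := (mem_compositionLists.1 hβ).2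
      cases β with
      | nil => simp at this; omega
      | cons b β => simp

theorem sum_treeData_unit_first {a r : ℕ} (hr : 1 ≤ r) (hra : r ≤ a) (n : ℕ) :
    (∑ x ∈ treeData n, if x.1.headD 0 = a then (if x.2 = r then
      (if x.1.length = 1 then compWeight e x.1 else 0) else 0) else 0) =
      if n = a then e a else 0 := by
  cases n with
  | zero => rw [sum_treeData_zero, if_neg (by omega)]
  | succ n =>
    rw [sum_treeData_succ, Finset.sum_range_succ, Finset.sum_eq_zero]
    · simp only [List.headD_cons, Nat.sub_self, compositionLists, Finset.sum_singleton,
        List.length_singleton, if_true, zero_add, compWeight, List.map_cons, List.map_nil,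
        List.prod_singleton]
      split_ifs with h
      · rw [Finset.sum_ite_eq' _ r, if_pos (Finset.mem_Icc.2 ⟨hr, by omega⟩), h]
      · simp
    · intro i hi
      refine Finset.sum_eq_zero fun β hβ => Finset.sum_eq_zero fun r _ => ?_
      have hi' := Finset.mem_range.1 hi
      have := (mem_compositionLists.1 hβ).2
      cases β with
      | nil => simp at this; omega
      | cons b β => simp

end Compositions

/-! ### Sums over forest triples -/

namespace OrderedGraph

open Setoid

section

variable {V : Type} [DecidableEq V] [Fintype V]

open Classical in
/-- The edges of `F` with both ends in `B`. -/
noncomputable def edgesWithin (F : Finset (Sym2 V)) (B : Finset V) : Finset (Sym2 V) :=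
  {e ∈ F | ∀ v ∈ e, v ∈ B}

theorem mem_edgesWithin {F : Finset (Sym2 V)} {B : Finset V} {e : Sym2 V} :
    e ∈ edgesWithin F B ↔ e ∈ F ∧ ∀ v ∈ e, v ∈ B := by simp [edgesWithin]

theorem isTreeTriple_iff {F : Finset (Sym2 V)} {τ : TreeTriple V} :
    IsTreeTriple F τ ↔ τ.verts ∈ (F.sup ofEdge).blocks Finset.univ ∧
      τ.edges = edgesWithin F τ.verts ∧ ⟨τ.comp, τ.r⟩ ∈ treeData τ.verts.card := by
  rw [IsTreeTriple, treeData, Finset.mem_sigma, mem_compositionLists, Finset.mem_Icc]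
  have h1 : (∃ c : (SimpleGraph.fromEdgeSet (F : Set (Sym2 V))).ConnectedComponent,
      (τ.verts : Set V) = c.supp) ↔ τ.verts ∈ (F.sup ofEdge).blocks Finset.univ := by
    have : ∀ x, ((SimpleGraph.fromEdgeSet (F : Set (Sym2 V))).connectedComponentMk x).supp =
        ((F.sup ofEdge).block Finset.univ x : Set V) := by
      intro x
      ext y
      rw [SimpleGraph.ConnectedComponent.mem_supp_iff, SimpleGraph.ConnectedComponent.eq,
        Finset.mem_coe, mem_block, ← sup_ofEdge_rel_iff]
      exact ⟨fun h => ⟨Finset.mem_univ _, Setoid.symm' _ h⟩, fun h => Setoid.symm' _ h.2⟩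
    rw [mem_blocks]
    constructor
    · rintro ⟨c, hc⟩
      induction c using SimpleGraph.ConnectedComponent.ind with | _ x
      rw [this] at hc
      exact ⟨x, Finset.mem_univ _, (Finset.coe_injective hc).symm⟩
    · rintro ⟨x, _, hx⟩
      exact ⟨SimpleGraph.connectedComponentMk _ x, by rw [this, hx]⟩
  have h2 : (∀ e, e ∈ τ.edges ↔ e ∈ F ∧ ∀ v ∈ e, v ∈ τ.verts) ↔
      τ.edges = edgesWithin F τ.verts := by
    simp only [Finset.ext_iff, mem_edgesWithin]
  rw [h1, h2]
  simp only [TreeTriple.first]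
  tauto

end

variable (G : OrderedGraph)

/-- A non-broken circuit with a composition `α` and an integer `r` for each of its trees. -/
abbrev DecoratedForest : Type :=
  Σ F : {F // F ∈ G.nonBroken}, ∀ B : {B // B ∈ (F.1.sup ofEdge).blocks (Finset.univ)},
    {x // x ∈ treeData B.1.card}

variable {G}

/-- The tree triple on a block of a decorated forest. -/
noncomputable def DecoratedForest.triple (D : G.DecoratedForest) :
    {B // B ∈ (D.1.1.sup ofEdge).blocks (Finset.univ)} ↪ TreeTriple G.Vertex where
  toFun B := ⟨B.1, edgesWithin D.1.1 B.1, (D.2 B).1.1, (D.2 B).1.2⟩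
  inj' _ _ h := Subtype.ext (TreeTriple.mk.inj h).1

/-- The forest triple of a decorated forest. -/
noncomputable def DecoratedForest.toForestTriple (D : G.DecoratedForest) : G.ForestTriple :=
  ⟨Finset.univ.map D.triple, D.1.1, mem_nonBroken.1 D.1.2, by
    intro τ hτ
    obtain ⟨B, _, rfl⟩ := Finset.mem_map.1 hτ
    exact isTreeTriple_iff.2 ⟨B.2, rfl, (D.2 B).2⟩, by
    intro v
    refine ⟨D.triple ⟨_, block_mem_blocks _ (Finset.mem_univ v)⟩,
      ⟨Finset.mem_map_of_mem _ (Finset.mem_univ _), self_mem_block _ (Finset.mem_univ v)⟩, ?_⟩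
    rintro τ ⟨hτ, hv⟩
    obtain ⟨B, _, rfl⟩ := Finset.mem_map.1 hτ
    congr 1
    exact Subtype.ext (eq_block_of_mem B.2 hv)⟩

theorem DecoratedForest.mem_iff (D : G.DecoratedForest) (e : Sym2 G.Vertex) :
    e ∈ D.1.1 ↔ ∃ τ ∈ D.toForestTriple.1, e ∈ τ.edges := by
  constructor
  · intro he
    induction e with | _ u v
    refine ⟨D.triple ⟨_, block_mem_blocks _ (Finset.mem_univ u)⟩,
      Finset.mem_map_of_mem _ (Finset.mem_univ _), mem_edgesWithin.2 ⟨he, ?_⟩⟩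
    have huv : (D.1.1.sup ofEdge) u v := ofEdge_le_iff.1 (Finset.le_sup (f := ofEdge) he)
    intro w hw
    rcases Sym2.mem_iff.1 hw with rfl | rfl
    · exact self_mem_block _ (Finset.mem_univ _)
    · exact mem_block.2 ⟨Finset.mem_univ _, huv⟩
  · rintro ⟨τ, hτ, he⟩
    obtain ⟨B, _, rfl⟩ := Finset.mem_map.1 hτ
    exact (mem_edgesWithin.1 he).1

/-- A forest triple determines its non-broken circuit as the union of the edges of its trees, so the
existential `F` in its definition carries no extra choice. -/
theorem DecoratedForest.toForestTriple_bijective :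
    Function.Bijective (DecoratedForest.toForestTriple (G := G)) := by
  constructor
  · rintro D D' h
    have hF : D.1 = D'.1 := Subtype.ext (Finset.ext fun e => by
      rw [D.mem_iff, D'.mem_iff, h])
    obtain ⟨F, p⟩ := D
    obtain ⟨F', p'⟩ := D'
    obtain rfl : F = F' := hF
    congr 1
    funext B
    have hB : DecoratedForest.triple ⟨F, p⟩ B ∈ (DecoratedForest.toForestTriple ⟨F, p'⟩).1 :=
      h ▸ Finset.mem_map_of_mem _ (Finset.mem_univ B)
    obtain ⟨B', _, hB'⟩ := Finset.mem_map.1 hB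
    have h' := TreeTriple.mk.inj hB'
    obtain rfl : B' = B := Subtype.ext h'.1
    refine Subtype.ext (Sigma.ext h'.2.2.1.symm (heq_of_eq h'.2.2.2.symm))
  · rintro ⟨S, F, hF, hS, hv⟩
    have hex : ∀ B : {B // B ∈ (F.sup ofEdge).blocks (Finset.univ)}, ∃ τ ∈ S, τ.verts = B.1 := by
      rintro ⟨B, hB⟩
      obtain ⟨x, hx⟩ := nonempty_of_mem_blocks hB
      obtain ⟨τ, ⟨hτ, hxτ⟩, _⟩ := hv x
      exact ⟨τ, hτ, (eq_block_of_mem (isTreeTriple_iff.1 (hS τ hτ)).1 hxτ).trans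
        (eq_block_of_mem hB hx).symm⟩
    choose t ht htB using hex
    let D : G.DecoratedForest := ⟨⟨F, mem_nonBroken.2 hF⟩, fun B =>
      ⟨⟨(t B).comp, (t B).r⟩, htB B ▸ (isTreeTriple_iff.1 (hS _ (ht B))).2.2⟩⟩
    have hD : ∀ B, D.triple B = t B := by
      intro B
      have h1 := (isTreeTriple_iff.1 (hS _ (ht B))).2.1
      rw [htB] at h1
      change TreeTriple.mk B.1 _ _ _ = t B
      conv_rhs => rw [show t B = ⟨(t B).verts, (t B).edges, (t B).comp, (t B).r⟩ from rfl, h1, htB]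
    refine ⟨D, Subtype.ext (Finset.ext fun τ => ?_)⟩
    change τ ∈ Finset.univ.map D.triple ↔ τ ∈ S
    rw [Finset.mem_map]
    constructor
    · rintro ⟨B, _, rfl⟩
      rw [hD]
      exact ht B
    · intro hτ
      have hB := (isTreeTriple_iff.1 (hS τ hτ)).1
      refine ⟨⟨τ.verts, hB⟩, Finset.mem_univ _, ?_⟩
      rw [hD]
      obtain ⟨x, hx⟩ := nonempty_of_mem_blocks hB
      exact (hv x).unique ⟨ht _, by rw [htB]; exact hx⟩ ⟨hτ, hx⟩

noncomputable instance : Fintype G.ForestTriple :=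
  Fintype.ofBijective _ (DecoratedForest.toForestTriple_bijective (G := G))

/-- The pairs `(α, r)` are chosen independently on the trees, so for fixed `F` the sum factors over
the blocks. -/
theorem sum_forestTriple {R : Type*} [CommRing R] (G : OrderedGraph)
    (ψ : Finset G.Vertex → List ℕ → ℕ → R) :
    ∑ S : G.ForestTriple, ∏ τ ∈ S.1, ψ τ.verts τ.comp τ.r =
      forestSum Finset.univ G.edges fun B => ∑ x ∈ treeData B.card, ψ B x.1 x.2 := by
  rw [← sum_nonBroken, ← (DecoratedForest.toForestTriple_bijective (G := G)).sum_comp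
    fun S => ∏ τ ∈ S.1, ψ τ.verts τ.comp τ.r, Fintype.sum_sigma, ← Finset.sum_coe_sort G.nonBroken]
  refine Finset.sum_congr rfl fun F _ => ?_
  have h : blockProd Finset.univ (fun B => ∑ x ∈ treeData B.card, ψ B x.1 x.2) (F.1.sup ofEdge) =
      ∏ B : {B // B ∈ (F.1.sup ofEdge).blocks (Finset.univ)},
        ∑ x : {x // x ∈ treeData B.1.card}, ψ B.1 x.1.1 x.1.2 := by
    rw [blockProd, ← Finset.prod_coe_sort]
    exact Finset.prod_congr rfl fun B _ =>
      (Finset.sum_coe_sort (treeData B.1.card) fun x => ψ B.1 x.1 x.2).symm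
  rw [h, Finset.prod_univ_sum, Fintype.piFinset_univ]
  exact Finset.sum_congr rfl fun p _ => Finset.prod_map _ _ _

end OrderedGraph

/-! ### Sums over forests of a glued graph -/

namespace OrderedGraph

open Setoid

variable {R : Type*} [CommRing R]

/-- The sum over the forests of `G`, with weight `g |T|` for the tree `T` of the vertex `0` and
weight `w |T|` for the other trees. -/
noncomputable def rootSum (G : OrderedGraph) (w g : ℕ → R) : R :=
  forestSum Finset.univ G.edges (rootWeight (0 : G.Vertex) g w)

/-- A linear functional on sequences that only depends on finitely many terms of positive index. -/
def IsFiniteFunctional (L : (ℕ → R) → R) : Prop :=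
  ∃ (W : ℕ → R) (N : ℕ), W 0 = 0 ∧ ∀ K, N < K → ∀ g, L g = ∑ j ∈ Finset.range K, W j * g j

theorem isFiniteFunctional_rootSum (G : OrderedGraph) (w : ℕ → R) :
    IsFiniteFunctional (G.rootSum w) := by
  let b : Finset (Sym2 G.Vertex) → ℕ := fun F => ((F.sup ofEdge).block Finset.univ 0).card
  let q : Finset (Sym2 G.Vertex) → R := fun F =>
    ∏ B ∈ (F.sup ofEdge).blocks Finset.univ with (0 : G.Vertex) ∉ B, w B.card
  have h : ∀ g, G.rootSum w g = ∑ F ∈ G.nonBroken, q F * g (b F) := by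
    intro g
    rw [rootSum, ← sum_nonBroken]
    refine Finset.sum_congr rfl fun F _ => ?_
    rw [blockProd_split _ _ (Finset.mem_univ (0 : G.Vertex)), mul_comm]
    congr 1
    · exact Finset.prod_congr rfl fun B hB => if_neg (Finset.mem_filter.1 hB).2
    · exact if_pos (self_mem_block _ (Finset.mem_univ _))
  refine ⟨fun j => ∑ F ∈ G.nonBroken, if b F = j then q F else 0, G.last + 1, ?_, ?_⟩
  · refine Finset.sum_eq_zero fun F _ => if_neg ?_
    exact (Finset.card_pos.2 ⟨0, self_mem_block _ (Finset.mem_univ _)⟩).ne'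
  · intro K hK g
    simp only [h, Finset.sum_mul]
    rw [Finset.sum_comm]
    refine Finset.sum_congr rfl fun F _ => ?_
    have hb : b F ∈ Finset.range K := by
      have := Finset.card_le_univ ((F.sup ofEdge).block Finset.univ (0 : G.Vertex))
      rw [Fintype.card_fin] at this
      exact Finset.mem_range.2 (lt_of_le_of_lt this hK)
    simp only [ite_mul, zero_mul]
    rw [Finset.sum_ite_eq, if_pos hb]

/-- The sum over the forests of `H` with the weights `rootWeight₂` for the first and the last
vertex. -/
noncomputable def pairSum (H : OrderedGraph) (w g g₁ g₂ : ℕ → R) : R :=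
  forestSum Finset.univ H.edges (rootWeight₂ (0 : H.Vertex) (Fin.last H.last) g g₁ g₂ w)

theorem pairSum_self (H : OrderedGraph) (w g : ℕ → R) : H.pairSum w g g w = H.rootSum w g := by
  rw [pairSum, rootWeight₂_self, rootSum]

/-- The tree through the shared vertex consists of a tree `C` of `H` and a tree `D` of `G` with one
common vertex, hence the size `|C| + |D| - 1`. It is the root tree when `0 ∈ C`. Summing over the
forests of `G` first leaves a weight that depends on `|C|` only. -/
theorem rootSum_add (H G : OrderedGraph) (w g : ℕ → R) :
    (H + G).rootSum w g = H.pairSum w (fun k => G.rootSum w fun j => g (k + j - 1)) g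
      (fun l => G.rootSum w fun j => w (l + j - 1)) := by
  let ιl : Fin (H.last + 1) ↪ Fin (H.last + G.last + 1) := ⟨inl _ _, inl_injective _ _⟩
  let ιr : Fin (G.last + 1) ↪ Fin (H.last + G.last + 1) := ⟨inr _ _, inr_injective _ _⟩
  have hl : ∀ i, (ιl i : ℕ) = i := fun i => rfl
  have hr : ∀ i, (ιr i : ℕ) = i + H.last := fun i => rfl
  set c : Fin (H.last + G.last + 1) := ιl (Fin.last _) with hc
  have hc' : c = ιr 0 := Fin.ext (by rw [hc, hl, hr]; simp)
  have h0 : (0 : Fin (H.last + G.last + 1)) = ιl 0 := Fin.ext (by rw [hl]; rfl)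
  have huniv : (Finset.univ : Finset (Fin (H.last + G.last + 1))) =
      Finset.univ.map ιl ∪ Finset.univ.map ιr := by
    ext x
    simp only [Finset.mem_univ, Finset.mem_union, Finset.mem_map, true_and, true_iff]
    by_cases hx : (x : ℕ) ≤ H.last
    · exact Or.inl ⟨⟨x, by omega⟩, Fin.ext (hl _)⟩
    · have := x.2
      exact Or.inr ⟨⟨x - H.last, by omega⟩, Fin.ext (by rw [hr]; simp; omega)⟩
  have hinter : ∀ x ∈ Finset.univ.map ιl, x ∈ Finset.univ.map ιr → x = c := by
    intro x hx hx'
    obtain ⟨a, _, rfl⟩ := Finset.mem_map.1 hx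
    obtain ⟨b, _, hb⟩ := Finset.mem_map.1 hx'
    have := congrArg Fin.val hb
    rw [hl, hr] at this
    have ha := a.2
    exact Fin.ext (by rw [hc, hl, hl, Fin.val_last]; omega)
  have hin : ∀ {n : ℕ} (ι : Fin n ↪ Fin (H.last + G.last + 1)) (l : List (Sym2 (Fin n))),
      EdgesIn (Finset.univ.map ι) (l.map (Sym2.map ι)) := by
    intro n ι l e he v hv
    obtain ⟨e', _, rfl⟩ := List.mem_map.1 he
    obtain ⟨a, _, rfl⟩ := Sym2.mem_map.1 hv
    exact Finset.mem_map_of_mem _ (Finset.mem_univ a)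
  change forestSum (Finset.univ : Finset (Fin (H.last + G.last + 1)))
    (H.edges.map (Sym2.map ιl) ++ G.edges.map (Sym2.map ιr)) (rootWeight 0 g w) = _
  rw [huniv, forestSum_union (hin ιl _) (hin ιr _) hinter (Finset.mem_map_of_mem _ (Finset.mem_univ _))
    (hc' ▸ Finset.mem_map_of_mem _ (Finset.mem_univ _)), forestSum_map, pairSum]
  refine forestSum_congr _ fun C _ _ => ?_
  have hcC : c ∈ C.map ιl ↔ Fin.last H.last ∈ C := Finset.mem_map' ιl
  have h0C : (0 : Fin (H.last + G.last + 1)) ∈ C.map ιl ↔ 0 ∈ C := by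
    rw [h0]; exact Finset.mem_map' ιl
  -- The root can lie on the side of `G` only if `H` is a single vertex; this degenerate case needs
  -- no separate treatment here.
  have h0D : ∀ D : Finset (Fin (G.last + 1)), (0 : Fin (H.last + G.last + 1)) ∈ D.map ιr →
      0 ∈ D ∧ Fin.last H.last = 0 := by
    intro D hD
    obtain ⟨b, hb, hb'⟩ := Finset.mem_map.1 hD
    have := congrArg Fin.val hb'
    rw [hr, Fin.val_zero] at this
    have hb0 : b = 0 := Fin.ext (show (b : ℕ) = 0 by omega)
    exact ⟨hb0 ▸ hb, Fin.ext (show H.last = 0 by omega)⟩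
  simp only [hcC]
  by_cases hlast : Fin.last H.last ∈ C
  · rw [if_pos hlast, forestSum_map]
    have key : ∀ g' : ℕ → R, (∀ D : Finset (Fin (G.last + 1)), 0 ∈ D →
        rootWeight 0 g w (C.map ιl ∪ D.map ιr) = g' (C.card + D.card - 1)) →
        forestSum Finset.univ G.edges (fun D => if c ∈ D.map ιr then
          rootWeight 0 g w (C.map ιl ∪ D.map ιr) else rootWeight 0 g w (D.map ιr)) =
        G.rootSum w fun j => g' (C.card + j - 1) := by
      intro g' hg'
      refine forestSum_congr _ fun D _ _ => ?_
      have hcD : c ∈ D.map ιr ↔ 0 ∈ D := by rw [hc']; exact Finset.mem_map' ιr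
      simp only [hcD]
      conv_rhs => rw [rootWeight]
      split_ifs with h
      · exact hg' D h
      · rw [rootWeight, if_neg fun h' => h (h0D D h').1, Finset.card_map]
    have hcard : ∀ D : Finset (Fin (G.last + 1)), 0 ∈ D →
        (C.map ιl ∪ D.map ιr).card = C.card + D.card - 1 := by
      intro D hD
      have h : C.map ιl ∩ D.map ιr = {c} := by
        ext x
        rw [Finset.mem_inter, Finset.mem_singleton]
        constructor
        · exact fun h => hinter x (Finset.map_subset_map.2 (Finset.subset_univ _) h.1)
            (Finset.map_subset_map.2 (Finset.subset_univ _) h.2)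
        · rintro rfl
          exact ⟨hcC.2 hlast, hc' ▸ Finset.mem_map_of_mem _ hD⟩
      have := Finset.card_union_add_card_inter (C.map ιl) (D.map ιr)
      rw [h, Finset.card_singleton, Finset.card_map, Finset.card_map] at this
      omega
    by_cases h0' : (0 : Fin (H.last + 1)) ∈ C
    · rw [rootWeight₂, if_pos h0', if_pos hlast]
      refine key g fun D hD => ?_
      rw [rootWeight, if_pos (Finset.mem_union_left _ (h0C.2 h0')), hcard D hD]
    · rw [rootWeight₂, if_neg h0', if_pos hlast]
      refine key w fun D hD => ?_
      rw [rootWeight, if_neg, hcard D hD]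
      rw [Finset.mem_union, h0C]
      rintro (h | h)
      · exact h0' h
      · exact h0' ((h0D D h).2 ▸ hlast)
  · rw [if_neg hlast, rootWeight₂, if_neg hlast, if_neg hlast, rootWeight, Finset.card_map]
    simp only [h0C]

/-! ### Pair sums of cliques, single vertices and cycles -/

section Blocks

open PowerSeries

variable {w : ℕ → R} {Y : PowerSeries R}

theorem IsClique.isCompleteList {H : OrderedGraph} (hH : H.IsClique) :
    IsCompleteList Finset.univ H.edges := by
  refine ⟨H.nodup, fun e => ⟨fun he => ⟨H.loopless e he, by simp⟩, fun he => ?_⟩⟩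
  induction e with | _ u v
  have h : H.graph.Adj u v := by
    rw [show H.graph = ⊤ from hH, SimpleGraph.top_adj]
    simpa using he.1
  rw [graph, SimpleGraph.fromEdgeSet_adj] at h
  exact h.1

theorem IsClique.pairSum_eq {H : OrderedGraph} (hH : H.IsClique) (h0 : coeff 0 Y = 1)
    (hY : derivative R Y = shiftSeries w * Y) (hlast : H.last ≠ 0) (g g₁ g₂ : ℕ → R) :
    H.pairSum w g g₁ g₂ =
      (H.last - 1).factorial * coeff H.last (X * pairSeries g g₁ g₂ * Y) := by
  obtain ⟨m, hm⟩ := Nat.exists_eq_succ_of_ne_zero hlast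
  rw [pairSum, forestSum_complete_rootWeight₂ h0 hY (m := m) (by simp [hm]) (Finset.mem_univ _)
    (Finset.mem_univ _) _ hH.isCompleteList, hm, mul_assoc X, coeff_succ_X_mul]
  · rfl
  · intro h
    have := congrArg Fin.val h
    simp at this
    omega

/-- In `K_1` the two marked vertices coincide, so the formula for cliques does not cover it. -/
theorem pairSum_of_last_eq_zero {H : OrderedGraph} (hlast : H.last = 0) (g g₁ g₂ : ℕ → R) :
    H.pairSum w g g₁ g₂ = g 1 := by
  obtain ⟨last, edges, nodup, loopless⟩ := H
  obtain rfl : last = 0 := hlast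
  have : edges = [] := by
    refine List.eq_nil_iff_forall_not_mem.2 fun e he => loopless e he ?_
    induction e with | _ u v
    exact Fin.ext (by omega)
  subst this
  have hu : (Finset.univ : Finset (Fin (0 + 1))) = {0} := rfl
  rw [pairSum]
  change forestSum (Finset.univ : Finset (Fin (0 + 1))) [] _ = _
  rw [hu, forestSum_nil_singleton, rootWeight₂]
  simp

theorem pairSum_cycle (hY : Y = 1 + X * shiftSeries w * Y) (k : ℕ) (hk : 1 ≤ k) (g g₁ g₂ : ℕ → R) :
    (cycle k hk).pairSum w g g₁ g₂ = coeff k (X * pairSeries g g₁ g₂ * Y) := by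
  have hmap : (List.ofFn fun i : Fin k => s(i.castSucc, i.succ)).map (Sym2.map Fin.valEmbedding) =
      pathList k := by
    refine List.ext_getElem (by simp [pathList]) fun i h₁ h₂ => ?_
    simp [pathList]
  rw [← forestSum_cycle_rootWeight₂ hY, ← hmap, pairSum]
  have huniv : Finset.range (k + 1) = (Finset.univ : Finset (Fin (k + 1))).map Fin.valEmbedding := by
    ext x
    simp only [Finset.mem_range, Finset.mem_map, Finset.mem_univ, true_and]
    exact ⟨fun h => ⟨⟨x, h⟩, rfl⟩, by rintro ⟨y, rfl⟩; exact y.2⟩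
  have hlist : (List.ofFn fun i : Fin k => s(i.castSucc, i.succ)).map (Sym2.map Fin.valEmbedding) ++
      [s(k, 0)] = ((List.ofFn fun i : Fin k => s(i.castSucc, i.succ)) ++
        [s(Fin.last k, 0)]).map (Sym2.map Fin.valEmbedding) := by
    simp
  rw [huniv, hlist, forestSum_map]
  have hf : ∀ B : Finset (Fin (k + 1)),
      rootWeight₂ (0 : Fin (k + 1)) (Fin.last k) g g₁ g₂ w B =
        rootWeight₂ 0 k g g₁ g₂ w (B.map Fin.valEmbedding) := by
    intro B
    have h1 : 0 ∈ B.map Fin.valEmbedding ↔ (0 : Fin (k + 1)) ∈ B :=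
      Finset.mem_map' (a := (0 : Fin (k + 1))) Fin.valEmbedding
    have h2 : k ∈ B.map Fin.valEmbedding ↔ Fin.last k ∈ B :=
      Finset.mem_map' (a := Fin.last k) Fin.valEmbedding
    simp only [rootWeight₂, h1, h2, Finset.card_map]
  rw [← forestSum_congr _ fun B _ _ => hf B]
  change forestSum (Finset.univ : Finset (Fin (k + 1))) (List.dedup _) _ = _
  exact forestSum_dedup _ _ _

end Blocks

end OrderedGraph

/-! ### Positivity -/

namespace PowerSeries

variable {R : Type*} [CommRing R] [PartialOrder R] [IsOrderedRing R]

/-- All coefficients are non-negative. -/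
def CoeffNonneg (p : PowerSeries R) : Prop := ∀ n, 0 ≤ coeff n p

theorem CoeffNonneg.add {p q : PowerSeries R} (hp : CoeffNonneg p) (hq : CoeffNonneg q) :
    CoeffNonneg (p + q) := fun n => by
  rw [map_add]; exact add_nonneg (hp n) (hq n)

theorem CoeffNonneg.mul {p q : PowerSeries R} (hp : CoeffNonneg p) (hq : CoeffNonneg q) :
    CoeffNonneg (p * q) := fun n => by
  rw [coeff_mul]; exact Finset.sum_nonneg fun x _ => mul_nonneg (hp _) (hq _)

theorem coeffNonneg_one : CoeffNonneg (1 : PowerSeries R) := fun n => by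
  rw [coeff_one]; split_ifs <;> simp

theorem coeffNonneg_X_pow (k : ℕ) : CoeffNonneg (X ^ k : PowerSeries R) := fun n => by
  rw [coeff_X_pow]; split_ifs <;> simp

theorem coeffNonneg_of_eq_add_mul {b S U : PowerSeries R} (hb : CoeffNonneg b)
    (hS : CoeffNonneg S) (hS0 : coeff 0 S = 0) (hU : U = b + S * U) : CoeffNonneg U := by
  intro n
  induction n using Nat.strong_induction_on with
  | _ n ih =>
    rw [hU, map_add, coeff_mul]
    refine add_nonneg (hb n) (Finset.sum_nonneg fun x hx => ?_)
    rw [Finset.HasAntidiagonal.mem_antidiagonal] at hx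
    rcases Nat.eq_zero_or_pos x.1 with h | h
    · rw [h, hS0, zero_mul]
    · exact mul_nonneg (hS _) (ih _ (by omega))

theorem exists_eq_one_add_mul {R : Type*} [CommRing R] {S : PowerSeries R} (hS : coeff 0 S = 0) :
    ∃ U : PowerSeries R, U = 1 + S * U := by
  refine ⟨invOfUnit (1 - S) 1, ?_⟩
  have h : (1 - S) * invOfUnit (1 - S) 1 = 1 := mul_invOfUnit _ _ (by
    rw [map_sub, ← coeff_zero_eq_constantCoeff_apply S, hS]
    simp)
  linear_combination h

end PowerSeries

/-! ### Generating functions of the signed and unit weights -/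

section ElementarySequence

open PowerSeries

variable {R : Type*} [CommRing R] (e : ℕ → R)

/-- The weights `n e_n` of the unit forest triples. -/
def unitWeight (n : ℕ) : R := n * e n

/-- The weights `∑_α (-1)^{ℓ(α)} e_α`, over the compositions `α` of `n - c`. -/
def shiftedComplete (c : ℤ) (j : ℕ) : R :=
  if c ≤ j then signedComplete e (j - c).toNat else 0

theorem mk_mul_mk_signedComplete (he : e 0 = 1) :
    PowerSeries.mk e * PowerSeries.mk (signedComplete e) = 1 := by
  ext n
  rw [coeff_mul, Finset.Nat.sum_antidiagonal_eq_sum_range_succ_mk]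
  simp only [coeff_mk]
  cases n with
  | zero => simp [he, signedComplete_zero]
  | succ n =>
    rw [Finset.sum_range_succ', he, one_mul, Nat.sub_zero, signedComplete_succ, coeff_one,
      if_neg (by omega), add_neg_eq_zero]
    exact Finset.sum_congr rfl fun i _ => by rw [Nat.add_sub_add_right]

theorem shiftSeries_unitWeight : shiftSeries (unitWeight e) = derivative R (PowerSeries.mk e) := by
  ext n
  rw [coeff_shiftSeries, coeff_derivative, coeff_mk, unitWeight]
  push_cast
  ring

/-- The logarithmic derivative `E'/E`: the first part together with `r` gives `E'`, and the
remaining signed composition gives `1/E`. -/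
theorem shiftSeries_signedPower : shiftSeries (signedPower e) =
    derivative R (PowerSeries.mk e) * PowerSeries.mk (signedComplete e) := by
  ext n
  rw [coeff_shiftSeries, signedPower_succ, coeff_mul,
    Finset.Nat.sum_antidiagonal_eq_sum_range_succ_mk]
  refine Finset.sum_congr rfl fun i _ => ?_
  rw [coeff_derivative, coeff_mk, coeff_mk]
  push_cast
  ring

theorem X_mul_shiftSeries_unitWeight :
    (X * shiftSeries (unitWeight e) : PowerSeries R) = PowerSeries.mk (unitWeight e) := by
  ext n
  cases n with
  | zero => simp [unitWeight]
  | succ n => rw [coeff_succ_X_mul, coeff_shiftSeries, coeff_mk]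

/-- The coefficients of the solution of `y' = (∑ e_n X ^ n)' y`, where `ρ n` is an inverse of `n`. -/
def expCoeff (ρ : ℕ → R) : ℕ → R
  | 0 => 1
  | n + 1 => ρ (n + 1) * ∑ i : Fin (n + 1), unitWeight e (i + 1) * expCoeff ρ (n - i)

section Ordered

variable [PartialOrder R] [IsOrderedRing R]

/-- The series is `y = exp(E - 1)`, built by solving `y' = E'y` coefficient by coefficient because
only inverses of positive integers are available. It is compared with `E`, the solution for the
signed weights. -/
theorem exists_series_clique (he : e 0 = 1) (he' : ∀ n, 0 ≤ e n)
    (hinv : ∀ n : ℕ, 0 < n → ∃ ρ : R, 0 ≤ ρ ∧ n * ρ = 1) :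
    ∃ y : PowerSeries R, coeff 0 y = 1 ∧ derivative R y = shiftSeries (unitWeight e) * y ∧
      CoeffNonneg (y - PowerSeries.mk e) := by
  choose! ρ hρ hρ' using hinv
  let S : ℕ → (ℕ → R) → R := fun n f => ∑ i ∈ Finset.range (n + 1), unitWeight e (i + 1) * f (n - i)
  let z : ℕ → R := expCoeff e ρ
  have hz0 : z 0 = 1 := by simp only [z, expCoeff]
  have hz : ∀ n, z (n + 1) = ρ (n + 1) * S n z := by
    intro n
    simp only [z, expCoeff, S]
    rw [Fin.sum_univ_eq_sum_range (fun i => unitWeight e (i + 1) * expCoeff e ρ (n - i)) (n + 1)]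
  have hw : ∀ n, 0 ≤ unitWeight e n := fun n => mul_nonneg (Nat.cast_nonneg n) (he' n)
  have hpos : ∀ n, 0 ≤ z n := by
    intro n
    induction n using Nat.strong_induction_on with
    | _ n ih =>
      cases n with
      | zero => rw [hz0]; exact zero_le_one
      | succ n =>
        rw [hz]
        exact mul_nonneg (hρ _ (by omega)) (Finset.sum_nonneg fun i _ =>
          mul_nonneg (hw _) (ih _ (by omega)))
  refine ⟨PowerSeries.mk z, by rw [coeff_mk, hz0], ?_, ?_⟩
  · ext n
    rw [coeff_derivative, coeff_mk, hz, coeff_mul,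
      Finset.Nat.sum_antidiagonal_eq_sum_range_succ_mk]
    have h1 : S n z = ∑ i ∈ Finset.range n.succ,
        coeff i (shiftSeries (unitWeight e)) * coeff (n - i) (PowerSeries.mk z) :=
      Finset.sum_congr rfl fun i _ => by rw [coeff_shiftSeries, coeff_mk]
    rw [← h1]
    have := hρ' (n + 1) (by omega)
    push_cast at this
    linear_combination S n z * this
  · intro n
    rw [map_sub, coeff_mk, coeff_mk, sub_nonneg]
    cases n with
    | zero => rw [hz0, he]
    | succ n =>
      -- Only the summand `i = n`, where `z 0 = 1`, is kept.
      have h1 : unitWeight e (n + 1) ≤ S n z := by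
        have h2 := Finset.single_le_sum (f := fun i => unitWeight e (i + 1) * z (n - i))
          (fun i _ => mul_nonneg (hw _) (hpos _)) (Finset.self_mem_range_succ n)
        simpa [hz0] using h2
      have h3 := mul_le_mul_of_nonneg_left h1 (hρ (n + 1) (by omega))
      rw [hz]
      refine le_trans (le_of_eq ?_) h3
      rw [unitWeight]
      linear_combination (-e (n + 1)) * hρ' (n + 1) (by omega)

/-- With `T = xE'`, take `D = 1/(E - T)` and `y = 1/(1 - T)`. The series `T - (E - 1)` has
coefficients `(n - 1) e_n` for `n ≥ 1`, so `D` is non-negative. The comparison follows from `y - D =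
(E - 1)D + T(y - D)` and `y - DE = T(y - D)`. -/
theorem exists_series_cycle (he : e 0 = 1) (he' : ∀ n, 0 ≤ e n) :
    ∃ D y : PowerSeries R, CoeffNonneg D ∧
      D * PowerSeries.mk e = 1 + X * shiftSeries (signedPower e) * (D * PowerSeries.mk e) ∧
      y = 1 + X * shiftSeries (unitWeight e) * y ∧ CoeffNonneg (y - D * PowerSeries.mk e) := by
  set E := PowerSeries.mk e
  set T := X * shiftSeries (unitWeight e) with hT
  have hT' : T = PowerSeries.mk (unitWeight e) := X_mul_shiftSeries_unitWeight e
  have hT0 : coeff 0 T = 0 := by rw [hT', coeff_mk, unitWeight]; simp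
  have hTpos : CoeffNonneg T := fun n => by
    rw [hT', coeff_mk]; exact mul_nonneg (Nat.cast_nonneg n) (he' n)
  have hE : CoeffNonneg (E - 1) := by
    intro n
    rw [map_sub, coeff_one, coeff_mk]
    split_ifs with h
    · rw [h, he, sub_self]
    · rw [sub_zero]; exact he' n
  have hS : CoeffNonneg (T - (E - 1)) := by
    intro n
    rw [map_sub, map_sub, hT', coeff_mk, coeff_mk, coeff_one, unitWeight]
    cases n with
    | zero => simp [he]
    | succ n =>
      rw [if_neg (by omega), sub_zero]
      have : ((n + 1 : ℕ) : R) * e (n + 1) - e (n + 1) = n * e (n + 1) := by push_cast; ring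
      rw [this]
      exact mul_nonneg (Nat.cast_nonneg n) (he' _)
  have hS0 : coeff 0 (T - (E - 1)) = 0 := by
    rw [map_sub, map_sub, hT0, coeff_mk, he, coeff_one, if_pos rfl, sub_self, sub_self]
  obtain ⟨D, hD⟩ := exists_eq_one_add_mul hS0
  obtain ⟨y, hy⟩ := exists_eq_one_add_mul hT0
  have hDpos : CoeffNonneg D := coeffNonneg_of_eq_add_mul coeffNonneg_one hS hS0 hD
  have hyD : CoeffNonneg (y - D) :=
    coeffNonneg_of_eq_add_mul (b := (E - 1) * D) (S := T) (hE.mul hDpos) hTpos hT0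
      (by linear_combination hy - hD)
  refine ⟨D, y, hDpos, ?_, hy, ?_⟩
  · have h1 := mk_mul_mk_signedComplete e he
    rw [shiftSeries_signedPower, ← shiftSeries_unitWeight]
    linear_combination hD - T * D * h1
  · have : y - D * E = T * (y - D) := by linear_combination hy - hD
    rw [this]
    exact hTpos.mul hyD

end Ordered

end ElementarySequence

namespace OrderedGraph

open PowerSeries

/-! ### Functionals on weight sequences and the cancellation identity -/

section Functionals

variable {R : Type*} [CommRing R]

theorem IsFiniteFunctional.exists_eq_sum {L : (ℕ → R) → R} (hL : IsFiniteFunctional L) :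
    L (fun j => if j = 0 then 1 else 0) = 0 ∧ ∃ N, ∀ K, N < K → ∀ g,
      L g = ∑ t ∈ Finset.range K, L (fun j => if j = t then 1 else 0) * g t := by
  obtain ⟨W, N, hW0, hW⟩ := hL
  have h : ∀ K, N < K → ∀ t < K, L (fun j => if j = t then 1 else 0) = W t := by
    intro K hK t ht
    rw [hW K hK]
    simp [ht]
  refine ⟨by rw [h (N + 1) (by omega) 0 (by omega), hW0], N, fun K hK g => ?_⟩
  rw [hW K hK]
  exact Finset.sum_congr rfl fun t ht => by rw [h K hK t (Finset.mem_range.1 ht)]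

/-- The functional of a graph glued to a clique or a cycle with `m + 1` vertices. -/
noncomputable def pairFunctional (κ m : ℕ) (w : ℕ → R) (Y : PowerSeries R) (L : (ℕ → R) → R)
    (g : ℕ → R) : R :=
  κ * coeff m (X * pairSeries (fun k => L fun j => g (k + j - 1)) g
    (fun l => L fun j => w (l + j - 1)) * Y)

/-- The contribution of the trees that contain both marked vertices. -/
noncomputable def joinedSeries (L : (ℕ → R) → R) (g : ℕ → R) : PowerSeries R :=
  PowerSeries.mk fun k => k * L fun j => g (k + j)

/-- The contribution of the tree of the second marked vertex. -/
noncomputable def separatedSeries (L : (ℕ → R) → R) (w : ℕ → R) : PowerSeries R :=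
  PowerSeries.mk fun l => L fun j => w (l + j)

theorem X_mul_pairSeries (L : (ℕ → R) → R) (g w : ℕ → R) :
    X * pairSeries (fun k => L fun j => g (k + j - 1)) g (fun l => L fun j => w (l + j - 1)) =
      X * shiftSeries g * separatedSeries L w + joinedSeries L g := by
  have h1 : shiftSeries (fun l => L fun j => w (l + j - 1)) = separatedSeries L w := by
    ext l
    rw [coeff_shiftSeries, separatedSeries, coeff_mk]
    congr 1
    funext j
    congr 1
    omega
  have h2 : X * derivative R (shiftSeries fun k => L fun j => g (k + j - 1)) =
      joinedSeries L g := by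
    ext k
    rw [joinedSeries, coeff_mk]
    cases k with
    | zero => simp
    | succ k =>
      rw [coeff_succ_X_mul, coeff_derivative, coeff_shiftSeries, mul_comm]
      push_cast
      congr 2
      funext j
      congr 1
      omega
  rw [pairSeries, h1, mul_add, h2, mul_assoc]

theorem X_mul_shiftSeries_single {c : ℕ} (hc : 1 ≤ c) :
    (X * shiftSeries (fun j => if j = c then (1 : R) else 0)) = X ^ c := by
  ext k
  cases k with
  | zero => rw [coeff_X_pow, if_neg (by omega)]; simp
  | succ k => rw [coeff_succ_X_mul, coeff_shiftSeries, coeff_X_pow]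

variable (e : ℕ → R)

/-- The generating function of `h_c` is `x^c/E`; the factor `E` supplied by the clique and cycle
series removes the denominator. -/
theorem X_mul_shiftSeries_shiftedComplete (he : e 0 = 1) {c : ℕ} (hc : 1 ≤ c) :
    X * shiftSeries (shiftedComplete e c) * PowerSeries.mk e = X ^ c := by
  have h : X * shiftSeries (shiftedComplete e c) =
      X ^ c * PowerSeries.mk (signedComplete e) := by
    ext k
    rw [coeff_X_pow_mul']
    cases k with
    | zero => rw [if_neg (by omega)]; simp
    | succ k =>
      rw [coeff_succ_X_mul, coeff_shiftSeries, shiftedComplete, coeff_mk]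
      refine if_congr (by omega) ?_ rfl
      congr 1
      omega
  rw [h, mul_assoc, mul_comm (PowerSeries.mk _), mk_mul_mk_signedComplete e he, mul_one]

/-- A convolution with `1/E`. The index `a - l` may be negative, which is why `shiftedComplete`
takes an integer. -/
theorem sum_mul_shiftedComplete (b : ℕ → R) (l j : ℕ) {M : ℕ} (hM : l + j < M) :
    ∑ a ∈ Finset.range M, b a * shiftedComplete e ((a : ℤ) - l) j =
      coeff (l + j) (PowerSeries.mk b * PowerSeries.mk (signedComplete e)) := by
  rw [coeff_mul, Finset.Nat.sum_antidiagonal_eq_sum_range_succ_mk]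
  symm
  refine Finset.sum_subset_zero_on_sdiff (Finset.range_mono hM) ?_ ?_
  · intro a ha
    rw [Finset.mem_sdiff, Finset.mem_range, Finset.mem_range] at ha
    rw [shiftedComplete, if_neg (by omega), mul_zero]
  · intro a ha
    rw [Finset.mem_range] at ha
    rw [shiftedComplete, if_pos (by omega), coeff_mk, coeff_mk]
    congr 2
    omega

/-- Apply `L` to the shifted identities `E · (1/E) = 1` and `xE' · (1/E) = xE'/E`. The constant term
of the first is invisible because `L` ignores index `0`. Finiteness of `L` makes all long enough
truncations equal. -/
theorem IsFiniteFunctional.sum_shiftedComplete (he : e 0 = 1) {L : (ℕ → R) → R}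
    (hL : IsFiniteFunctional L) (l : ℕ) : ∃ M₀, ∀ M, M₀ ≤ M →
      (∑ a ∈ Finset.range M, e a * L (shiftedComplete e ((a : ℤ) - l)) = 0) ∧
      (∑ a ∈ Finset.range M, a * e a * L (shiftedComplete e ((a : ℤ) - l)) =
        L fun j => signedPower e (l + j)) := by
  obtain ⟨W, N, hW0, hW⟩ := hL
  refine ⟨l + N + 1, fun M hM => ?_⟩
  have key : ∀ b : ℕ → R, ∑ a ∈ Finset.range M, b a * L (shiftedComplete e ((a : ℤ) - l)) =
      ∑ j ∈ Finset.range (N + 1), W j *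
        coeff (l + j) (PowerSeries.mk b * PowerSeries.mk (signedComplete e)) := by
    intro b
    simp only [hW (N + 1) (Nat.lt_succ_self N), Finset.mul_sum]
    rw [Finset.sum_comm]
    refine Finset.sum_congr rfl fun j hj => ?_
    rw [Finset.mem_range] at hj
    rw [← sum_mul_shiftedComplete e b l j (by omega : l + j < M), Finset.mul_sum]
    exact Finset.sum_congr rfl fun a _ => by ring
  refine ⟨?_, ?_⟩
  · rw [key, mk_mul_mk_signedComplete e he]
    refine Finset.sum_eq_zero fun j _ => ?_
    rcases Nat.eq_zero_or_pos j with rfl | hj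
    · rw [hW0, zero_mul]
    · rw [coeff_one, if_neg (by omega), mul_zero]
  · rw [key, hW (N + 1) (Nat.lt_succ_self N)]
    refine Finset.sum_congr rfl fun j _ => ?_
    congr 1
    have h1 : (PowerSeries.mk fun a => (a : R) * e a) = X * derivative R (PowerSeries.mk e) := by
      rw [← shiftSeries_unitWeight, X_mul_shiftSeries_unitWeight]
      rfl
    rw [h1, mul_assoc, ← shiftSeries_signedPower]
    cases l + j with
    | zero => rw [signedPower_zero]; simp
    | succ n => rw [coeff_succ_X_mul, coeff_shiftSeries]

theorem joinedSeries_shiftedComplete (L : (ℕ → R) → R) (c : ℕ) :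
    joinedSeries L (shiftedComplete e c) =
      PowerSeries.mk fun k => k * L (shiftedComplete e ((c : ℤ) - k)) := by
  rw [joinedSeries]
  congr 1
  funext k
  congr 2
  funext j
  rw [shiftedComplete, shiftedComplete]
  refine if_congr (by omega) ?_ rfl
  congr 1
  omega

/-- The individual terms have no evident sign. With `A_a = L(h_{a - (j - c)})`, the separated part
is `∑_a a e_a A_a` and the joined part is `∑_{a ≤ j} (j - a) e_a A_a`. Subtracting `j ∑_a e_a A_a =
0` leaves `∑_{a > j} (a - j) e_a A_a`, which involves `L(h_t)` only for `t > c`. -/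
theorem coeff_separatedSeries_add_joinedSeries (he : e 0 = 1) {L : (ℕ → R) → R}
    (hL : IsFiniteFunctional L) {c j : ℕ} (hcj : c ≤ j) : ∃ M₀, ∀ M, M₀ ≤ M →
      coeff j (X ^ c * separatedSeries L (signedPower e) +
        joinedSeries L (shiftedComplete e c) * PowerSeries.mk e) =
      ∑ i ∈ Finset.range M, (i + 1 : ℕ) * e (j + 1 + i) *
        L (shiftedComplete e ((c + 1 + i : ℕ) : ℤ)) := by
  obtain ⟨M₀, hM₀⟩ := hL.sum_shiftedComplete e he (j - c)
  refine ⟨M₀, fun M hM => ?_⟩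
  obtain ⟨h1, h2⟩ := hM₀ (j + 1 + M) (by omega)
  rw [map_add, coeff_X_pow_mul', if_pos hcj, separatedSeries, coeff_mk, ← h2,
    joinedSeries_shiftedComplete, mul_comm (PowerSeries.mk _), coeff_mul,
    Finset.Nat.sum_antidiagonal_eq_sum_range_succ_mk]
  rw [Finset.sum_range_add] at h1 h2 ⊢
  set A : ℕ → R := fun a => L (shiftedComplete e ((a : ℤ) - (j - c : ℕ))) with hA
  have h3 : ∀ i, L (shiftedComplete e ((c + 1 + i : ℕ) : ℤ)) = A (j + 1 + i) := by
    intro i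
    rw [hA]
    congr 2
    omega
  have h4 : ∀ a ∈ Finset.range j.succ,
      coeff a (PowerSeries.mk e) * coeff (j - a) (PowerSeries.mk fun k : ℕ =>
        (k : R) * L (shiftedComplete e ((c : ℤ) - k))) = (j - a) * e a * A a := by
    intro a ha
    rw [Finset.mem_range] at ha
    rw [coeff_mk, coeff_mk, Nat.cast_sub (by omega), hA,
      show (c : ℤ) - ((j - a : ℕ) : ℤ) = (a : ℤ) - (j - c : ℕ) by omega]
    ring
  rw [Finset.sum_congr rfl h4]
  simp only [h3]
  -- Up to `j` the factors `a` and `j - a` add up to `j`; beyond `j` the factor `a` is split as `(a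
  -- - j) + j`. The parts with factor `j` vanish by `h1`.
  have h5 : ∑ a ∈ Finset.range (j + 1), (a : R) * e a * A a +
      ∑ a ∈ Finset.range j.succ, ((j : R) - a) * e a * A a =
      j * ∑ a ∈ Finset.range (j + 1), e a * A a := by
    rw [← Finset.sum_add_distrib, Finset.mul_sum]
    exact Finset.sum_congr rfl fun a _ => by ring
  have h6 : ∑ i ∈ Finset.range M, ((j + 1 + i : ℕ) : R) * e (j + 1 + i) * A (j + 1 + i) =
      (∑ i ∈ Finset.range M, ((i + 1 : ℕ) : R) * e (j + 1 + i) * A (j + 1 + i)) +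
      j * ∑ i ∈ Finset.range M, e (j + 1 + i) * A (j + 1 + i) := by
    rw [Finset.mul_sum, ← Finset.sum_add_distrib]
    exact Finset.sum_congr rfl fun a _ => by push_cast; ring
  change ∑ a ∈ Finset.range (j + 1), (a : R) * e a * A a +
    ∑ i ∈ Finset.range M, ((j + 1 + i : ℕ) : R) * e (j + 1 + i) * A (j + 1 + i) + _ = _
  change ∑ a ∈ Finset.range (j + 1), e a * A a +
    ∑ i ∈ Finset.range M, e (j + 1 + i) * A (j + 1 + i) = 0 at h1
  linear_combination h5 + h6 + j * h1

end Functionals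

/-! ### The inductive inequalities -/

section Bounds

variable {R : Type*} [CommRing R] [PartialOrder R] [IsOrderedRing R] (e : ℕ → R)

/-- The functional `L` of the signed sums and the functional `L'` of the unit sums satisfy the
inequalities that are needed for a first-preserving involution. -/
structure IsBounded (L L' : (ℕ → R) → R) : Prop where
  finite_left : IsFiniteFunctional L
  finite_right : IsFiniteFunctional L'
  nonneg : ∀ c : ℕ, 1 ≤ c → 0 ≤ L (shiftedComplete e c)
  le : ∀ c : ℕ, 1 ≤ c → L (shiftedComplete e c) ≤ L' fun j => if j = c then 1 else 0

variable {e}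

theorem IsBounded.single_nonneg {L L' : (ℕ → R) → R} (h : IsBounded e L L') (c : ℕ) :
    0 ≤ L' fun j => if j = c then 1 else 0 := by
  rcases Nat.eq_zero_or_pos c with rfl | hc
  · exact h.finite_right.exists_eq_sum.1.ge
  · exact (h.nonneg c hc).trans (h.le c hc)

theorem IsBounded.nonneg_right {L L' : (ℕ → R) → R} (h : IsBounded e L L') {g : ℕ → R}
    (hg : ∀ j, 0 ≤ g j) : 0 ≤ L' g := by
  obtain ⟨N, hN⟩ := h.finite_right.exists_eq_sum.2
  rw [hN (N + 1) (Nat.lt_succ_self N)]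
  exact Finset.sum_nonneg fun t _ => mul_nonneg (h.single_nonneg t) (hg t)

/-- In degrees `j ≥ c` the signed side is the positive expression of the cancellation identity,
bounded by the terms `t > c` of the separated unit series since `i + 1 ≤ j + 1 + i`. In degrees `j <
c` only the joined parts occur, with indices `c - k ≥ 1`, and are compared term by term. -/
theorem IsBounded.coeff_bounds (he : e 0 = 1) (he' : ∀ n, 0 ≤ e n) {L L' : (ℕ → R) → R}
    (h : IsBounded e L L') {c : ℕ} (j : ℕ) :
    0 ≤ coeff j (X ^ c * separatedSeries L (signedPower e) +
        joinedSeries L (shiftedComplete e c) * PowerSeries.mk e) ∧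
    coeff j (X ^ c * separatedSeries L (signedPower e) +
        joinedSeries L (shiftedComplete e c) * PowerSeries.mk e) ≤
      coeff j (X ^ c * separatedSeries L' (unitWeight e) +
        joinedSeries L' (fun t => if t = c then 1 else 0) * PowerSeries.mk e) := by
  have hJ : CoeffNonneg (joinedSeries L' (fun t => if t = c then 1 else 0)) := fun k => by
    rw [joinedSeries, coeff_mk]
    exact mul_nonneg (Nat.cast_nonneg k) (h.nonneg_right fun t => by split_ifs <;> simp)
  have hE : CoeffNonneg (PowerSeries.mk e) := fun k => by rw [coeff_mk]; exact he' k
  rcases le_or_gt c j with hcj | hcj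
  · obtain ⟨M₀, hM₀⟩ := coeff_separatedSeries_add_joinedSeries e he h.finite_left hcj
    obtain ⟨N, hN⟩ := h.finite_right.exists_eq_sum.2
    -- The cutoff serves both functionals: it exceeds the bound for `L`, and `c + 1 + (M₀ + N) > N`
    -- makes the expansion of `L'` complete.
    rw [hM₀ (M₀ + N) (by omega)]
    refine ⟨Finset.sum_nonneg fun i _ => mul_nonneg (mul_nonneg (Nat.cast_nonneg _) (he' _))
      (h.nonneg _ (by omega)), ?_⟩
    rw [map_add, coeff_X_pow_mul', if_pos hcj]
    refine le_trans ?_ (le_add_of_nonneg_right (hJ.mul hE j))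
    rw [separatedSeries, coeff_mk, hN (c + 1 + (M₀ + N)) (by omega),
      Finset.sum_range_add _ (c + 1) (M₀ + N)]
    refine le_trans ?_ (le_add_of_nonneg_left (Finset.sum_nonneg fun t _ =>
      mul_nonneg (h.single_nonneg t) (mul_nonneg (Nat.cast_nonneg _) (he' _))))
    refine Finset.sum_le_sum fun i _ => ?_
    rw [mul_comm, unitWeight, show j - c + (c + 1 + i) = j + 1 + i by omega]
    refine mul_le_mul (h.le _ (by omega)) ?_ (mul_nonneg (Nat.cast_nonneg _) (he' _))
      (h.single_nonneg _)
    exact mul_le_mul_of_nonneg_right (Nat.mono_cast (by omega)) (he' _)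
  · rw [map_add, map_add, coeff_X_pow_mul', if_neg (by omega), coeff_X_pow_mul',
      if_neg (by omega), zero_add, zero_add, joinedSeries_shiftedComplete, coeff_mul, coeff_mul]
    have hk : ∀ x ∈ Finset.HasAntidiagonal.antidiagonal j, 1 ≤ c - x.1 ∧
        ((c : ℤ) - x.1 : ℤ) = ((c - x.1 : ℕ) : ℤ) ∧
        (fun t => if x.1 + t = c then (1 : R) else 0) = fun t => if t = c - x.1 then 1 else 0 := by
      intro x hx
      rw [Finset.HasAntidiagonal.mem_antidiagonal] at hx
      refine ⟨by omega, by omega, funext fun t => if_congr (by omega) rfl rfl⟩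
    refine ⟨Finset.sum_nonneg fun x hx => ?_, Finset.sum_le_sum fun x hx => ?_⟩
    · obtain ⟨h1, h2, _⟩ := hk x hx
      rw [coeff_mk, coeff_mk, h2]
      exact mul_nonneg (mul_nonneg (Nat.cast_nonneg _) (h.nonneg _ h1)) (he' _)
    · obtain ⟨h1, h2, h3⟩ := hk x hx
      rw [coeff_mk, coeff_mk, h2, joinedSeries, coeff_mk, h3]
      exact mul_le_mul_of_nonneg_right
        (mul_le_mul_of_nonneg_left (h.le _ h1) (Nat.cast_nonneg _)) (he' _)

theorem IsBounded.pairFunctional (he : e 0 = 1) (he' : ∀ n, 0 ≤ e n) {L L' : (ℕ → R) → R}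
    (h : IsBounded e L L') {D y : PowerSeries R} (hD : CoeffNonneg D)
    (hy : CoeffNonneg (y - D * PowerSeries.mk e)) (κ m : ℕ) {c : ℕ} (hc : 1 ≤ c) :
    0 ≤ pairFunctional κ m (signedPower e) (D * PowerSeries.mk e) L (shiftedComplete e c) ∧
    pairFunctional κ m (signedPower e) (D * PowerSeries.mk e) L (shiftedComplete e c) ≤
      pairFunctional κ m (unitWeight e) y L' fun j => if j = c then 1 else 0 := by
  have hX := X_mul_pairSeries L' (fun j => if j = c then 1 else 0) (unitWeight e)
  beta_reduce at hX
  rw [OrderedGraph.pairFunctional, OrderedGraph.pairFunctional, X_mul_pairSeries, hX,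
    X_mul_shiftSeries_single hc]
  set E := PowerSeries.mk e with hE
  set J := joinedSeries L (shiftedComplete e c)
  set J' := joinedSeries L' (fun t => if t = c then 1 else 0) with hJ'_def
  set S := separatedSeries L (signedPower e)
  set S' := separatedSeries L' (unitWeight e) with hS'
  -- The factor `E` clears the denominator of `h_c`, leaving the non-negative `D` times the series
  -- of `coeff_bounds`.
  have h1 : (X * shiftSeries (shiftedComplete e c) * S + J) * (D * E) =
      D * (X ^ c * S + J * E) := by
    linear_combination S * D * X_mul_shiftSeries_shiftedComplete e he hc
  have hEpos : CoeffNonneg E := fun k => by rw [coeff_mk]; exact he' k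
  have hE1 : CoeffNonneg (E - 1) := by
    intro n
    rw [map_sub, coeff_one, coeff_mk]
    split_ifs with h
    · rw [h, he, sub_self]
    · rw [sub_zero]; exact he' n
  have hJ' : CoeffNonneg J' := fun k => by
    rw [hJ'_def, joinedSeries, coeff_mk]
    exact mul_nonneg (Nat.cast_nonneg k) (h.nonneg_right fun t => by split_ifs <;> simp)
  have hS'pos : CoeffNonneg S' := fun k => by
    rw [hS', separatedSeries, coeff_mk]
    exact h.nonneg_right fun t => mul_nonneg (Nat.cast_nonneg _) (he' _)
  have hT : CoeffNonneg (X ^ c * S + J * E) := fun j => (h.coeff_bounds he he' j).1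
  have hT' : CoeffNonneg (X ^ c * S' + J' * E - (X ^ c * S + J * E)) := fun j => by
    rw [map_sub]
    exact sub_nonneg.2 (h.coeff_bounds he he' j).2
  have hXS : CoeffNonneg (X ^ c * S') := (coeffNonneg_X_pow c).mul hS'pos
  have h2 : CoeffNonneg ((X ^ c * S' + J') * y - D * (X ^ c * S + J * E)) := by
    -- The slack comes from three sources: the inductive bound, the excess of `y` over `DE`, and the
    -- factor `E` that `X ^ c * S'` lacks in that bound.
    have : (X ^ c * S' + J') * y - D * (X ^ c * S + J * E) =
        D * (X ^ c * S' + J' * E - (X ^ c * S + J * E)) + (X ^ c * S' + J') * (y - D * E) +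
          X ^ c * S' * (D * (E - 1)) := by ring
    rw [this]
    exact ((hD.mul hT').add ((hXS.add hJ').mul hy)).add (hXS.mul (hD.mul hE1))
  rw [h1]
  refine ⟨mul_nonneg (Nat.cast_nonneg _) ((hD.mul hT) m), ?_⟩
  have h3 := h2 m
  rw [map_sub] at h3
  exact mul_le_mul_of_nonneg_left (sub_nonneg.1 h3) (Nat.cast_nonneg _)

/-- Evaluation at `1` is the functional of a one-vertex graph and starts the induction. -/
theorem isBounded_trivial : IsBounded e (fun g => g 1) fun g => g 1 := by
  have hf : IsFiniteFunctional (fun g : ℕ → R => g 1) := by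
    refine ⟨fun j => if j = 1 then 1 else 0, 1, by simp, fun K hK g => ?_⟩
    simp [hK]
  have key : ∀ c : ℕ, 1 ≤ c → shiftedComplete e c 1 = if 1 = c then 1 else 0 := by
    intro c hc
    rw [shiftedComplete]
    refine if_ctx_congr (by omega) (fun h => ?_) fun _ => rfl
    rw [← h]
    exact signedComplete_zero e
  exact ⟨hf, hf, fun c hc => by rw [key c hc]; split_ifs <;> simp, fun c hc => (key c hc).le⟩

/-- The sums over the forests of a chain satisfy the inequalities. -/
theorem IsCycleCliqueChain.isBounded (he : e 0 = 1) (he' : ∀ n, 0 ≤ e n)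
    (hinv : ∀ n : ℕ, 0 < n → ∃ ρ : R, 0 ≤ ρ ∧ n * ρ = 1) {G : OrderedGraph}
    (hG : G.IsCycleCliqueChain) :
    IsBounded e (G.rootSum (signedPower e)) (G.rootSum (unitWeight e)) := by
  have key : ∀ {H : OrderedGraph}, H.IsCycle ∨ H.IsClique → ∀ {L L' : (ℕ → R) → R},
      IsBounded e L L' → ∀ {c : ℕ}, 1 ≤ c →
      0 ≤ H.pairSum (signedPower e) (fun k => L fun j => shiftedComplete e c (k + j - 1))
        (shiftedComplete e c) (fun l => L fun j => signedPower e (l + j - 1)) ∧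
      H.pairSum (signedPower e) (fun k => L fun j => shiftedComplete e c (k + j - 1))
        (shiftedComplete e c) (fun l => L fun j => signedPower e (l + j - 1)) ≤
      H.pairSum (unitWeight e) (fun k => L' fun j => if k + j - 1 = c then 1 else 0)
        (fun j => if j = c then 1 else 0) (fun l => L' fun j => unitWeight e (l + j - 1)) := by
    rintro H (⟨k, hk, rfl⟩ | hH) L L' h c hc
    · obtain ⟨D, y, hD, hY, hy, hyD⟩ := exists_series_cycle e he he'
      rw [pairSum_cycle hY, pairSum_cycle hy]
      have := h.pairFunctional he he' hD hyD 1 k hc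
      rwa [OrderedGraph.pairFunctional, OrderedGraph.pairFunctional, Nat.cast_one, one_mul,
        one_mul] at this
    · by_cases hlast : H.last = 0
      · rw [pairSum_of_last_eq_zero hlast, pairSum_of_last_eq_zero hlast]
        simp only [Nat.add_sub_cancel_left]
        exact ⟨h.nonneg c hc, h.le c hc⟩
      · obtain ⟨y, hy0, hy, hyE⟩ := exists_series_clique e he he' hinv
        have hY : derivative R (PowerSeries.mk e) =
            shiftSeries (signedPower e) * PowerSeries.mk e := by
          rw [shiftSeries_signedPower, mul_assoc, mul_comm (PowerSeries.mk (signedComplete e)),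
            mk_mul_mk_signedComplete e he, mul_one]
        rw [hH.pairSum_eq (Y := PowerSeries.mk e) (by rw [coeff_mk, he]) hY hlast,
          hH.pairSum_eq hy0 hy hlast]
        -- For a clique the signed series is `E` itself, so `D = 1`.
        have := h.pairFunctional he he' (D := 1) (y := y) coeffNonneg_one (by rwa [one_mul])
          (H.last - 1).factorial H.last hc
        rwa [one_mul] at this
  induction hG with
  | single H hH =>
    refine ⟨H.isFiniteFunctional_rootSum _, H.isFiniteFunctional_rootSum _, fun c hc => ?_,
      fun c hc => ?_⟩
    -- Gluing a single vertex changes nothing: both marks of the last vertex then carry the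
    -- unshifted weights.
    · have := (key hH isBounded_trivial hc).1
      simpa only [Nat.add_sub_cancel, pairSum_self] using this
    · have := (key hH isBounded_trivial hc).2
      simpa only [Nat.add_sub_cancel, pairSum_self] using this
  | add H G hH _ ih =>
    refine ⟨(H + G).isFiniteFunctional_rootSum _, (H + G).isFiniteFunctional_rootSum _,
      fun c hc => ?_, fun c hc => ?_⟩
    · rw [rootSum_add]
      exact (key hH ih hc).1
    · rw [rootSum_add, rootSum_add]
      exact (key hH ih hc).2

end Bounds

end OrderedGraph

/-! ### Existence of sign-reversing involutions -/

section Involution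

variable {α κ : Type*} [Fintype α] [DecidableEq α] [DecidableEq κ]

theorem Finset.exists_involution_of_card_eq {A B : Finset α} (hAB : Disjoint A B)
    (h : A.card = B.card) : ∃ ψ : α → α, (∀ x, ψ (ψ x) = x) ∧ (∀ x ∈ A, ψ x ∈ B) ∧
      (∀ x ∈ B, ψ x ∈ A) ∧ ∀ x, x ∉ A → x ∉ B → ψ x = x := by
  let ε : A ≃ B := Finset.equivOfCardEq h
  have hBA : ∀ x ∈ B, x ∉ A := fun x hx hx' => Finset.disjoint_left.1 hAB hx' hx
  let ψ : α → α := fun x =>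
    if hA : x ∈ A then ε ⟨x, hA⟩ else if hB : x ∈ B then ε.symm ⟨x, hB⟩ else x
  have hψA : ∀ x (hx : x ∈ A), ψ x = ε ⟨x, hx⟩ := fun x hx => dif_pos hx
  have hψB : ∀ x (hx : x ∈ B), ψ x = ε.symm ⟨x, hx⟩ := fun x hx =>
    (dif_neg (hBA x hx)).trans (dif_pos hx)
  have hψ : ∀ x, x ∉ A → x ∉ B → ψ x = x := fun x hA hB => (dif_neg hA).trans (dif_neg hB)
  refine ⟨ψ, fun x => ?_, fun x hx => ?_, fun x hx => ?_, hψ⟩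
  · by_cases hA : x ∈ A
    · rw [hψA x hA, hψB _ (ε _).2, Subtype.coe_eta, ε.symm_apply_apply]
    · by_cases hB : x ∈ B
      · rw [hψB x hB, hψA _ (ε.symm _).2, Subtype.coe_eta, ε.apply_symm_apply]
      · rw [hψ x hA hB, hψ x hA hB]
  · rw [hψA x hx]
    exact (ε _).2
  · rw [hψB x hx]
    exact (ε.symm _).2

/-- Inside a class the sum of the signs is the excess of positive over negative elements. By the
bounds there are enough elements satisfying `u`, all positive, to serve as that many fixed points;
the rest is matched bijectively. -/
theorem exists_involution_of_sum_bounds (key : α → κ) (s : α → ℤ) (hs : ∀ x, s x = 1 ∨ s x = -1)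
    (u : α → Prop) [DecidablePred u] (hu : ∀ x, u x → s x = 1)
    (h0 : ∀ k, 0 ≤ ∑ x with key x = k, s x)
    (h1 : ∀ k, ∑ x with key x = k, s x ≤ Finset.card {x | key x = k ∧ u x}) :
    ∃ φ : α → α, (∀ x, φ (φ x) = x) ∧ (∀ x, key (φ x) = key x) ∧
      (∀ x, φ x ≠ x → s (φ x) ≠ s x) ∧ ∀ x, φ x = x → u x := by
  have main : ∀ k, ∃ ψ : α → α, (∀ x, ψ (ψ x) = x) ∧ (∀ x, key x = k → key (ψ x) = k) ∧
      (∀ x, key x = k → ψ x ≠ x → s (ψ x) ≠ s x) ∧ ∀ x, key x = k → ψ x = x → u x := by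
    intro k
    let P : Finset α := {x | key x = k ∧ s x = 1}
    let N : Finset α := {x | key x = k ∧ s x = -1}
    let U : Finset α := {x | key x = k ∧ u x}
    have hP : ∀ x, x ∈ P ↔ key x = k ∧ s x = 1 := fun x => by simp [P]
    have hN : ∀ x, x ∈ N ↔ key x = k ∧ s x = -1 := fun x => by simp [N]
    have hU : ∀ x, x ∈ U ↔ key x = k ∧ u x := fun x => by simp [U]
    have hUP : U ⊆ P := fun x hx => (hP x).2 ⟨((hU x).1 hx).1, hu x ((hU x).1 hx).2⟩
    have hdisj : Disjoint P N := Finset.disjoint_left.2 fun x hx hx' => by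
      have h1 := ((hP x).1 hx).2
      have h2 := ((hN x).1 hx').2
      omega
    have hsum : ∑ x with key x = k, s x = P.card - N.card := by
      have : ({x | key x = k} : Finset α) = P ∪ N := by
        ext x
        rw [Finset.mem_union, hP, hN]
        have := hs x
        simp only [Finset.mem_filter, Finset.mem_univ, true_and]
        tauto
      rw [this, Finset.sum_union hdisj, Finset.sum_congr rfl fun x hx => ((hP x).1 hx).2,
        Finset.sum_congr rfl fun x hx => ((hN x).1 hx).2]
      simp
      ring
    have h0k := h0 k
    have h1k : ∑ x with key x = k, s x ≤ U.card := h1 k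
    rw [hsum] at h0k h1k
    -- `K` is the set of fixed points. The natural subtraction is exact because of the lower bound
    -- `h0k`.
    obtain ⟨K, hKU, hK⟩ := Finset.exists_subset_card_eq (s := U) (n := P.card - N.card) (by omega)
    obtain ⟨ψ, hψ, hψA, hψB, hψ'⟩ := Finset.exists_involution_of_card_eq (A := P \ K) (B := N)
      (Finset.disjoint_of_subset_left Finset.sdiff_subset hdisj) (by
        rw [Finset.card_sdiff_of_subset (hKU.trans hUP)]
        have := Finset.card_le_card hUP
        omega)
    have hcases : ∀ x, key x = k → x ∈ P \ K ∨ x ∈ N ∨ (x ∈ K ∧ x ∉ P \ K ∧ x ∉ N) := by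
      intro x hx
      by_cases hxK : x ∈ K
      · refine Or.inr (Or.inr ⟨hxK, by simp [hxK], ?_⟩)
        exact Finset.disjoint_left.1 hdisj (hUP (hKU hxK))
      · rcases hs x with h | h
        · exact Or.inl (Finset.mem_sdiff.2 ⟨(hP x).2 ⟨hx, h⟩, hxK⟩)
        · exact Or.inr (Or.inl ((hN x).2 ⟨hx, h⟩))
    refine ⟨ψ, hψ, fun x hx => ?_, fun x hx hne => ?_, fun x hx heq => ?_⟩
    · rcases hcases x hx with h | h | ⟨_, h, h'⟩
      · exact ((hN _).1 (hψA x h)).1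
      · exact ((hP _).1 (Finset.mem_sdiff.1 (hψB x h)).1).1
      · rw [hψ' x h h', hx]
    · rcases hcases x hx with h | h | ⟨_, h, h'⟩
      · rw [((hN _).1 (hψA x h)).2, ((hP _).1 (Finset.mem_sdiff.1 h).1).2]
        decide
      · rw [((hP _).1 (Finset.mem_sdiff.1 (hψB x h)).1).2, ((hN _).1 h).2]
        decide
      · exact absurd (hψ' x h h') hne
    · rcases hcases x hx with h | h | ⟨h, _⟩
      · have h2 := hψA x h
        rw [heq] at h2
        exact absurd h2 (Finset.disjoint_left.1 hdisj (Finset.mem_sdiff.1 h).1)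
      · have h2 := hψB x h
        rw [heq] at h2
        exact absurd h (Finset.disjoint_left.1 hdisj (Finset.mem_sdiff.1 h2).1)
      · exact ((hU x).1 (hKU h)).2
  choose ψ hψ hkey hne heq using main
  refine ⟨fun x => ψ (key x) x, fun x => ?_, fun x => hkey _ x rfl, fun x h => hne _ x rfl h,
    fun x h => heq _ x rfl h⟩
  change ψ (key (ψ (key x) x)) (ψ (key x) x) = x
  rw [hkey _ x rfl, hψ]

end Involution

/-! ### Coefficientwise order of polynomials -/

namespace MvPolynomial

/-- One inequality of polynomials compares the counts for all types at once. Rational coefficients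
supply the inverses of integers used for cliques. -/
noncomputable instance coeffPartialOrder : PartialOrder (MvPolynomial ℕ ℚ) :=
  PartialOrder.lift (fun p d => coeff d p) fun _ _ h => MvPolynomial.ext _ _ (congrFun h)

theorem coeff_le_iff {p q : MvPolynomial ℕ ℚ} : p ≤ q ↔ ∀ d, coeff d p ≤ coeff d q := Iff.rfl

instance : IsOrderedAddMonoid (MvPolynomial ℕ ℚ) where
  add_le_add_left p q h r := coeff_le_iff.2 fun d => by
    rw [coeff_add, coeff_add]
    exact add_le_add_left (h d) _

instance : ZeroLEOneClass (MvPolynomial ℕ ℚ) where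
  zero_le_one := coeff_le_iff.2 fun d => by
    rw [coeff_zero, coeff_one]
    split_ifs <;> norm_num

instance : IsOrderedRing (MvPolynomial ℕ ℚ) := IsOrderedRing.of_mul_nonneg fun p q hp hq =>
  coeff_le_iff.2 fun d => by
    rw [coeff_zero, coeff_mul]
    refine Finset.sum_nonneg fun x _ => mul_nonneg ?_ ?_
    · have := coeff_le_iff.1 hp x.1
      rwa [coeff_zero] at this
    · have := coeff_le_iff.1 hq x.2
      rwa [coeff_zero] at this

/-- The variables `e_n`, with `e_0 = 1`. -/
noncomputable def elemVar (n : ℕ) : MvPolynomial ℕ ℚ := if n = 0 then 1 else X n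

theorem elemVar_zero : elemVar 0 = 1 := if_pos rfl

theorem elemVar_nonneg (n : ℕ) : 0 ≤ elemVar n := by
  rw [elemVar]
  split_ifs
  · exact zero_le_one
  · refine coeff_le_iff.2 fun d => ?_
    rw [coeff_zero, coeff_X]
    split_ifs <;> norm_num

theorem exists_natCast_mul_eq_one (n : ℕ) (hn : 0 < n) :
    ∃ ρ : MvPolynomial ℕ ℚ, 0 ≤ ρ ∧ n * ρ = 1 := by
  refine ⟨C (n : ℚ)⁻¹, coeff_le_iff.2 fun d => ?_, ?_⟩
  · rw [coeff_zero, coeff_C]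
    split_ifs
    · positivity
    · exact le_rfl
  · rw [← map_natCast (C : ℚ →+* MvPolynomial ℕ ℚ), ← map_mul,
      mul_inv_cancel₀ (by exact_mod_cast hn.ne'), map_one]

theorem compWeight_elemVar {α : List ℕ} (hα : ∀ a ∈ α, 0 < a) :
    compWeight elemVar α = monomial (Multiset.toFinsupp (α : Multiset ℕ)) 1 := by
  induction α with
  | nil => simp [compWeight]
  | cons a α ih =>
    rw [List.forall_mem_cons] at hα
    have h : monomial (Multiset.toFinsupp ((a :: α : List ℕ) : Multiset ℕ)) (1 : ℚ) =
        X a * monomial (Multiset.toFinsupp (α : Multiset ℕ)) 1 := by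
      rw [← Multiset.cons_coe, ← Multiset.singleton_add, map_add, Multiset.toFinsupp_singleton, X,
        monomial_mul, one_mul]
    rw [h, ← ih hα.2, compWeight, List.map_cons, List.prod_cons, elemVar, if_neg hα.1.ne',
      compWeight]

end MvPolynomial

/-! ### Signed and unit counts of forest triples -/

namespace OrderedGraph

namespace ForestTriple

variable {G : OrderedGraph}

/-- The tree triple that contains the vertex `0`. -/
noncomputable def rootTriple (S : G.ForestTriple) : TreeTriple G.Vertex :=
  (S.2.choose_spec.2.2 0).choose

theorem rootTriple_mem (S : G.ForestTriple) : S.rootTriple ∈ S.1 :=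
  (S.2.choose_spec.2.2 0).choose_spec.1.1

theorem zero_mem_rootTriple (S : G.ForestTriple) : 0 ∈ S.rootTriple.verts :=
  (S.2.choose_spec.2.2 0).choose_spec.1.2

theorem eq_rootTriple (S : G.ForestTriple) {τ : TreeTriple G.Vertex} (hτ : τ ∈ S.1)
    (h : 0 ∈ τ.verts) : τ = S.rootTriple :=
  (S.2.choose_spec.2.2 0).choose_spec.2 τ ⟨hτ, h⟩

theorem comp_pos (S : G.ForestTriple) {τ : TreeTriple G.Vertex} (hτ : τ ∈ S.1) :
    ∀ a ∈ τ.comp, 0 < a := (S.2.choose_spec.2.1 τ hτ).2.2.1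

theorem rootTriple_bounds (S : G.ForestTriple) :
    1 ≤ S.rootTriple.r ∧ S.rootTriple.r ≤ S.rootTriple.first :=
  (S.2.choose_spec.2.1 _ S.rootTriple_mem).2.2.2.2

theorem prod_root {R : Type*} [CommRing R] (S : G.ForestTriple) (φ : List ℕ → R) (a r : ℕ) :
    (∏ τ ∈ S.1, if (0 : G.Vertex) ∈ τ.verts then
      (if τ.comp.headD 0 = a then (if τ.r = r then φ τ.comp else 0) else 0) else φ τ.comp) =
      if S.rootTriple.first = a ∧ S.rootTriple.r = r then ∏ τ ∈ S.1, φ τ.comp else 0 := by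
  classical
  rw [← Finset.mul_prod_erase _ _ S.rootTriple_mem, if_pos S.zero_mem_rootTriple,
    ← Finset.mul_prod_erase _ (fun τ => φ τ.comp) S.rootTriple_mem,
    Finset.prod_congr rfl fun τ hτ => if_neg fun h => (Finset.mem_erase.1 hτ).1
      (S.eq_rootTriple (Finset.mem_erase.1 hτ).2 h)]
  change (if S.rootTriple.first = a then _ else _) * _ = _
  by_cases ha : S.rootTriple.first = a
  · by_cases hr : S.rootTriple.r = r
    · rw [if_pos ha, if_pos hr, if_pos ⟨ha, hr⟩]
    · rw [if_pos ha, if_neg hr, if_neg fun h => hr h.2, zero_mul]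
  · rw [if_neg ha, if_neg fun h => ha h.1, zero_mul]

theorem prod_compWeight (S : G.ForestTriple) :
    ∏ τ ∈ S.1, compWeight MvPolynomial.elemVar τ.comp =
      MvPolynomial.monomial (Multiset.toFinsupp S.type) 1 := by
  rw [type, map_sum, MvPolynomial.monomial_sum_one]
  exact Finset.prod_congr rfl fun τ hτ => MvPolynomial.compWeight_elemVar (S.comp_pos hτ)

theorem prod_sign {R : Type*} [CommRing R] (S : G.ForestTriple) :
    ∏ τ ∈ S.1, (-1 : R) ^ (τ.comp.length - 1) = (S.sign : R) := by
  rw [Finset.prod_pow_eq_pow_sum, sign]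
  push_cast
  rfl

theorem sign_eq (S : G.ForestTriple) : S.sign = 1 ∨ S.sign = -1 :=
  neg_one_pow_eq_or ℤ _

theorem IsUnit.sign_eq_one {S : G.ForestTriple} (h : S.IsUnit) : S.sign = 1 := by
  rw [sign, Finset.sum_eq_zero fun τ hτ => by rw [h τ hτ]; rfl, pow_zero]

/-- The type of a forest triple and the data `α_1`, `r` of the tree triple of the vertex `0`. -/
noncomputable def rootKey (S : G.ForestTriple) : Multiset ℕ × ℕ × ℕ :=
  (S.type, S.rootTriple.first, S.rootTriple.r)

/-- The conditions on `α_1` and `r` only alter the weight of the root tree, and the factor `e a`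
comes out by linearity in that weight. -/
theorem sum_prod_root {R : Type*} [CommRing R] (φ : List ℕ → R) (e : ℕ → R) (a r : ℕ)
    (w g : ℕ → R) (hw : ∀ n, ∑ x ∈ treeData n, φ x.1 = w n)
    (hg : ∀ n, (∑ x ∈ treeData n, if x.1.headD 0 = a then (if x.2 = r then φ x.1 else 0) else 0) =
      e a * g n) :
    (∑ S : G.ForestTriple, if S.rootTriple.first = a ∧ S.rootTriple.r = r then
      ∏ τ ∈ S.1, φ τ.comp else 0) = e a * G.rootSum w g := by
  simp_rw [← prod_root]
  rw [sum_forestTriple G fun B α s => if (0 : G.Vertex) ∈ B then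
    (if α.headD 0 = a then (if s = r then φ α else 0) else 0) else φ α]
  obtain ⟨W, N, -, hW⟩ := isFiniteFunctional_rootSum G w
  trans G.rootSum w fun n => e a * g n
  · refine congrArg _ (funext fun B => ?_)
    rw [rootWeight, ← hg, ← hw]
    split_ifs <;> rfl
  · rw [hW (N + 1) N.lt_succ_self, hW (N + 1) N.lt_succ_self, Finset.mul_sum]
    exact Finset.sum_congr rfl fun j _ => mul_left_comm _ _ _

open MvPolynomial in
theorem sum_sign_monomial {a r : ℕ} (hr : 1 ≤ r) (hra : r ≤ a) :
    (∑ S : G.ForestTriple, if S.rootTriple.first = a ∧ S.rootTriple.r = r then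
      (S.sign : MvPolynomial ℕ ℚ) * monomial (Multiset.toFinsupp S.type) 1 else 0) =
      elemVar a * G.rootSum (signedPower elemVar) (shiftedComplete elemVar a) := by
  rw [← sum_prod_root (fun α => (-1) ^ (α.length - 1) * compWeight elemVar α) elemVar a r
    (signedPower elemVar) (shiftedComplete elemVar a) fun _ => rfl]
  · refine Finset.sum_congr rfl fun S _ => ?_
    rw [Finset.prod_mul_distrib, prod_sign, prod_compWeight]
  · intro n
    rw [sum_treeData_first _ hr hra, shiftedComplete, mul_ite, mul_zero]
    refine if_ctx_congr (by omega) (fun h => ?_) fun _ => rfl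
    congr
    omega

open MvPolynomial in
open Classical in
theorem sum_unit_monomial {a r : ℕ} (hr : 1 ≤ r) (hra : r ≤ a) :
    (∑ S : G.ForestTriple, if S.rootTriple.first = a ∧ S.rootTriple.r = r then
      (if S.IsUnit then monomial (Multiset.toFinsupp S.type) (1 : ℚ) else 0) else 0) =
      elemVar a * G.rootSum (unitWeight elemVar) fun j => if j = a then 1 else 0 := by
  rw [← sum_prod_root (fun α => if α.length = 1 then compWeight elemVar α else 0) elemVar a r
    (unitWeight elemVar) (fun j => if j = a then 1 else 0) fun n => sum_treeData_unit _ n]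
  · refine Finset.sum_congr rfl fun S _ => ?_
    rw [Finset.prod_ite_zero, prod_compWeight]
    exact if_congr Iff.rfl (if_congr Iff.rfl rfl rfl) rfl
  · intro n
    rw [sum_treeData_unit_first _ hr hra, mul_ite, mul_one, mul_zero]

open Classical in
-- These are the inequalities of `IsBounded` multiplied by `e_a`, read off at the monomial of the
-- type `μ`.
theorem sum_sign_bounds (hG : G.IsCycleCliqueChain) (k : Multiset ℕ × ℕ × ℕ) :
    0 ≤ ∑ S : G.ForestTriple with S.rootKey = k, S.sign ∧
      ∑ S : G.ForestTriple with S.rootKey = k, S.sign ≤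
        Finset.card {S : G.ForestTriple | S.rootKey = k ∧ S.IsUnit} := by
  obtain ⟨μ, a, r⟩ := k
  have hkey : ∀ S : G.ForestTriple, S.rootKey = (μ, a, r) ↔
      (S.rootTriple.first = a ∧ S.rootTriple.r = r) ∧ S.type = μ := fun S => by
    rw [rootKey, Prod.mk.injEq, Prod.mk.injEq, and_comm]
  by_cases hr : 1 ≤ r ∧ r ≤ a
  · have hB := hG.isBounded MvPolynomial.elemVar_zero MvPolynomial.elemVar_nonneg
      MvPolynomial.exists_natCast_mul_eq_one
    have ha : 1 ≤ a := hr.1.trans hr.2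
    have h0 := mul_nonneg (MvPolynomial.elemVar_nonneg a) (hB.nonneg a ha)
    have h1 := mul_le_mul_of_nonneg_left (hB.le a ha) (MvPolynomial.elemVar_nonneg a)
    rw [← sum_sign_monomial hr.1 hr.2] at h0 h1
    rw [← sum_unit_monomial hr.1 hr.2] at h1
    have hs : MvPolynomial.coeff (Multiset.toFinsupp μ) (∑ S : G.ForestTriple,
        if S.rootTriple.first = a ∧ S.rootTriple.r = r then (S.sign : MvPolynomial ℕ ℚ) *
          MvPolynomial.monomial (Multiset.toFinsupp S.type) 1 else 0) =
        ((∑ S : G.ForestTriple with S.rootKey = (μ, a, r), S.sign : ℤ) : ℚ) := by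
      rw [MvPolynomial.coeff_sum, Finset.sum_filter, Int.cast_sum]
      refine Finset.sum_congr rfl fun S _ => ?_
      have h : MvPolynomial.coeff (Multiset.toFinsupp μ) ((S.sign : MvPolynomial ℕ ℚ) *
          MvPolynomial.monomial (Multiset.toFinsupp S.type) 1) =
          if S.type = μ then (S.sign : ℚ) else 0 := by
        rw [← map_intCast (MvPolynomial.C : ℚ →+* MvPolynomial ℕ ℚ), MvPolynomial.coeff_C_mul,
          MvPolynomial.coeff_monomial, mul_ite, mul_one, mul_zero]
        exact if_congr (Multiset.toFinsupp.injective.eq_iff) rfl rfl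
      simp_rw [hkey, ite_and, apply_ite (MvPolynomial.coeff _), h, MvPolynomial.coeff_zero,
        apply_ite (Int.cast : ℤ → ℚ), Int.cast_zero]
    have hu : MvPolynomial.coeff (Multiset.toFinsupp μ) (∑ S : G.ForestTriple,
        if S.rootTriple.first = a ∧ S.rootTriple.r = r then
          (if S.IsUnit then MvPolynomial.monomial (Multiset.toFinsupp S.type) (1 : ℚ) else 0)
          else 0) =
        (Finset.card {S : G.ForestTriple | S.rootKey = (μ, a, r) ∧ S.IsUnit} : ℚ) := by
      rw [MvPolynomial.coeff_sum, Finset.card_filter, Nat.cast_sum]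
      refine Finset.sum_congr rfl fun S _ => ?_
      simp_rw [hkey, ite_and]
      split_ifs with h h' h'' <;>
        simp_all [MvPolynomial.coeff_monomial]
    have h0' := MvPolynomial.coeff_le_iff.1 h0 (Multiset.toFinsupp μ)
    have h1' := MvPolynomial.coeff_le_iff.1 h1 (Multiset.toFinsupp μ)
    rw [hs, MvPolynomial.coeff_zero] at h0'
    rw [hs, hu] at h1'
    exact ⟨by exact_mod_cast h0', by exact_mod_cast h1'⟩
  -- No forest triple violates `1 ≤ r ≤ α_1`, so such a class is empty.
  · rw [Finset.filter_false_of_mem, Finset.sum_empty]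
    · exact ⟨le_rfl, Nat.cast_nonneg _⟩
    · intro S _ hS
      obtain ⟨⟨rfl, rfl⟩, _⟩ := (hkey S).1 hS
      exact hr S.rootTriple_bounds

theorem exists_isFirstPreservingInvolution (hG : G.IsCycleCliqueChain) :
    ∃ φ : G.ForestTriple → G.ForestTriple, IsFirstPreservingInvolution φ := by
  classical
  obtain ⟨φ, h1, h2, h3, h4⟩ := exists_involution_of_sum_bounds (rootKey (G := G)) sign sign_eq
    IsUnit (fun _ h => h.sign_eq_one) (fun k => (sum_sign_bounds hG k).1)
    fun k => (sum_sign_bounds hG k).2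
  refine ⟨φ, ⟨⟨h1, fun S => congrArg Prod.fst (h2 S), h3, fun S h => (h4 S h).sign_eq_one⟩, h4,
    fun S τ hτ h τ' hτ' h' => ?_⟩⟩
  rw [S.eq_rootTriple hτ h, (φ S).eq_rootTriple hτ' h']
  exact Prod.mk.inj (Prod.mk.inj (h2 S)).2

end ForestTriple

end OrderedGraph

/-! ### Power sums and proper colorings -/

section Newton

variable {σ A : Type*} [Fintype σ] [CommRing A] (x : σ → A)

/-- `(-1)^{n-1} ∑_i x_i^n`. -/
def signedPsum (n : ℕ) : A := (-1) ^ (n - 1) * ∑ i, x i ^ n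

theorem esymm_map_zero : (Finset.univ.val.map x).esymm 0 = 1 := by
  simp [Multiset.esymm]

theorem sum_antidiagonal_esymm_mul_signedPsum (n : ℕ) :
    ∑ a ∈ Finset.HasAntidiagonal.antidiagonal n, (Finset.univ.val.map x).esymm a.1 *
      (if a.2 = 0 then 0 else signedPsum x a.2) = n * (Finset.univ.val.map x).esymm n := by
  have h := congrArg (MvPolynomial.aeval x) (MvPolynomial.mul_esymm_eq_sum σ ℤ n)
  simp only [map_mul, map_natCast, map_sum, map_pow, map_neg, map_one, MvPolynomial.psum,
    MvPolynomial.aeval_esymm_eq_multiset_esymm, MvPolynomial.aeval_X] at h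
  rw [h, Finset.mul_sum, Finset.sum_filter]
  refine Finset.sum_congr rfl fun a ha => ?_
  rw [Finset.HasAntidiagonal.mem_antidiagonal] at ha
  by_cases h2 : a.2 = 0
  · rw [if_pos h2, if_neg (by omega), mul_zero]
  · have h3 : (-1 : A) ^ (a.2 - 1) = (-1) ^ (n + 1) * (-1) ^ a.1 := by
      rw [← pow_add, show n + 1 + a.1 = 2 * (a.1 + 1) + (a.2 - 1) by omega, pow_add, pow_mul,
        neg_one_sq, one_pow, one_mul]
    rw [if_neg h2, if_pos (by omega), signedPsum, h3]
    ring

/-- Newton's identities say that `E · ∑ (-1)^{n-1} p_n x^n = xE'`; multiplication by `1/E` gives the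
generating function of `signedPower`. -/
theorem signedPower_esymm (n : ℕ) :
    signedPower (Finset.univ.val.map x).esymm n = if n = 0 then 0 else signedPsum x n := by
  set e := (Finset.univ.val.map x).esymm
  have hE := mk_mul_mk_signedComplete e (esymm_map_zero x)
  have h1 : PowerSeries.mk e * PowerSeries.mk (fun n => if n = 0 then 0 else signedPsum x n) =
      PowerSeries.mk fun n => n * e n := by
    ext n
    rw [PowerSeries.coeff_mul, PowerSeries.coeff_mk, ← sum_antidiagonal_esymm_mul_signedPsum]
    simp only [PowerSeries.coeff_mk, e]
  have h2 : PowerSeries.mk (signedPower e) =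
      (PowerSeries.mk fun n => n * e n) * PowerSeries.mk (signedComplete e) := by
    ext n
    rw [PowerSeries.coeff_mul, PowerSeries.coeff_mk,
      Finset.Nat.sum_antidiagonal_eq_sum_range_succ_mk]
    simp only [PowerSeries.coeff_mk]
    cases n with
    | zero => simp [signedPower_zero]
    | succ n =>
      rw [Finset.sum_range_succ', signedPower_succ, Nat.cast_zero, zero_mul, zero_mul, add_zero]
      exact Finset.sum_congr rfl fun i _ => by rw [Nat.add_sub_add_right]
  have h3 : PowerSeries.mk (signedPower e) =
      PowerSeries.mk (fun n => if n = 0 then 0 else signedPsum x n) := by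
    rw [h2, ← h1]
    linear_combination (PowerSeries.mk fun n => if n = 0 then 0 else signedPsum x n) * hE
  have h4 := congrArg (PowerSeries.coeff n) h3
  rwa [PowerSeries.coeff_mk, PowerSeries.coeff_mk] at h4

end Newton

section Coloring

open Setoid

variable {V σ A : Type*} [Fintype V] [DecidableEq V] [Fintype σ] [CommRing A]
  (x : σ → A)

open Classical in
-- Expanding the product chooses a color for each block, which is a coloring constant on the blocks.
theorem prod_blocks_psum (π : Setoid V) :
    ∏ B ∈ π.blocks Finset.univ, ∑ i, x i ^ B.card =
      ∑ κ : V → σ with π ≤ ker κ, ∏ v, x (κ v) := by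
  rw [← Finset.prod_coe_sort, Finset.prod_univ_sum, Fintype.piFinset_univ]
  have hb : ∀ v : V, π.block Finset.univ v ∈ π.blocks Finset.univ := fun v =>
    block_mem_blocks π (Finset.mem_univ v)
  refine Finset.sum_nbij (fun h v => h ⟨_, hb v⟩) (fun h _ => ?_) ?_ ?_ fun h _ => ?_
  · rw [Finset.mem_filter]
    refine ⟨Finset.mem_univ _, fun u v huv => ?_⟩
    rw [ker_def]
    congr 2
    exact block_congr huv
  · intro h _ h' _ hh
    funext B
    obtain ⟨v, -, hv⟩ := mem_blocks.1 B.2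
    have := congrFun hh v
    have hB : B = ⟨_, hb v⟩ := Subtype.ext hv.symm
    rwa [hB]
  · intro κ hκ
    have hκ' : π ≤ ker κ := (Finset.mem_filter.1 hκ).2
    choose v _ hv using fun B : {B // B ∈ π.blocks Finset.univ} => mem_blocks.1 B.2
    refine ⟨fun B => κ (v B), Finset.mem_coe.2 (Finset.mem_univ _), funext fun u => ?_⟩
    refine hκ' ?_
    have h := self_mem_block π (Finset.mem_univ u)
    exact (mem_block.1 ((hv ⟨_, hb u⟩).ge h)).2
  · rw [← Finset.prod_fiberwise_of_maps_to (g := fun v => (⟨_, hb v⟩ : {B // B ∈ π.blocks _}))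
      (t := Finset.univ) fun v _ => Finset.mem_univ _]
    refine Finset.prod_congr rfl fun B _ => ?_
    rw [Finset.prod_congr rfl fun v hv => congrArg (fun B => x (h B)) (Finset.mem_filter.1 hv).2,
      Finset.prod_const]
    congr 2
    ext v
    rw [Finset.mem_filter, Subtype.ext_iff]
    constructor
    · intro h
      refine ⟨Finset.mem_univ _, (eq_block_of_mem B.2 h).symm⟩
    · rintro ⟨-, h⟩
      rw [← h]
      exact self_mem_block π (Finset.mem_univ v)

open Classical in
-- Inclusion–exclusion: the sublists whose elements all lie below `k` cancel unless there is only
-- the empty one.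
theorem altSum_indicator {Λ : Type*} [SemilatticeSup Λ] (l : List Λ) (k π : Λ) (a : A) :
    altSum l (fun ρ => if ρ ≤ k then a else 0) π =
      if π ≤ k ∧ ∀ s ∈ l, ¬ s ≤ k then a else 0 := by
  induction l generalizing π with
  | nil => simp [altSum]
  | cons s l ih =>
    simp only [altSum, ih, sup_le_iff, List.forall_mem_cons]
    split_ifs <;> simp_all

open Classical in
-- The block signs multiply to `(-1)^|V|` and cancel the prefactor; inclusion–exclusion over the
-- monochromatic edges then leaves the proper colorings.
theorem forestSum_signedPsum (l : List (Sym2 V)) :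
    forestSum Finset.univ l (fun B => signedPsum x B.card) =
      ∑ κ : V → σ with ∀ s ∈ l, ¬ ofEdge s ≤ ker κ, ∏ v, x (κ v) := by
  have h : ∀ π : Setoid V, blockProd Finset.univ (fun B => -signedPsum x B.card) π =
      (-1) ^ Finset.card (Finset.univ : Finset V) *
        ∑ κ : V → σ, if π ≤ ker κ then ∏ v, x (κ v) else 0 := by
    intro π
    rw [← Finset.sum_filter, ← prod_blocks_psum, blockProd]
    have h1 : ∀ B ∈ π.blocks Finset.univ, -signedPsum x B.card =
        (-1) ^ B.card * ∑ i, x i ^ B.card := by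
      intro B hB
      obtain ⟨n, hn⟩ := Nat.exists_eq_succ_of_ne_zero
        (Finset.card_pos.2 (nonempty_of_mem_blocks hB)).ne'
      rw [signedPsum, hn, Nat.succ_sub_one, pow_succ]
      ring
    rw [Finset.prod_congr rfl h1, Finset.prod_mul_distrib, Finset.prod_pow_eq_pow_sum]
    congr 2
    rw [Finset.card_eq_sum_card_fiberwise (f := π.block Finset.univ) (t := π.blocks Finset.univ)
      fun v _ => block_mem_blocks π (Finset.mem_univ v)]
    refine Finset.sum_congr rfl fun B hB => congrArg _ ?_
    ext v
    rw [Finset.mem_filter]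
    exact ⟨fun h => ⟨Finset.mem_univ _, (eq_block_of_mem hB h).symm⟩,
      fun h => h.2 ▸ self_mem_block π (Finset.mem_univ v)⟩
  rw [forestSum, funext h, altSum_mul_left, ← mul_assoc, ← mul_pow, neg_one_mul, neg_neg, one_pow,
    one_mul, altSum_sum, Finset.sum_filter]
  refine Finset.sum_congr rfl fun κ _ => ?_
  rw [altSum_indicator]
  refine if_congr ?_ rfl rfl
  simp

end Coloring

namespace OrderedGraph

variable {G : OrderedGraph} {σ A : Type*} [Fintype σ] [CommRing A] (x : σ → A)

theorem graph_adj {u v : G.Vertex} : G.graph.Adj u v ↔ s(u, v) ∈ G.edges := by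
  rw [graph, SimpleGraph.fromEdgeSet_adj]
  refine ⟨fun h => h.1, fun h => ⟨h, fun huv => ?_⟩⟩
  exact G.loopless _ h (Sym2.mk_isDiag_iff.2 huv)

/-- Adjacent vertices have different colors. -/
def IsProper (G : OrderedGraph) (κ : G.Vertex → σ) : Prop := ∀ u v, G.graph.Adj u v → κ u ≠ κ v

open Classical in
/-- The expansion of the chromatic symmetric polynomial in elementary symmetric polynomials. -/
theorem sum_coloring_eq_sum_forestTriple :
    ∑ κ : G.Vertex → σ with G.IsProper κ, ∏ v, x (κ v) =
      ∑ S : G.ForestTriple, (S.sign : A) * (S.type.map (Finset.univ.val.map x).esymm).prod := by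
  have h : ∀ S : G.ForestTriple, (S.sign : A) * (S.type.map (Finset.univ.val.map x).esymm).prod =
      ∏ τ ∈ S.1, (-1) ^ (τ.comp.length - 1) *
        compWeight (Finset.univ.val.map x).esymm τ.comp := by
    intro S
    rw [Finset.prod_mul_distrib, ForestTriple.prod_sign, ForestTriple.type]
    congr 1
    induction S.1 using Finset.induction_on with
    | empty => simp
    | insert τ T hτ ih =>
      rw [Finset.sum_insert hτ, Finset.prod_insert hτ, Multiset.map_add, Multiset.prod_add, ih]
      rfl
  rw [Finset.sum_congr rfl fun S _ => h S, sum_forestTriple G fun _ α _ =>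
    (-1) ^ (α.length - 1) * compWeight (Finset.univ.val.map x).esymm α]
  trans forestSum Finset.univ G.edges fun B => signedPsum x B.card
  · rw [forestSum_signedPsum]
    refine Finset.sum_congr (Finset.filter_congr fun κ _ => ?_) fun _ _ => rfl
    constructor
    · intro h s hs
      induction s with | _ u v
      rw [Setoid.ofEdge_le_iff]
      exact h u v (graph_adj.2 hs)
    · intro h u v huv
      have := h _ (graph_adj.1 huv)
      rwa [Setoid.ofEdge_le_iff] at this
  · refine forestSum_congr _ fun B _ hB => ?_
    exact (if_neg (Finset.card_pos.2 hB).ne').symm.trans (signedPower_esymm x _).symm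

end OrderedGraph

/-! ### e-positivity -/

namespace MvPowerSeries

/-- `f` and `g` have the same coefficients at all monomials in the variables `x_i`, `i < N`. -/
def AgreeBelow (N : ℕ) (f g : MvPowerSeries ℕ ℤ) : Prop :=
  ∀ d : ℕ →₀ ℕ, d.support ⊆ Finset.range N → coeff d f = coeff d g

variable {N : ℕ}

theorem AgreeBelow.mul {f g f' g' : MvPowerSeries ℕ ℤ} (h : AgreeBelow N f g)
    (h' : AgreeBelow N f' g') : AgreeBelow N (f * f') (g * g') := fun d hd => by
  classical
  rw [coeff_mul, coeff_mul]
  refine Finset.sum_congr rfl fun a ha => ?_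
  have ha := Finset.HasAntidiagonal.mem_antidiagonal.1 ha
  rw [h _ (le_trans (Finsupp.support_mono (ha ▸ le_self_add)) hd),
    h' _ (le_trans (Finsupp.support_mono (ha ▸ le_add_self)) hd)]

theorem AgreeBelow.multiset_prod {f g : ℕ → MvPowerSeries ℕ ℤ} (h : ∀ k, AgreeBelow N (f k) (g k))
    (μ : Multiset ℕ) : AgreeBelow N (μ.map f).prod (μ.map g).prod := by
  induction μ using Multiset.induction_on with
  | empty => exact fun _ _ => by simp
  | cons k μ ih =>
    rw [Multiset.map_cons, Multiset.map_cons, Multiset.prod_cons, Multiset.prod_cons]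
    exact (h k).mul ih

theorem prod_X {ι : Type*} (s : Finset ι) (f : ι → ℕ) :
    ∏ i ∈ s, (X (f i) : MvPowerSeries ℕ ℤ) = monomial (∑ i ∈ s, Finsupp.single (f i) 1) 1 := by
  simp_rw [X_def]
  rw [prod_monomial, Finset.prod_const_one]

theorem sum_single_eq_iff (t : Finset ℕ) (d : ℕ →₀ ℕ) :
    d = ∑ i ∈ t, Finsupp.single i 1 ↔ (∀ i, d i ≤ 1) ∧ t = d.support := by
  have h : ∀ j, (∑ i ∈ t, Finsupp.single i 1 : ℕ →₀ ℕ) j = if j ∈ t then 1 else 0 := fun j => by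
    simp [Finsupp.finsetSum_apply, Finsupp.single_apply]
  constructor
  · rintro rfl
    refine ⟨fun i => ?_, ?_⟩
    · rw [h]
      split_ifs <;> simp
    · ext i
      rw [Finsupp.mem_support_iff, h]
      simp
  · rintro ⟨h1, rfl⟩
    ext j
    rw [h]
    have := h1 j
    split_ifs with hj
    · have := Finsupp.mem_support_iff.1 hj
      omega
    · exact Finsupp.notMem_support_iff.1 hj

theorem agreeBelow_elementarySymm (N k : ℕ) : AgreeBelow N (elementarySymm k)
    ((Finset.univ.val.map fun i : Fin N => (X (i : ℕ) : MvPowerSeries ℕ ℤ)).esymm k) := by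
  classical
  intro d hd
  have h : (Finset.univ.val.map fun i : Fin N => (X (i : ℕ) : MvPowerSeries ℕ ℤ)) =
      (Finset.range N).val.map X := by
    rw [show Finset.range N = Finset.Iio N from (Nat.Iio_eq_range N).symm, ← Fin.map_valEmbedding_univ, Finset.map_val, Multiset.map_map]
    rfl
  rw [h, Finset.esymm_map_val, map_sum]
  have h2 : ∀ t ∈ (Finset.range N).powersetCard k,
      coeff d (∏ i ∈ t, (X i : MvPowerSeries ℕ ℤ)) =
        if t = d.support then (if ∀ i, d i ≤ 1 then 1 else 0) else 0 := by
    intro t _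
    rw [prod_X t fun i => i, coeff_monomial, ← ite_and]
    exact if_congr ((sum_single_eq_iff t d).trans and_comm) rfl rfl
  rw [Finset.sum_congr rfl h2, Finset.sum_ite_eq']
  change (if _ then _ else _) = _
  rw [ite_and]
  by_cases hd1 : ∀ i, d i ≤ 1
  · have : d.degree = d.support.card := by
      rw [Finsupp.degree, Finset.card_eq_sum_ones]
      refine Finset.sum_congr rfl fun i hi => ?_
      have := hd1 i
      have := Finsupp.mem_support_iff.1 hi
      omega
    rw [if_pos hd1, if_pos hd1, this]
    exact if_congr ⟨fun h => Finset.mem_powersetCard.2 ⟨hd, h⟩,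
      fun h => (Finset.mem_powersetCard.1 h).2⟩ rfl rfl
  · rw [if_neg hd1, if_neg hd1, ite_self]

end MvPowerSeries

/-! ### The chromatic symmetric function as a signed sum over forest triples -/

namespace OrderedGraph

variable {G : OrderedGraph}

open MvPowerSeries

open Classical in
theorem agreeBelow_chromaticSymmetricFunction (N : ℕ) :
    AgreeBelow N G.graph.chromaticSymmetricFunction
      (∑ κ : G.Vertex → Fin N with G.IsProper κ, ∏ v, X (κ v : ℕ)) := by
  intro d hd
  have h : ∀ κ : G.Vertex → Fin N, coeff d (∏ v, (X (κ v : ℕ) : MvPowerSeries ℕ ℤ)) =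
      if ∑ v, Finsupp.single (κ v : ℕ) 1 = d then 1 else 0 := fun κ => by
    rw [prod_X Finset.univ fun v => (κ v : ℕ), coeff_monomial]
    exact if_congr eq_comm rfl rfl
  rw [map_sum, Finset.sum_congr rfl fun κ _ => h κ, Finset.sum_boole, Finset.filter_filter]
  change ((Nat.card _ : ℕ) : ℤ) = _
  rw [← Fintype.card_subtype, ← Nat.card_eq_fintype_card, Nat.cast_inj]
  refine (Nat.card_congr (Equiv.ofBijective (fun κ => ⟨SimpleGraph.Coloring.mk
    (fun v => (κ.1 v : ℕ)) fun {u v} huv h => κ.2.1 u v huv (Fin.ext h), κ.2.2⟩) ⟨?_, ?_⟩)).symm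
  · intro κ κ' hκ
    refine Subtype.ext (funext fun v => Fin.ext ?_)
    exact DFunLike.congr_fun (Subtype.ext_iff.1 hκ) v
  · rintro ⟨κ, hκ⟩
    have hlt : ∀ v, κ v < N := fun v => by
      refine Finset.mem_range.1 (hd (Finsupp.mem_support_iff.2 ?_))
      rw [← hκ, Finsupp.finsetSum_apply]
      refine (Finset.sum_pos' (fun _ _ => Nat.zero_le _) ⟨v, Finset.mem_univ v, ?_⟩).ne'
      simp
    exact ⟨⟨fun v => ⟨κ v, hlt v⟩, fun u v huv h => κ.valid huv (Fin.mk.inj h), hκ⟩, rfl⟩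

namespace ForestTriple

theorem pos_of_mem_type (S : G.ForestTriple) {i : ℕ} (hi : i ∈ S.type) : 0 < i := by
  obtain ⟨τ, hτ, hi⟩ := Multiset.mem_sum.1 hi
  exact S.comp_pos hτ i hi

theorem sum_type (S : G.ForestTriple) : S.type.sum = Fintype.card G.Vertex := by
  classical
  obtain ⟨S, F, hF, hS, hv⟩ := S
  change (∑ τ ∈ S, (τ.comp : Multiset ℕ)).sum = _
  rw [← Multiset.coe_sumAddMonoidHom, map_sum]
  have h : ∀ τ ∈ S, Multiset.sumAddMonoidHom (τ.comp : Multiset ℕ) =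
      ∑ v : G.Vertex, if v ∈ τ.verts then 1 else 0 := fun τ hτ => by
    rw [Finset.sum_boole, Finset.filter_univ_mem, Nat.cast_id, ← (hS τ hτ).2.2.2.1]
    exact Multiset.sum_coe _
  rw [Finset.sum_congr rfl h, Finset.sum_comm, Fintype.card_eq_sum_ones]
  refine Finset.sum_congr rfl fun v _ => ?_
  obtain ⟨τ, ⟨hτ, hvτ⟩, hτ'⟩ := hv v
  rw [Finset.sum_eq_single_of_mem τ hτ fun τ' h hne => if_neg fun h' => hne (hτ' τ' ⟨h, h'⟩),
    if_pos hvτ]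

/-- The type of a forest triple as a partition of the number of vertices. -/
def partition (S : G.ForestTriple) : (Fintype.card G.Vertex).Partition where
  parts := S.type
  parts_pos := S.pos_of_mem_type
  parts_sum := S.sum_type

end ForestTriple

theorem chromaticSymmetricFunction_eq_sum_forestTriple :
    G.graph.chromaticSymmetricFunction =
      ∑ S : G.ForestTriple, S.sign • elementarySymmPartition S.partition := by
  ext d
  -- A monomial involves finitely many variables, so the identity for `N` colors determines its
  -- coefficient.
  obtain ⟨N, hN⟩ := d.support.exists_nat_subset_range
  rw [agreeBelow_chromaticSymmetricFunction N d hN,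
    sum_coloring_eq_sum_forestTriple fun i : Fin N => (X (i : ℕ) : MvPowerSeries ℕ ℤ),
    map_sum, map_sum]
  refine Finset.sum_congr rfl fun S _ => ?_
  rw [← zsmul_eq_mul, map_zsmul, map_zsmul,
    ← AgreeBelow.multiset_prod (agreeBelow_elementarySymm N) S.type d hN]
  rfl

/-- The coefficient of `e_λ` is the signed number of forest triples of type `λ`, and it is a sum of
the non-negative signed counts of the classes. -/
theorem ePositive (hG : G.IsCycleCliqueChain) : G.graph.EPositive := by
  classical
  refine ⟨fun p => ∑ S : G.ForestTriple with S.partition = p, S.sign, ?_, fun p => ?_⟩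
  · rw [chromaticSymmetricFunction_eq_sum_forestTriple, ← Finset.sum_fiberwise _ ForestTriple.partition]
    refine Finset.sum_congr rfl fun p _ => ?_
    rw [Finset.sum_smul]
    exact Finset.sum_congr rfl fun S hS => by rw [(Finset.mem_filter.1 hS).2]
  · change 0 ≤ ∑ S : G.ForestTriple with S.partition = p, S.sign
    rw [← Finset.sum_fiberwise_of_maps_to (g := ForestTriple.rootKey)
      fun S hS => Finset.mem_image_of_mem ForestTriple.rootKey hS]
    refine Finset.sum_nonneg fun k hk => ?_
    obtain ⟨S₀, hS₀, rfl⟩ := Finset.mem_image.1 hk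
    -- The root key determines the type, so each fibre is a whole class.
    rw [Finset.filter_filter, Finset.filter_congr (q := fun S => S.rootKey = S₀.rootKey)]
    · exact (ForestTriple.sum_sign_bounds hG _).1
    · intro S _
      refine ⟨fun h => h.2, fun h => ⟨?_, h⟩⟩
      rw [← (Finset.mem_filter.1 hS₀).2]
      exact Nat.Partition.ext (congrArg Prod.fst h)

end OrderedGraph
theorem mainTheorem4 (G : OrderedGraph) (hG : G.IsCycleCliqueChain) :
    (∃ φ : G.ForestTriple → G.ForestTriple,
      OrderedGraph.ForestTriple.IsFirstPreservingInvolution φ) ∧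
    G.graph.EPositive :=
  ⟨OrderedGraph.ForestTriple.exists_isFirstPreservingInvolution hG, OrderedGraph.ePositive hG⟩
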